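/- Let $M$ be a finite simple graph all of whose connected components are Coxeter graphs of type $A_n$ $(n\ge 1)$, $D_n$ $(n\ge 4)$, $E_6$, $E_7$ or $E_8$, and write $i\sim j$ for adjacency of nodes. The Brauer monoid ${\rm BrM}(M)$ is the monoid generated by $\delta,\delta^{-1}$ and $r_i,e_i$ ($i$ a node of $M$), where $\delta$ is central, $\delta\delta^{-1}=1$, and $$r_i^2=1,\quad e_ir_i=e_i=r_ie_i,\quad e_i^2=\delta e_i\qquad\text{for all } i,$$ $$r_ir_j=r_jr_i,\quad e_ir_j=r_je_i,\quad e_ie_j=e_je_i\qquad\text{for } i\not\sim j,$$ $$r_ir_jr_i=r_jr_ir_j,\quad r_je_ir_j=r_ie_jr_i,\quad r_jr_ie_j=e_ie_j\qquad\text{for } i\sim j.$$ The Brauer algebra is ${\rm Br}(M)=\mathbb Z[{\rm BrM}(M)]$. Let $W$ be the Coxeter group of type $M$, with simple reflections $r_i$, acting on its root system $\Phi$ with simple roots $\alpha_i$, all roots being normalized by $(\alpha,\alpha)=2$. For roots write $\alpha\sim\beta$ if $|(\alpha,\beta)|=1$, and let $r_\beta$ be the reflection in $\beta$. The group $W$ acts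 on sets $B$ of mutually orthogonal positive roots: $wB$ is the set of the positive roots among $\pm w\beta$, $\beta\in B$. Such a set $B$ is admissible if, whenever $\beta_1,\beta_2,\beta_3\in B$ are distinct and $\alpha$ is a root with $\alpha\sim\beta_1,\beta_2,\beta_3$, the positive root among $\pm r_\alpha r_{\beta_1}r_{\beta_2}r_{\beta_3}\alpha$ is in $B$. Fix the $W$-orbit $\mathcal B$ of an admissible set. Order $\mathcal B$ by the partial order generated by the relations $B<r_iB$, for those $B\in\mathcal B$ and nodes $i$ with $r_iB\ne B$ for which the least height of a root in $B\setminus r_iB$ is smaller than the least height of a root in $r_iB\setminus B$. Then $\mathcal B$ has a unique maximal element $B_0$. Let $C$ be the set of nodes $i$ with $\alpha_i\perp B_0$, and let $W(C)=\langle r_i\mid i\in C\rangle$. For $B\in\mathcal B$ and a node $i$ put $h_{B,i}=1$ if $\alpha_i\not\perp B$; the following rules define, without ambiguity, simple reflections $h_{B,i}$ of $W(C)$ for all pairs $(B,i)$ with $\alpha_i\perp B$: $h_{B_0,i}=r_i$; and if $r_jB>B$, then $h_{B,i}=h_{r_jB,i}$ in case $j\not\sim i$, and $h_{B,i}=h_{r_ir_jB,j}$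 in case $j\sim i$. Let $V$ be the free right $\mathbb Q(\delta)[W(C)]$-module with basis $\xi_B$, $B\in\mathcal B$. There are representations of $W$ and of ${\rm Br}(M)$ on $V$, by right $\mathbb Q(\delta)[W(C)]$-linear maps, in which $\delta$ acts as the scalar $\delta$, in both of which $r_i\xi_B=\xi_{r_iB}h_{B,i}$, and in which $$e_i\xi_B=\begin{cases}\xi_B\,\delta&\text{if }\alpha_i\in B,\\ 0&\text{if }\alpha_i\perp B,\\ r_\beta r_i\xi_B&\text{if }\beta\in B\text{ and }\beta\sim\alpha_i.\end{cases}$$ For every irreducible $\mathbb Q(\delta)[W(C)]$-submodule $U_1$ of the left regular representation $\mathbb Q(\delta)[W(C)]$, the subspace $\sum_{B\in\mathcal B}\xi_BU_1$ of $V$ is invariant under ${\rm Br}(M)$ and is an irreducible ${\rm Br}(M)$-module over $\mathbb Q(\delta)$. If $U_1$ and $U_2$ are inequivalent irreducible $\mathbb Q(\delta)[W(C)]$-submodules of the regular representation, then $\sum_{B\in\mathcal B}\xi_BU_1$ and $\sum_{B\in\mathcal B}\xi_BU_2$ are inequivalent ${\rm Br}(M)$-modules over $\mathbb Q(\delta)$.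 -/

import Mathlib

namespace BrauerADE

/-! ### Simply laced graphs of spherical type -/

/-- The graph on `0, …, n-1` whose first `n-1` nodes form a path and whose last node is joined
to the node `b` of that path. -/
def branchGraph (n b : ℕ) : SimpleGraph (Fin n) :=
  SimpleGraph.fromRel fun i j =>
    ((i : ℕ) + 1 = j ∧ (j : ℕ) + 1 < n) ∨ ((i : ℕ) = b ∧ (j : ℕ) + 1 = n)

/-- The connected Coxeter graphs `A_n` (`n ≥ 1`), `D_n` (`n ≥ 4`), `E_6`, `E_7`, `E_8`. -/
def IsConnectedADE {V : Type*} (G : SimpleGraph V) : Prop :=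
  (∃ n, 1 ≤ n ∧ Nonempty (G ≃g SimpleGraph.pathGraph n)) ∨
  (∃ n, 4 ≤ n ∧ Nonempty (G ≃g branchGraph n (n - 3))) ∨
  (∃ n, (n = 6 ∨ n = 7 ∨ n = 8) ∧ Nonempty (G ≃g branchGraph n 2))

/-- All connected components are of type `A_n`, `D_n` or `E_n`. -/
def IsADE {ι : Type*} (M : SimpleGraph ι) : Prop :=
  ∀ c : M.ConnectedComponent, IsConnectedADE (M.induce c.supp)

/-! ### The Brauer monoid and the Brauer algebra -/

inductive BrauerGen (ι : Type*) where
  | r (i : ι) : BrauerGen ι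
  | e (i : ι) : BrauerGen ι
  | delta : BrauerGen ι
  | deltaInv : BrauerGen ι

open BrauerGen FreeMonoid in
/-- The defining relations of the Brauer monoid. -/
inductive BrauerRel {ι : Type*} (M : SimpleGraph ι) :
    FreeMonoid (BrauerGen ι) → FreeMonoid (BrauerGen ι) → Prop where
  | delta_central (g : BrauerGen ι) :
      BrauerRel M (of delta * of g) (of g * of delta)
  | delta_inv : BrauerRel M (of delta * of deltaInv) 1
  | RSrr (i : ι) : BrauerRel M (of (r i) * of (r i)) 1
  | RSer (i : ι) : BrauerRel M (of (e i) * of (r i)) (of (e i))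
  | RSre (i : ι) : BrauerRel M (of (r i) * of (e i)) (of (e i))
  | HSee (i : ι) : BrauerRel M (of (e i) * of (e i)) (of delta * of (e i))
  | HCrr (i j : ι) : ¬ M.Adj i j → BrauerRel M (of (r i) * of (r j)) (of (r j) * of (r i))
  | HCer (i j : ι) : ¬ M.Adj i j → BrauerRel M (of (e i) * of (r j)) (of (r j) * of (e i))
  | HCee (i j : ι) : ¬ M.Adj i j → BrauerRel M (of (e i) * of (e j)) (of (e j) * of (e i))
  | HNrrr (i j : ι) : M.Adj i j →
      BrauerRel M (of (r i) * of (r j) * of (r i)) (of (r j) * of (r i) * of (r j))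
  | HNrer (i j : ι) : M.Adj i j →
      BrauerRel M (of (r j) * of (e i) * of (r j)) (of (r i) * of (e j) * of (r i))
  | RNrre (i j : ι) : M.Adj i j →
      BrauerRel M (of (r j) * of (r i) * of (e j)) (of (e i) * of (e j))

/-- The Brauer monoid `BrM(M)`. -/
abbrev BrauerMonoid {ι : Type*} (M : SimpleGraph ι) : Type _ := PresentedMonoid (BrauerRel M)

/-- The Brauer algebra `Br(M) = ℤ[BrM(M)]`. -/
abbrev BrauerAlgebra {ι : Type*} (M : SimpleGraph ι) : Type _ :=
  MonoidAlgebra ℤ (BrauerMonoid M)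

/-- A generator of the Brauer monoid, as an element of the Brauer algebra. -/
noncomputable def brGen {ι : Type*} (M : SimpleGraph ι) (g : BrauerGen ι) : BrauerAlgebra M :=
  MonoidAlgebra.of ℤ (BrauerMonoid M) (PresentedMonoid.of (BrauerRel M) g)

/-! ### Weyl group and roots -/

section Roots

variable {ι : Type*} [Fintype ι] [DecidableEq ι] (M : SimpleGraph ι)

open Classical in
/-- `2` on the diagonal, `-1` for adjacent nodes, `0` otherwise. -/
noncomputable def cartan : Matrix ι ι ℤ :=
  Matrix.of fun i j => if i = j then 2 else if M.Adj i j then -1 else 0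

/-- The symmetric form on the root lattice `ℤ^ι` with Gram matrix `cartan M`. -/
noncomputable def form : LinearMap.BilinForm ℤ (ι → ℤ) := Matrix.toBilin' (cartan M)

/-- The simple root `α_i`. -/
def simpleRoot (i : ι) : ι → ℤ := Pi.single i 1

/-- The reflection `x ↦ x - (β, x) β`, as a map. -/
noncomputable def refl (β x : ι → ℤ) : ι → ℤ := x - form M β x • β

theorem form_simpleRoot_self (i : ι) : form M (simpleRoot i) (simpleRoot i) = 2 := by
  simp [form, simpleRoot, cartan]

/-- The simple reflection `r_i`. -/
noncomputable def simpleRefl (i : ι) : (ι → ℤ) ≃ₗ[ℤ] (ι → ℤ) :=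
  Module.reflection (form_simpleRoot_self M i)

theorem simpleRefl_apply (i : ι) (x : ι → ℤ) : simpleRefl M i x = refl M (simpleRoot i) x := by
  simp [simpleRefl, Module.reflection_apply, refl]

/-- The Coxeter group `W(M)`, in its reflection representation on the root lattice. -/
def W : Subgroup ((ι → ℤ) ≃ₗ[ℤ] (ι → ℤ)) := Subgroup.closure (Set.range (simpleRefl M))

/-- The simple reflection `r_i` as an element of `W(M)`. -/
noncomputable def s (i : ι) : W M := ⟨simpleRefl M i, Subgroup.subset_closure ⟨i, rfl⟩⟩

/-- The parabolic subgroup `W(C)` generated by the `r_i` with `i ∈ C`. -/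
def parabolic (C : Set ι) : Subgroup (W M) := Subgroup.closure (s M '' C)

/-- The roots are the images of the simple roots under `W(M)`. -/
def IsRoot (v : ι → ℤ) : Prop := ∃ (w : W M) (i : ι), v = w.1 (simpleRoot i)

def IsPosRoot (v : ι → ℤ) : Prop := IsRoot M v ∧ ∀ i, 0 ≤ v i

/-- The height of a root: the sum of its coefficients on the simple roots. -/
def height (v : ι → ℤ) : ℤ := ∑ i, v i

/-- `w` is the reflection `r_β`. -/
def IsReflectionIn (w : W M) (β : ι → ℤ) : Prop := ∀ x, w.1 x = refl M β x

theorem form_symm (x y : ι → ℤ) : form M x y = form M y x := by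
  have h : (cartan M).transpose = cartan M := by
    ext i j
    have hij := M.adj_comm j i
    simp only [cartan, Matrix.transpose_apply, Matrix.of_apply]
    by_cases h₁ : i = j
    · simp [h₁]
    · by_cases h₂ : M.Adj i j
      · simp [h₁, Ne.symm h₁, hij.2 h₂, h₂]
      · simp [h₁, Ne.symm h₁, mt hij.1 h₂, h₂]
  simp only [form, Matrix.toBilin'_apply']
  rw [Matrix.dotProduct_mulVec, ← Matrix.mulVec_transpose, h, dotProduct_comm]

theorem form_invariant (w : W M) (x y : ι → ℤ) : form M (w.1 x) (w.1 y) = form M x y := by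
  obtain ⟨w, hw⟩ := w
  simp only
  induction hw using Subgroup.closure_induction generalizing x y with
  | mem g hg =>
    obtain ⟨i, rfl⟩ := hg
    simp only [simpleRefl_apply, refl, map_sub, map_smul, LinearMap.sub_apply,
      LinearMap.smul_apply, smul_eq_mul, form_simpleRoot_self,
      form_symm M x (simpleRoot i)]
    ring
  | one => rfl
  | mul g g' _ _ h h' => simp only [LinearEquiv.mul_apply, h, h']
  | inv g _ h =>
    rw [← h (g⁻¹ x) (g⁻¹ y)]
    simp only [← LinearEquiv.mul_apply, mul_inv_cancel, LinearEquiv.coe_one, id_eq]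

/-- Every root `β` has its reflection `r_β` in `W(M)`. -/
theorem exists_isReflectionIn {β : ι → ℤ} (hβ : IsRoot M β) : ∃ w : W M, IsReflectionIn M w β := by
  obtain ⟨w, i, rfl⟩ := hβ
  refine ⟨w * s M i * w⁻¹, fun x => ?_⟩
  have h : w.1 (w.1⁻¹ x) = x := by
    rw [← LinearEquiv.mul_apply, mul_inv_cancel]; rfl
  have h2 := form_invariant M w (simpleRoot i) (w.1⁻¹ x)
  rw [h] at h2
  change w.1 (simpleRefl M i (w.1⁻¹ x)) = _
  rw [simpleRefl_apply, refl, refl, map_sub, map_smul, h, h2]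

/-! ### Admissible sets, their orbits and the partial order -/

/-- A set of mutually orthogonal positive roots. -/
def IsOrthogonalSet (B : Set (ι → ℤ)) : Prop :=
  (∀ β ∈ B, IsPosRoot M β) ∧ B.Pairwise fun β γ => form M β γ = 0

/-- Admissible sets of mutually orthogonal positive roots. -/
def IsAdmissible (B : Set (ι → ℤ)) : Prop :=
  IsOrthogonalSet M B ∧
  ∀ β₁ ∈ B, ∀ β₂ ∈ B, ∀ β₃ ∈ B, β₁ ≠ β₂ → β₁ ≠ β₃ → β₂ ≠ β₃ →
  ∀ α, IsRoot M α → |form M α β₁| = 1 → |form M α β₂| = 1 → |form M α β₃| = 1 →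
  ∀ γ, IsPosRoot M γ →
    (γ = refl M α (refl M β₁ (refl M β₂ (refl M β₃ α))) ∨
      γ = -refl M α (refl M β₁ (refl M β₂ (refl M β₃ α)))) → γ ∈ B

/-- `r_i B`: the positive roots among the `± r_i β` with `β ∈ B`. -/
def reflSet (i : ι) (B : Set (ι → ℤ)) : Set (ι → ℤ) :=
  {γ | IsPosRoot M γ ∧ ∃ β ∈ B, γ = simpleRefl M i β ∨ γ = -simpleRefl M i β}

/-- The `W`-orbit of `X` (the group `W` is generated by the `r_i`). -/
def InOrbit (X B : Set (ι → ℤ)) : Prop :=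
  Relation.ReflTransGen (fun B B' => ∃ i, B' = reflSet M i B) X B

/-- The `W`-orbit `𝓑` of `X`, as a type. -/
abbrev Orbit (X : Set (ι → ℤ)) : Type _ := {B : Set (ι → ℤ) // InOrbit M X B}

/-- `r_i` acting on the orbit. -/
def act {X : Set (ι → ℤ)} (i : ι) (B : Orbit M X) : Orbit M X :=
  ⟨reflSet M i B.1, B.2.tail ⟨i, rfl⟩⟩

/-- `B < r_i B`: the least height occurring in `B \ r_i B` is smaller than the least height
occurring in `r_i B \ B`. -/
def Raises (i : ι) (B : Set (ι → ℤ)) : Prop :=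
  ∃ β ∈ B \ reflSet M i B, ∀ γ ∈ reflSet M i B \ B, height β < height γ

/-- The partial order on an orbit, generated by the relations `B < r_i B`. -/
def Below (B B' : Set (ι → ℤ)) : Prop :=
  Relation.TransGen (fun B B' => ∃ i, Raises M i B ∧ B' = reflSet M i B) B B'

/-- `B₀` is a maximal element of the `W`-orbit of `X`. -/
def IsHighest (X B₀ : Set (ι → ℤ)) : Prop :=
  InOrbit M X B₀ ∧ ∀ B, InOrbit M X B → ¬ Below M B₀ B

/-- `α_i ⊥ B`. -/
def Perp (i : ι) (B : Set (ι → ℤ)) : Prop := ∀ β ∈ B, form M (simpleRoot i) β = 0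

/-- The set `C` of nodes `i` with `α_i ⊥ B₀`. -/
def nodesC (B₀ : Set (ι → ℤ)) : Set ι := {i | Perp M i B₀}

/-- `HRel M B₀ B i k` says that `h_{B,i} = r_k` (for `α_i ⊥ B`): going up from `B` to `B₀` in the
order, `h_{B₀,i} = r_i`, and if `r_j B > B` then `h_{B,i} = h_{r_j B, i}` for `j ≁ i` and
`h_{B,i} = h_{r_i r_j B, j}` for `j ∼ i`. -/
inductive HRel (B₀ : Set (ι → ℤ)) : Set (ι → ℤ) → ι → ι → Prop where
  | top (i : ι) : Perp M i B₀ → HRel B₀ B₀ i i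
  | comm (B : Set (ι → ℤ)) (i j k : ι) : Perp M i B → Raises M j B → ¬ M.Adj i j →
      HRel B₀ (reflSet M j B) i k → HRel B₀ B i k
  | braid (B : Set (ι → ℤ)) (i j k : ι) : Perp M i B → Raises M j B → M.Adj i j →
      HRel B₀ (reflSet M i (reflSet M j B)) j k → HRel B₀ B i k

open Classical in
/-- The element `h_{B,i}` of `W(C)`: a simple reflection if `α_i ⊥ B`, and `1` otherwise. -/
noncomputable def h (B₀ B : Set (ι → ℤ)) (i : ι) : parabolic M (nodesC M B₀) :=
  if hk : ∃ k : nodesC M B₀, HRel M B₀ B i k.1 then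
    ⟨s M hk.choose.1, Subgroup.subset_closure ⟨hk.choose.1, hk.choose.2, rfl⟩⟩
  else 1

end Roots

/-! ### The representation of the Brauer algebra attached to an orbit -/

section Rep

/-- The field `ℚ(δ)`, with `δ = RatFunc.X`. -/
abbrev K : Type := RatFunc ℚ

variable {ι : Type*} [Fintype ι] [DecidableEq ι] (M : SimpleGraph ι)

/-- The group algebra `ℚ(δ)[W(C)]`. -/
abbrev GroupAlg (B₀ : Set (ι → ℤ)) : Type _ := MonoidAlgebra K (parabolic M (nodesC M B₀))

/-- The free right `ℚ(δ)[W(C)]`-module with basis `ξ_B`, `B ∈ 𝓑`. -/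
abbrev V (X B₀ : Set (ι → ℤ)) : Type _ := Orbit M X →₀ GroupAlg M B₀

variable {M} {X B₀ : Set (ι → ℤ)}

/-- The element `ξ_B a`. -/
noncomputable def xi (B : Orbit M X) (a : GroupAlg M B₀) : V M X B₀ := Finsupp.single B a

/-- `ρW` and `ρ` are the representations of `W(M)` and `Br(M)` given by
`r_i ξ_B = ξ_{r_i B} h_{B,i}`, `δ v = v δ`, and `e_i ξ_B = ξ_B δ`, `0`, `r_β r_i ξ_B` according to
`α_i ∈ B`, `α_i ⊥ B`, `α_i ∼ β ∈ B`. -/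
structure IsBrauerRep (ρW : W M →* Module.End K (V M X B₀))
    (ρ : BrauerAlgebra M →+* Module.End K (V M X B₀)) : Prop where
  simple (i : ι) (B : Orbit M X) (a : GroupAlg M B₀) :
    ρW (s M i) (xi B a) = xi (act M i B) (MonoidAlgebra.of K _ (h M B₀ B.1 i) * a)
  gen_r (i : ι) : ρ (brGen M (.r i)) = ρW (s M i)
  gen_delta (v : V M X B₀) : ρ (brGen M .delta) v = (RatFunc.X : K) • v
  gen_e_mem (i : ι) (B : Orbit M X) (a : GroupAlg M B₀) : simpleRoot i ∈ B.1 →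
    ρ (brGen M (.e i)) (xi B a) = (RatFunc.X : K) • xi B a
  gen_e_perp (i : ι) (B : Orbit M X) (a : GroupAlg M B₀) : Perp M i B.1 →
    ρ (brGen M (.e i)) (xi B a) = 0
  gen_e_adj (i : ι) (B : Orbit M X) (a : GroupAlg M B₀) (β : ι → ℤ) (rβ : W M) : β ∈ B.1 →
    |form M β (simpleRoot i)| = 1 → IsReflectionIn M rβ β →
    ρ (brGen M (.e i)) (xi B a) = ρW rβ (ρW (s M i) (xi B a))

/-- The subspace `∑_{B ∈ 𝓑} ξ_B U₁`, for a left ideal `U₁` of `ℚ(δ)[W(C)]`, that is, an invariant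
subspace of the regular representation. -/
noncomputable def xiSum (X : Set (ι → ℤ)) (U₁ : Submodule (GroupAlg M B₀) (GroupAlg M B₀)) :
    Submodule K (V M X B₀) :=
  ⨆ B : Orbit M X, (U₁.restrictScalars K).map (Finsupp.lsingle B)

variable {E : Type*} [AddCommGroup E] [Module K E]

/-- The `ℚ(δ)`-subspace `N` is invariant under `Br(M)`. -/
def IsInvariant (ρ : BrauerAlgebra M →+* Module.End K E) (N : Submodule K E) : Prop :=
  ∀ a, ∀ v ∈ N, ρ a v ∈ N

/-- `N` is an irreducible `Br(M)`-module over `ℚ(δ)`. -/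
def IsIrreducibleModule (ρ : BrauerAlgebra M →+* Module.End K E) (N : Submodule K E) : Prop :=
  IsInvariant ρ N ∧ N ≠ ⊥ ∧ ∀ N' ≤ N, IsInvariant ρ N' → N' = ⊥ ∨ N' = N

/-- The invariant subspaces `N₁` and `N₂` are equivalent as `Br(M)`-modules over `ℚ(δ)`. -/
def AreEquivalent (ρ : BrauerAlgebra M →+* Module.End K E) (N₁ N₂ : Submodule K E) : Prop :=
  ∃ φ : N₁ ≃ₗ[K] N₂, ∀ (a : BrauerAlgebra M) (v v' : N₁),
    (v' : E) = ρ a v → (φ v' : E) = ρ a (φ v)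

end Rep

end BrauerADE

/-! The type of $M$ enters only through positive definiteness of the form (`posDefForm_of_isADE`).
As the root lattice is even as well, every vector of norm 2 has coefficients of one sign and nonzero
height (`nonneg_or_nonpos`, `height_ne_zero`). For orthogonal roots β, γ of a set and a small
combination u of simple roots, the norm of γ - β - u can be computed: norm 2 excludes the height
difference `height u`, and norm 0 forces γ = β + u. These two observations replace any
classification of admissible sets.

Raising terminates because `level` drops, and two raisings of one set can be continued to a common
set (`exists_common_upper`), so Newman's argument gives the unique highest element. The same
completions, refined to carry along a node orthogonal to the set, show by induction on the level
that the label $h_{B,i}$ does not depend on the raising node (`ruleLabel_iff`, `rulesAt`). Labels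
also preserve adjacency (`HRel.adj_iff`), so the operators $\xi_B\mapsto\xi_{r_iB}h_{B,i}$ satisfy
the Coxeter relations. The Coxeter presentation of $W$, proved through `intertwine_word` and
`word_eq_one`, turns them into a representation.

For the Brauer algebra an operator is attached to every root and not only to the simple ones;
conjugation by $W$ permutes these operators (`IsRootOperator.conj`). That $r_\beta r_\alpha\xi_B$
does not depend on β is `IsWeylRep.rep_mul_eq`, which rests on admissibility through
`IsAdmissible.wSet_reflW_mul_eq`. Among the relations, only the commutation of operators of
orthogonal roots needs a real case analysis (`IsRootOperator.comm`).

The product of the root operators over $B$ multiplies $\xi_B$ by $\delta^{|B|}$ and sends any other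
$\xi_{B'}$ to zero or to some $\xi_B g$ times a lower power of δ (`IsBrauerRep.exists_projection`).
Applied to a nonzero vector, with $B$ carrying a coefficient of maximal degree in δ, it leaves a
leading term that cannot cancel. So a nonzero invariant subspace contains a nonzero $\xi_B a$, and
transitivity of $W$ on the orbit together with the left multiplication of $W(C)$ on $\xi_{B_0}$
reduces irreducibility to simplicity of $U_1$. An equivalence of two such modules commutes with the
projection at $B_0$, hence restricts to a $W(C)$-linear map $U_1\to U_2$, and Schur's lemma applies.
-/

namespace BrauerADE

/-! ### Positive definiteness -/

/-- The form of the root lattice is positive definite. -/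
class PosDefForm {ι : Type*} [Fintype ι] [DecidableEq ι] (M : SimpleGraph ι) : Prop where
  eq_zero_of_form_nonpos : ∀ x, form M x x ≤ 0 → x = 0

open Classical in
/-- A positive vector with nonnegative inner products with all simple roots, one of them
positive. -/
def HasDominantVector {V : Type*} [Fintype V] (G : SimpleGraph V) : Prop :=
  ∃ d : V → ℤ, (∀ i, 0 < d i) ∧ (∀ i, ∑ j, (if G.Adj i j then d j else 0) ≤ 2 * d i) ∧
    ∃ i, ∑ j, (if G.Adj i j then d j else 0) < 2 * d i

theorem HasDominantVector.of_iso {V V' : Type*} [Fintype V] [Fintype V'] {G : SimpleGraph V}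
    {G' : SimpleGraph V'} (f : G ≃g G') (h : HasDominantVector G') : HasDominantVector G := by
  classical
  obtain ⟨d, h1, h2, i, hi⟩ := h
  have key : ∀ i, ∑ j, (if G.Adj i j then d (f j) else 0) =
      ∑ j, (if G'.Adj (f i) j then d j else 0) := fun i => by
    rw [← f.toEquiv.sum_comp]
    exact Finset.sum_congr rfl fun j _ => by
      exact if_congr f.map_adj_iff.symm rfl rfl
  refine ⟨fun i => d (f i), fun i => h1 _, fun i => ?_, f.symm i, ?_⟩
  · have := h2 (f i)
    rw [← key] at this
    convert this
  · have := key (f.symm i)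
    simp only [RelIso.apply_symm_apply] at this ⊢
    rw [← this] at hi
    convert hi

/-- Since `D` is nonnegative on all of `ℕ`, the set `S` may contain non-neighbours and even numbers
that are not nodes, which spares most boundary cases. -/
theorem sum_adj_le {n : ℕ} (G : SimpleGraph (Fin n)) [DecidableRel G.Adj] (D : ℕ → ℤ)
    (hD : ∀ c, 0 ≤ D c) (i : Fin n) (S : Finset ℕ) (hS : ∀ j, G.Adj i j → (j : ℕ) ∈ S) :
    ∑ j, (if G.Adj i j then D j else 0) ≤ ∑ c ∈ S, D c := by
  rw [← Finset.sum_filter]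
  have : ∑ a ∈ Finset.univ.filter (fun j => G.Adj i j), D a =
      ∑ c ∈ (Finset.univ.filter (fun j => G.Adj i j)).map Fin.valEmbedding, D c := by
    simp
  rw [this]
  refine Finset.sum_le_sum_of_subset_of_nonneg (fun c hc => ?_) fun c _ _ => hD c
  simp only [Finset.mem_map, Finset.mem_filter, Finset.mem_univ, true_and] at hc
  obtain ⟨j, hj, rfl⟩ := hc
  exact hS j hj

theorem branchGraph_adj {n b : ℕ} {i j : Fin n} : (branchGraph n b).Adj i j ↔ i ≠ j ∧
    ((((i : ℕ) + 1 = j ∧ (j : ℕ) + 1 < n) ∨ ((i : ℕ) = b ∧ (j : ℕ) + 1 = n)) ∨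
    (((j : ℕ) + 1 = i ∧ (i : ℕ) + 1 < n) ∨ ((j : ℕ) = b ∧ (i : ℕ) + 1 = n))) := by
  simp [branchGraph, SimpleGraph.fromRel_adj]

theorem hasDominantVector_pathGraph {n : ℕ} (hn : 1 ≤ n) :
    HasDominantVector (SimpleGraph.pathGraph n) := by
  classical
  refine ⟨fun _ => 1, fun _ => one_pos, fun i => ?_, ⟨⟨0, hn⟩, ?_⟩⟩
  -- For `i = 0` the truncated `i - 1` is `0`, and at the last node `i + 1` is no node; the surplus
  -- terms are harmless.
  · refine (sum_adj_le _ (fun _ => 1) (fun _ => zero_le_one) i {(i : ℕ) - 1, (i : ℕ) + 1}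
      fun j hj => ?_).trans ?_
    · rw [SimpleGraph.pathGraph_adj] at hj
      simp only [Finset.mem_insert, Finset.mem_singleton]
      omega
    · rw [Finset.sum_pair (by omega)]
      norm_num
  · refine (sum_adj_le _ (fun _ => 1) (fun _ => zero_le_one) _ {1}
      fun j hj => ?_).trans_lt ?_
    · rw [SimpleGraph.pathGraph_adj] at hj
      simp only [Finset.mem_singleton]
      simp only at hj
      omega
    · norm_num

theorem hasDominantVector_branchGraph_D {n : ℕ} (hn : 4 ≤ n) :
    HasDominantVector (branchGraph n (n - 3)) := by
  classical
  -- The coefficients of the highest root of `D_n`: 1 at the end of the long arm and at the two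
  -- short ends `n - 2`, `n - 1`, and 2 elsewhere.
  let D : ℕ → ℤ := fun c => if c = 0 ∨ n ≤ c + 2 then 1 else 2
  have hD : ∀ c, 0 ≤ D c := fun c => by simp only [D]; split_ifs <;> norm_num
  refine ⟨fun i => D i, fun i => ?_, fun i => ?_, ⟨⟨1, by omega⟩, ?_⟩⟩
  · simp only [D]; split_ifs <;> norm_num
  · by_cases h1 : (i : ℕ) = n - 3
    · refine (sum_adj_le _ D hD i {n - 4, n - 2, n - 1} fun j hj => ?_).trans ?_
      · rw [branchGraph_adj] at hj
        simp only [Finset.mem_insert, Finset.mem_singleton]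
        omega
      · rw [Finset.sum_insert (by simp; omega), Finset.sum_pair (by omega)]
        simp only [D]; split_ifs <;> omega
    · by_cases h2 : n ≤ (i : ℕ) + 2
      · refine (sum_adj_le _ D hD i {n - 3} fun j hj => ?_).trans ?_
        · rw [branchGraph_adj] at hj
          simp only [Finset.mem_singleton]
          omega
        · rw [Finset.sum_singleton]
          simp only [D]; split_ifs <;> omega
      · by_cases h3 : (i : ℕ) = 0
        · refine (sum_adj_le _ D hD i {1} fun j hj => ?_).trans ?_
          · rw [branchGraph_adj] at hj
            simp only [Finset.mem_singleton]
            omega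
          · rw [Finset.sum_singleton]
            simp only [D]; split_ifs <;> omega
        · refine (sum_adj_le _ D hD i {(i : ℕ) - 1, (i : ℕ) + 1} fun j hj => ?_).trans ?_
          · rw [branchGraph_adj] at hj
            simp only [Finset.mem_insert, Finset.mem_singleton]
            omega
          · rw [Finset.sum_pair (by omega)]
            simp only [D]; split_ifs <;> omega
  -- Strictness is attained at node 1, which is the branch node exactly when `n = 4`.
  · by_cases h4 : n = 4
    · refine (sum_adj_le _ D hD _ {0, 2, 3} fun j hj => ?_).trans_lt ?_
      · rw [branchGraph_adj] at hj
        simp only [Finset.mem_insert, Finset.mem_singleton]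
        simp only at hj
        omega
      · subst h4; simp [D]
    · refine (sum_adj_le _ D hD _ {0, 2} fun j hj => ?_).trans_lt ?_
      · rw [branchGraph_adj] at hj
        simp only [Finset.mem_insert, Finset.mem_singleton]
        simp only at hj
        omega
      · rw [Finset.sum_pair (by omega)]
        have e0 : D 0 = 1 := by simp [D]
        have e1 : D 1 = 2 := by simp [D]; omega
        have e2 : D 2 ≤ 2 := by simp only [D]; split_ifs <;> norm_num
        change D 0 + D 2 < 2 * D 1
        omega

/-- The coefficients of the highest root of `E_n`, for `n = 6, 7, 8`. -/
def highestRootE (n c : ℕ) : ℤ :=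
  if n = 6 then [1, 2, 3, 2, 1, 2].getD c 1
  else if n = 7 then [2, 3, 4, 3, 2, 1, 2].getD c 1
  else [2, 4, 6, 5, 4, 3, 2, 3].getD c 1

theorem hasDominantVector_branchGraph_E {n : ℕ} (hn : n = 6 ∨ n = 7 ∨ n = 8) :
    HasDominantVector (branchGraph n 2) := by
  classical
  -- Adjacency is written out arithmetically, so that the three graphs can be checked by evaluation.
  have key : (∀ i : Fin n, 0 < highestRootE n i) ∧
      (∀ i : Fin n, ∑ j : Fin n, (if i ≠ j ∧
    ((((i : ℕ) + 1 = j ∧ (j : ℕ) + 1 < n) ∨ ((i : ℕ) = 2 ∧ (j : ℕ) + 1 = n)) ∨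
    (((j : ℕ) + 1 = i ∧ (i : ℕ) + 1 < n) ∨ ((j : ℕ) = 2 ∧ (i : ℕ) + 1 = n)))
      then highestRootE n j else 0) ≤ 2 * highestRootE n i) ∧
      ∃ i : Fin n, ∑ j : Fin n, (if i ≠ j ∧
    ((((i : ℕ) + 1 = j ∧ (j : ℕ) + 1 < n) ∨ ((i : ℕ) = 2 ∧ (j : ℕ) + 1 = n)) ∨
    (((j : ℕ) + 1 = i ∧ (i : ℕ) + 1 < n) ∨ ((j : ℕ) = 2 ∧ (i : ℕ) + 1 = n)))
      then highestRootE n j else 0) < 2 * highestRootE n i := by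
    rcases hn with rfl | rfl | rfl <;> decide
  refine ⟨fun i => highestRootE n i, key.1, ?_⟩
  simp only [branchGraph_adj]
  convert key.2

theorem hasDominantVector_of_isConnectedADE {V : Type*} [Fintype V] {G : SimpleGraph V}
    (h : IsConnectedADE G) : HasDominantVector G := by
  rcases h with ⟨n, hn, ⟨f⟩⟩ | ⟨n, hn, ⟨f⟩⟩ | ⟨n, hn, ⟨f⟩⟩
  · exact .of_iso f (hasDominantVector_pathGraph hn)
  · exact .of_iso f (hasDominantVector_branchGraph_D hn)
  · exact .of_iso f (hasDominantVector_branchGraph_E hn)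

section

variable {ι : Type*} [Fintype ι] [DecidableEq ι] {M : SimpleGraph ι}

-- The vectors of the components are glued; edges never leave a component, so the neighbour sums
-- agree. Strictness is needed once in each component, whence the reachability clause.
open Classical in
theorem exists_dominant (hM : IsADE M) :
    ∃ d : ι → ℤ, (∀ i, 0 < d i) ∧ (∀ i, ∑ j, (if M.Adj i j then d j else 0) ≤ 2 * d i) ∧
    ∀ k, ∃ i, M.Reachable k i ∧ ∑ j, (if M.Adj i j then d j else 0) < 2 * d i := by
  choose d h1 h2 i hi using fun c => hasDominantVector_of_isConnectedADE (hM c)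
  let D : ι → ℤ := fun j =>
    d (M.connectedComponentMk j) ⟨j, (SimpleGraph.ConnectedComponent.mem_supp_iff _ _).2 rfl⟩
  have hD : ∀ (c : M.ConnectedComponent) (k : c.supp), D k = d c k := fun c ⟨k, hk⟩ => by
    have h := (SimpleGraph.ConnectedComponent.mem_supp_iff _ _).1 hk
    subst h
    rfl
  have key : ∀ (c : M.ConnectedComponent) (k : c.supp),
      ∑ j, (if M.Adj k j then D j else 0) =
      ∑ j, (if (M.induce c.supp).Adj k j then d c j else 0) := fun c k => by
    have h0 : ∀ j ∈ (Finset.univ : Finset ι), j ∉ Set.toFinset c.supp →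
        (if M.Adj k j then D j else 0) = 0 := fun j _ hj => by
      rw [if_neg]
      intro ha
      apply hj
      rw [Set.mem_toFinset, SimpleGraph.ConnectedComponent.mem_supp_iff,
        ← (SimpleGraph.ConnectedComponent.mem_supp_iff _ _).1 k.2]
      exact (SimpleGraph.ConnectedComponent.sound ha.reachable).symm
    rw [← Finset.sum_subset (Finset.subset_univ _) h0,
      ← Finset.sum_subtype_of_mem (p := fun j => j ∈ c.supp) _ (by simp)]
    have : Finset.subtype (fun j => j ∈ c.supp) (Set.toFinset c.supp) = Finset.univ := by
      ext; simp
    rw [this]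
    exact Finset.sum_congr rfl fun j _ => by simp [hD c j]
  refine ⟨D, fun _ => h1 _ _, fun k => ?_, fun k => ?_⟩
  · rw [key (M.connectedComponentMk k)
      ⟨k, (SimpleGraph.ConnectedComponent.mem_supp_iff _ _).2 rfl⟩]
    convert h2 (M.connectedComponentMk k) _
  · have hc := (i (M.connectedComponentMk k)).2
    refine ⟨i (M.connectedComponentMk k), ?_, ?_⟩
    · exact (SimpleGraph.ConnectedComponent.exact
        ((SimpleGraph.ConnectedComponent.mem_supp_iff _ _).1 hc)).symm
    · rw [key (M.connectedComponentMk k), hD]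
      convert hi (M.connectedComponentMk k)

theorem form_apply (x y : ι → ℤ) : form M x y = ∑ i, ∑ j, x i * cartan M i j * y j := by
  simp [form, Matrix.toBilin'_apply]

-- Completion of squares relative to a positive vector `d`: the mixed terms are absorbed in
-- $d_id_j(x_i/d_i-x_j/d_j)^2$, and the defect $2d_i-\sum_{j\sim i}d_j$ is what remains on the
-- diagonal. The factor 1/2 accounts for ordered pairs.
open Classical in
theorem form_self_eq_sum (d : ι → ℚ) (hd : ∀ i, 0 < d i) (x : ι → ℤ) :
    (form M x x : ℚ) = ∑ i, (2 * d i - ∑ j, if M.Adj i j then d j else 0) / d i * x i ^ 2 +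
      1 / 2 * ∑ i, ∑ j, if M.Adj i j then d i * d j * (x i / d i - x j / d j) ^ 2 else 0 := by
  have h1 : ∀ i j, (if M.Adj i j then d i * d j * (x i / d i - x j / d j) ^ 2 else 0 : ℚ) =
      (if M.Adj i j then d j else 0) * (x i ^ 2 / d i) +
      (if M.Adj j i then d i else 0) * (x j ^ 2 / d j) -
      2 * (if M.Adj i j then (x i : ℚ) * x j else 0) := fun i j => by
    have := (hd i).ne'
    have := (hd j).ne'
    by_cases h : M.Adj i j
    · simp only [h, h.symm, if_true]; field_simp; ring
    · simp [h, mt (M.adj_comm j i).1 h]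
  have h2 : ∑ i, ∑ j, (if M.Adj j i then d i else 0) * (x j ^ 2 / d j) =
      ∑ i, ∑ j, (if M.Adj i j then d j else 0) * (x i ^ 2 / d i) := Finset.sum_comm
  simp only [h1, Finset.sum_sub_distrib, Finset.sum_add_distrib, h2]
  have h3 : (form M x x : ℚ) = ∑ i, (2 * (x i : ℚ) ^ 2) -
      ∑ i, ∑ j, (if M.Adj i j then (x i : ℚ) * x j else 0) := by
    rw [form_apply]
    push_cast
    rw [← Finset.sum_sub_distrib]
    refine Finset.sum_congr rfl fun i _ => ?_
    have : (2 * (x i : ℚ) ^ 2) = ∑ j, if i = j then 2 * (x i : ℚ) * x j else 0 := by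
      simp; ring
    rw [this, ← Finset.sum_sub_distrib]
    refine Finset.sum_congr rfl fun j _ => ?_
    by_cases h : i = j
    · subst h; simp [cartan, mul_comm]
    · by_cases h' : M.Adj i j <;> simp [cartan, h, h']
  rw [h3]
  have h4 : ∀ i, (2 * d i - ∑ j, if M.Adj i j then d j else 0) / d i * (x i : ℚ) ^ 2 =
      2 * (x i : ℚ) ^ 2 - ∑ j, (if M.Adj i j then d j else 0) * (x i ^ 2 / d i) := fun i => by
    have := (hd i).ne'
    rw [← Finset.sum_mul]
    field_simp
  simp only [h4, Finset.sum_sub_distrib, ← Finset.mul_sum]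
  ring

/-- With a dominant `d` every term of `form_self_eq_sum` is nonnegative. If the form is nonpositive
they all vanish, so $x_i/d_i$ is constant on each component, and it is zero at the node where the
inequality is strict. -/
theorem posDefForm_of_isADE (hM : IsADE M) : PosDefForm M := by
  classical
  obtain ⟨d, h1, h2, h3⟩ := exists_dominant hM
  refine ⟨fun x hx => ?_⟩
  have h1' : ∀ i, 0 < (d i : ℚ) := fun i => by exact_mod_cast h1 i
  have e := form_self_eq_sum (M := M) (fun i => (d i : ℚ)) h1' x
  have hc : ∀ i, ((∑ j, if M.Adj i j then d j else 0 : ℤ) : ℚ) =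
      ∑ j, if M.Adj i j then (d j : ℚ) else 0 := fun i => by
    push_cast; rfl
  have n1 : ∀ i, 0 ≤ (2 * (d i : ℚ) - ∑ j, if M.Adj i j then (d j : ℚ) else 0) / d i *
      (x i : ℚ) ^ 2 := fun i => by
    rw [← hc]
    have : ((∑ j, if M.Adj i j then d j else 0 : ℤ) : ℚ) ≤ 2 * d i := by exact_mod_cast h2 i
    exact mul_nonneg (div_nonneg (by linarith) (h1' i).le) (sq_nonneg _)
  have n2 : ∀ i j, (0 : ℚ) ≤ if M.Adj i j then (d i : ℚ) * d j * (x i / d i - x j / d j) ^ 2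
      else 0 := fun i j => by
    split_ifs
    · exact mul_nonneg (mul_nonneg (h1' i).le (h1' j).le) (sq_nonneg _)
    · exact le_rfl
  have hx' : (form M x x : ℚ) ≤ 0 := by exact_mod_cast hx
  have s1 := Finset.sum_nonneg fun i (_ : i ∈ Finset.univ) => n1 i
  have s2 := Finset.sum_nonneg fun i (_ : i ∈ Finset.univ) =>
    Finset.sum_nonneg fun j (_ : j ∈ Finset.univ) => n2 i j
  have z1 := (Finset.sum_eq_zero_iff_of_nonneg fun i _ => n1 i).1 (by linarith)
  have z2 : ∀ i j, M.Adj i j → (x i : ℚ) / d i = x j / d j := fun i j hij => by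
    have := (Finset.sum_eq_zero_iff_of_nonneg fun i _ => Finset.sum_nonneg fun j
      (_ : j ∈ Finset.univ) => n2 i j).1 (by linarith) i (Finset.mem_univ _)
    have := (Finset.sum_eq_zero_iff_of_nonneg fun j _ => n2 i j).1 this j (Finset.mem_univ _)
    rw [if_pos hij] at this
    have h0 := mul_pos (h1' i) (h1' j)
    have := (mul_eq_zero.1 this).resolve_left h0.ne'
    have := pow_eq_zero_iff (two_ne_zero) |>.1 this
    linarith
  have z3 : ∀ i j, M.Reachable i j → (x i : ℚ) / d i = x j / d j := fun i j ⟨w⟩ => by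
    clear * - z2 w
    induction w with
    | nil => rfl
    | cons h _ ih => exact (z2 _ _ h).trans ih
  funext k
  obtain ⟨i, hr, hi⟩ := h3 k
  have := z1 i (Finset.mem_univ _)
  have hi' : ((∑ j, if M.Adj i j then d j else 0 : ℤ) : ℚ) < 2 * d i := by exact_mod_cast hi
  rw [hc] at hi'
  have hp : 0 < (2 * (d i : ℚ) - ∑ j, if M.Adj i j then (d j : ℚ) else 0) / d i :=
    div_pos (by linarith) (h1' i)
  have := pow_eq_zero_iff (two_ne_zero) |>.1 ((mul_eq_zero.1 this).resolve_left hp.ne')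
  have h5 := z3 k i hr
  rw [this, zero_div, div_eq_zero_iff] at h5
  have := h5.resolve_right (h1' k).ne'
  exact_mod_cast this

end

end BrauerADE

namespace BrauerADE

set_option linter.unusedSectionVars false

variable {ι : Type*} [Fintype ι] [DecidableEq ι] {M : SimpleGraph ι}

/-! ### Roots -/

theorem form_simpleRoot_simpleRoot (i j : ι) :
    form M (simpleRoot i) (simpleRoot j) = cartan M i j := by
  simp [form, simpleRoot]

theorem form_simpleRoot_of_adj {i j : ι} (h : M.Adj i j) :
    form M (simpleRoot i) (simpleRoot j) = -1 := by
  simp [form_simpleRoot_simpleRoot, cartan, h, h.ne]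

theorem form_simpleRoot_of_not_adj {i j : ι} (hij : i ≠ j) (h : ¬ M.Adj i j) :
    form M (simpleRoot i) (simpleRoot j) = 0 := by
  simp [form_simpleRoot_simpleRoot, cartan, h, hij]

theorem form_simpleRoot_nonpos {i j : ι} (hij : i ≠ j) :
    form M (simpleRoot i) (simpleRoot j) ≤ 0 := by
  by_cases h : M.Adj i j
  · rw [form_simpleRoot_of_adj h]; norm_num
  · rw [form_simpleRoot_of_not_adj hij h]

theorem eq_sum_simpleRoot (x : ι → ℤ) : x = ∑ i, x i • simpleRoot i := by
  ext j
  simp [simpleRoot, Finset.sum_apply, Pi.single_apply]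

theorem form_eq_sum (x y : ι → ℤ) : form M x y = ∑ i, x i * form M (simpleRoot i) y := by
  conv_lhs => rw [eq_sum_simpleRoot x]
  simp only [map_sum, LinearMap.sum_apply, map_smul, LinearMap.smul_apply, smul_eq_mul]

theorem form_add_self (x y : ι → ℤ) :
    form M (x + y) (x + y) = form M x x + form M y y + 2 * form M x y := by
  simp only [map_add, LinearMap.add_apply, form_symm M y x]; ring

theorem form_sub_self (x y : ι → ℤ) :
    form M (x - y) (x - y) = form M x x + form M y y - 2 * form M x y := by
  simp only [map_sub, LinearMap.sub_apply, form_symm M y x]; ring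

/-- The diagonal Gram entries are 2 and the mixed terms occur twice. With positivity this makes 2
the least norm of a nonzero vector. -/
theorem even_form_self (x : ι → ℤ) : Even (form M x x) := by
  have : ∀ s : Finset ι, Even (form M (∑ i ∈ s, x i • simpleRoot i)
      (∑ i ∈ s, x i • simpleRoot i)) := fun s => by
    induction s using Finset.induction_on with
    | empty => simp
    | insert a s ha ih =>
      rw [Finset.sum_insert ha, form_add_self]
      refine (Even.add ?_ ih).add (even_two_mul _)
      simp only [map_smul, LinearMap.smul_apply, smul_eq_mul, form_simpleRoot_self]
      exact ⟨x a * x a, by ring⟩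
  rw [eq_sum_simpleRoot x]
  exact this _

@[simp] theorem height_add (x y : ι → ℤ) : height (x + y) = height x + height y := by
  simp [height, Finset.sum_add_distrib]

@[simp] theorem height_sub (x y : ι → ℤ) : height (x - y) = height x - height y := by
  simp [height, Finset.sum_sub_distrib]

@[simp] theorem height_neg (x : ι → ℤ) : height (-x) = -height x := by
  simp [height]

@[simp] theorem height_smul (c : ℤ) (x : ι → ℤ) : height (c • x) = c * height x := by
  simp [height, Finset.mul_sum]

@[simp] theorem height_simpleRoot (i : ι) : height (simpleRoot i) = 1 := by
  simp [height, simpleRoot]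

theorem form_refl_right (β x y : ι → ℤ) :
    form M y (refl M β x) = form M y x - form M β x * form M y β := by
  simp only [refl, map_sub, map_smul, smul_eq_mul]

theorem height_refl (β x : ι → ℤ) :
    height (refl M β x) = height x - form M β x * height β := by
  simp only [refl, height_sub, height_smul]

theorem refl_neg_left (β x : ι → ℤ) : refl M (-β) x = refl M β x := by
  simp [refl]

theorem refl_neg_right (β x : ι → ℤ) : refl M β (-x) = -refl M β x := by
  simp [refl]; abel

theorem refl_self {β : ι → ℤ} (h : form M β β = 2) : refl M β β = -β := by
  simp [refl, h, two_smul]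

theorem refl_of_perp {β x : ι → ℤ} (h : form M β x = 0) : refl M β x = x := by
  simp [refl, h]

theorem refl_refl {β : ι → ℤ} (h : form M β β = 2) (x : ι → ℤ) : refl M β (refl M β x) = x := by
  simp only [refl, map_sub, map_smul, h, smul_eq_mul]
  module

@[simp] theorem s_apply (i : ι) (x : ι → ℤ) : (s M i).1 x = refl M (simpleRoot i) x :=
  simpleRefl_apply M i x

theorem mul_apply (w w' : W M) (x : ι → ℤ) : (w * w').1 x = w.1 (w'.1 x) := rfl

@[simp] theorem one_apply (x : ι → ℤ) : (1 : W M).1 x = x := rfl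

@[simp] theorem inv_apply_apply (w : W M) (x : ι → ℤ) : w⁻¹.1 (w.1 x) = x := by
  rw [← mul_apply, inv_mul_cancel, one_apply]

@[simp] theorem apply_inv_apply (w : W M) (x : ι → ℤ) : w.1 (w⁻¹.1 x) = x := by
  rw [← mul_apply, mul_inv_cancel, one_apply]

theorem W_ext {w w' : W M} (h : ∀ x, w.1 x = w'.1 x) : w = w' :=
  Subtype.ext (LinearEquiv.ext h)

theorem s_mul_self (i : ι) : s M i * s M i = 1 :=
  W_ext fun x => by
    rw [mul_apply, s_apply, s_apply, refl_refl (form_simpleRoot_self M i), one_apply]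

theorem s_inv (i : ι) : (s M i)⁻¹ = s M i := inv_eq_of_mul_eq_one_left (s_mul_self i)

theorem apply_refl (w : W M) (β x : ι → ℤ) : w.1 (refl M β x) = refl M (w.1 β) (w.1 x) := by
  simp only [refl, map_sub, map_smul, form_invariant]

theorem closure_range_s : Subgroup.closure (Set.range (s M)) = ⊤ := by
  rw [eq_top_iff]
  rintro ⟨w, hw⟩ -
  induction hw using Subgroup.closure_induction with
  | mem g hg =>
    obtain ⟨i, rfl⟩ := hg
    exact Subgroup.subset_closure ⟨i, rfl⟩
  | one => exact one_mem _
  | mul g g' h1 h2 h h' => exact mul_mem h h'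
  | inv g h1 h => exact inv_mem h

/-- Induction on elements of the Weyl group. -/
theorem W_induction {p : W M → Prop} (one : p 1) (s_mul : ∀ i w, p w → p (s M i * w)) (w : W M) :
    p w := by
  have hw : w ∈ Subgroup.closure (Set.range (s M)) := by
    rw [closure_range_s]; exact Subgroup.mem_top _
  induction hw using Subgroup.closure_induction_left with
  | one => exact one
  | mul_left x hx y _ ih => obtain ⟨i, rfl⟩ := hx; exact s_mul i y ih
  | inv_mul_cancel x hx y _ ih => obtain ⟨i, rfl⟩ := hx; rw [s_inv]; exact s_mul i y ih

theorem IsRoot.form_self {v : ι → ℤ} (h : IsRoot M v) : form M v v = 2 := by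
  obtain ⟨w, i, rfl⟩ := h
  rw [form_invariant, form_simpleRoot_self]

theorem isRoot_simpleRoot (i : ι) : IsRoot M (simpleRoot i) := ⟨1, i, rfl⟩

theorem isPosRoot_simpleRoot (i : ι) : IsPosRoot M (simpleRoot i) :=
  ⟨isRoot_simpleRoot i, fun j => by
    simp only [simpleRoot, Pi.single_apply]; split_ifs <;> norm_num⟩

theorem IsRoot.apply {v : ι → ℤ} (h : IsRoot M v) (w : W M) : IsRoot M (w.1 v) := by
  obtain ⟨w', i, rfl⟩ := h
  exact ⟨w * w', i, rfl⟩

theorem IsRoot.neg {v : ι → ℤ} (h : IsRoot M v) : IsRoot M (-v) := by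
  obtain ⟨w, i, rfl⟩ := h
  refine ⟨w * s M i, i, ?_⟩
  rw [mul_apply, s_apply, refl_self (form_simpleRoot_self M i), map_neg]

theorem height_nonneg {v : ι → ℤ} (h : ∀ i, 0 ≤ v i) : 0 ≤ height v :=
  Finset.sum_nonneg fun i _ => h i

section PosDef

variable [PosDefForm M]

theorem form_self_pos {x : ι → ℤ} (h : x ≠ 0) : 0 < form M x x := by
  by_contra! h'
  exact h (PosDefForm.eq_zero_of_form_nonpos x h')

theorem form_self_nonneg (x : ι → ℤ) : 0 ≤ form M x x := by
  by_cases h : x = 0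
  · simp [h]
  · exact (form_self_pos h).le

theorem two_le_form_self {x : ι → ℤ} (h : x ≠ 0) : 2 ≤ form M x x := by
  have := form_self_pos (M := M) h
  obtain ⟨k, hk⟩ := even_form_self (M := M) x
  omega

theorem eq_of_form_eq_two {x y : ι → ℤ} (hx : form M x x = 2) (hy : form M y y = 2)
    (h : 2 ≤ form M x y) : x = y :=
  sub_eq_zero.1 (PosDefForm.eq_zero_of_form_nonpos (M := M) _ (by rw [form_sub_self]; omega))

theorem eq_neg_of_form_eq_neg_two {x y : ι → ℤ} (hx : form M x x = 2) (hy : form M y y = 2)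
    (h : form M x y ≤ -2) : x = -y :=
  eq_neg_of_add_eq_zero_left
    (PosDefForm.eq_zero_of_form_nonpos (M := M) _ (by rw [form_add_self]; omega))

/-- The positive and negative parts have disjoint supports, so their product is at most 0; if both
were nonzero, the norm would be at least 2 + 2. It is proved for all vectors of norm 2 so that it
applies to differences not known to be roots. -/
theorem nonneg_or_nonpos {v : ι → ℤ} (h : form M v v = 2) :
    (∀ i, 0 ≤ v i) ∨ ∀ i, v i ≤ 0 := by
  set p : ι → ℤ := fun i => max (v i) 0
  set q : ι → ℤ := fun i => max (-v i) 0
  have hv : v = p - q := by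
    ext i
    simp only [p, q, Pi.sub_apply]
    omega
  have hpq : form M p q ≤ 0 := by
    rw [form_apply]
    refine Finset.sum_nonpos fun i _ => Finset.sum_nonpos fun j _ => ?_
    by_cases hij : i = j
    · subst hij
      have : p i * q i = 0 := by
        rcases le_total (v i) 0 with h0 | h0
        · simp [p, h0]
        · simp [q, h0]
      rw [mul_right_comm, this, zero_mul]
    · have h1 : cartan M i j ≤ 0 := by
        rw [← form_simpleRoot_simpleRoot]; exact form_simpleRoot_nonpos hij
      have h2 : 0 ≤ p i := le_max_right _ _
      have h3 : 0 ≤ q j := le_max_right _ _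
      exact mul_nonpos_of_nonpos_of_nonneg (mul_nonpos_of_nonneg_of_nonpos h2 h1) h3
  rw [hv, form_sub_self] at h
  by_cases hp : p = 0
  · right
    intro i
    have := congrFun hp i
    simp only [p, Pi.zero_apply] at this
    omega
  · by_cases hq : q = 0
    · left
      intro i
      have := congrFun hq i
      simp only [q, Pi.zero_apply] at this
      omega
    · have := two_le_form_self (M := M) hp
      have := two_le_form_self (M := M) hq
      omega

theorem height_pos {v : ι → ℤ} (h : form M v v = 2) (hv : ∀ i, 0 ≤ v i) : 0 < height v := by
  refine lt_of_le_of_ne (height_nonneg hv) fun h0 => ?_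
  have : v = 0 := by
    ext i
    exact (Finset.sum_eq_zero_iff_of_nonneg fun i _ => hv i).1 h0.symm i (Finset.mem_univ i)
  simp [this] at h

theorem height_ne_zero {v : ι → ℤ} (h : form M v v = 2) : height v ≠ 0 := by
  rcases nonneg_or_nonpos h with hv | hv
  · exact (height_pos h hv).ne'
  · have h' : form M (-v) (-v) = 2 := by simpa using h
    have := height_pos h' fun i => by simpa using hv i
    rw [height_neg] at this
    omega

theorem exists_form_pos {v : ι → ℤ} (h : form M v v = 2) (hv : ∀ i, 0 ≤ v i) :
    ∃ j, 0 < v j ∧ 0 < form M (simpleRoot j) v := by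
  by_contra! h'
  have : form M v v ≤ 0 := by
    rw [form_eq_sum]
    refine Finset.sum_nonpos fun i _ => ?_
    rcases (hv i).eq_or_lt with h0 | h0
    · simp [← h0]
    · exact mul_nonpos_of_nonneg_of_nonpos (hv i) (h' i h0)
  omega

theorem IsRoot.pos_or_neg {v : ι → ℤ} (h : IsRoot M v) : IsPosRoot M v ∨ IsPosRoot M (-v) := by
  rcases nonneg_or_nonpos h.form_self with hv | hv
  · exact .inl ⟨h, hv⟩
  · exact .inr ⟨h.neg, fun i => by simpa using hv i⟩

theorem IsPosRoot.height_pos {v : ι → ℤ} (h : IsPosRoot M v) : 0 < height v :=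
  BrauerADE.height_pos h.1.form_self h.2

theorem IsPosRoot.not_neg {v : ι → ℤ} (h : IsPosRoot M v) : ¬ IsPosRoot M (-v) := fun h' => by
  have h1 := h.height_pos
  have h2 := h'.height_pos
  rw [height_neg] at h2
  omega

/-- A simple reflection permutes the positive roots other than its own. -/
theorem IsPosRoot.refl_simpleRoot {v : ι → ℤ} (h : IsPosRoot M v) {i : ι} (hi : v ≠ simpleRoot i) :
    IsPosRoot M (refl M (simpleRoot i) v) := by
  rw [← s_apply]
  rcases (h.1.apply (s M i)).pos_or_neg with h' | h'
  · exact h'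
  · exfalso
    -- Only the coefficient at `i` changes under the reflection, so a change of sign leaves `v`
    -- supported at `i`.
    have key : ∀ k, k ≠ i → v k = 0 := fun k hk => by
      have h1 := h'.2 k
      rw [s_apply] at h1
      simp [refl, simpleRoot, hk] at h1
      exact le_antisymm h1 (h.2 k)
    have hv : v = v i • simpleRoot i := by
      ext k
      by_cases hk : k = i
      · subst hk; simp [simpleRoot]
      · simp [simpleRoot, hk, key k hk]
    have h2 := h.1.form_self
    rw [hv] at h2
    simp only [map_smul, LinearMap.smul_apply, form_simpleRoot_self, smul_eq_mul] at h2
    have h3 : v i * v i = 1 := by linarith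
    have h4 := h.2 i
    have h5 : v i = 1 := by nlinarith
    rw [h5, one_smul] at hv
    exact hi hv

theorem abs_form_le_one {α β : ι → ℤ} (hα : form M α α = 2) (hβ : form M β β = 2) (h1 : α ≠ β)
    (h2 : α ≠ -β) : -1 ≤ form M α β ∧ form M α β ≤ 1 := by
  constructor
  · by_contra! h; exact h2 (eq_neg_of_form_eq_neg_two hα hβ (by omega))
  · by_contra! h; exact h1 (eq_of_form_eq_two hα hβ (by omega))

end PosDef

/-! ### Reflections in the Weyl group -/

/-- The reflection `r_β` as an element of the Weyl group. -/
noncomputable def reflW (β : ι → ℤ) (hβ : IsRoot M β) : W M :=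
  (exists_isReflectionIn M hβ).choose

@[simp] theorem reflW_apply {β : ι → ℤ} (hβ : IsRoot M β) (x : ι → ℤ) :
    (reflW β hβ).1 x = refl M β x := (exists_isReflectionIn M hβ).choose_spec x

theorem isReflectionIn_iff {β : ι → ℤ} (hβ : IsRoot M β) {w : W M} :
    IsReflectionIn M w β ↔ w = reflW β hβ :=
  ⟨fun h => W_ext fun x => by rw [h, reflW_apply], fun h x => by rw [h, reflW_apply]⟩

theorem reflW_simpleRoot (i : ι) : reflW (simpleRoot i) (isRoot_simpleRoot i) = s M i :=
  W_ext fun x => by simp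

theorem reflW_mul_self {β : ι → ℤ} (hβ : IsRoot M β) : reflW β hβ * reflW β hβ = 1 :=
  W_ext fun x => by rw [mul_apply]; simp [refl_refl hβ.form_self]

theorem mul_reflW (w : W M) {β : ι → ℤ} (hβ : IsRoot M β) :
    w * reflW β hβ = reflW (w.1 β) (hβ.apply w) * w :=
  W_ext fun x => by simp [apply_refl]

/-! ### The action on sets of positive roots -/

/-- `v ∈ B` or `-v ∈ B`. -/
def InPM (B : Set (ι → ℤ)) (v : ι → ℤ) : Prop := v ∈ B ∨ -v ∈ B

theorem inPM_neg {B : Set (ι → ℤ)} {v : ι → ℤ} : InPM B (-v) ↔ InPM B v := by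
  simp [InPM, or_comm]

/-- The set of positive roots among `± w β`, `β ∈ B`. -/
def wSet (w : W M) (B : Set (ι → ℤ)) : Set (ι → ℤ) :=
  {γ | IsPosRoot M γ ∧ ∃ β ∈ B, γ = w.1 β ∨ γ = -w.1 β}

theorem reflSet_eq_wSet (i : ι) (B : Set (ι → ℤ)) : reflSet M i B = wSet (s M i) B := rfl

theorem mem_wSet {w : W M} {B : Set (ι → ℤ)} {γ : ι → ℤ} :
    γ ∈ wSet w B ↔ IsPosRoot M γ ∧ InPM B (w⁻¹.1 γ) := by
  refine and_congr_right fun _ => ⟨?_, ?_⟩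
  · rintro ⟨β, hβ, rfl | rfl⟩
    · left; simpa using hβ
    · right; simpa using hβ
  · rintro (h | h)
    · exact ⟨_, h, .inl (by simp)⟩
    · exact ⟨_, h, .inr (by simp)⟩

section PosDef

variable [PosDefForm M]

theorem inPM_iff_of_pos {B : Set (ι → ℤ)} (hB : ∀ β ∈ B, IsPosRoot M β) {v : ι → ℤ}
    (hv : IsPosRoot M v) : InPM B v ↔ v ∈ B :=
  ⟨fun h => h.resolve_right fun h' => hv.not_neg (hB _ h'), .inl⟩

theorem inPM_wSet {w : W M} {B : Set (ι → ℤ)} (hB : ∀ β ∈ B, IsPosRoot M β) {v : ι → ℤ} :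
    InPM (wSet w B) v ↔ InPM B (w⁻¹.1 v) := by
  simp only [InPM, mem_wSet, map_neg, neg_neg]
  constructor
  · rintro (⟨_, h⟩ | ⟨_, h⟩)
    · exact h
    · exact h.symm
  · intro h
    have hr : IsRoot M v := by
      have : IsRoot M (w⁻¹.1 v) := by
        rcases h with h | h
        · exact (hB _ h).1
        · simpa using (hB _ h).1.neg
      simpa using this.apply w
    rcases hr.pos_or_neg with h' | h'
    · exact .inl ⟨h', h⟩
    · exact .inr ⟨h', h.symm⟩

theorem wSet_pos (w : W M) (B : Set (ι → ℤ)) : ∀ β ∈ wSet w B, IsPosRoot M β := fun _ h => h.1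

theorem inPM_ext {B B' : Set (ι → ℤ)} (hB : ∀ β ∈ B, IsPosRoot M β)
    (hB' : ∀ β ∈ B', IsPosRoot M β) (h : ∀ v, InPM B v ↔ InPM B' v) : B = B' := by
  ext v
  constructor
  · intro hv
    exact (inPM_iff_of_pos hB' (hB v hv)).1 ((h v).1 (.inl hv))
  · intro hv
    exact (inPM_iff_of_pos hB (hB' v hv)).1 ((h v).2 (.inl hv))

theorem wSet_one {B : Set (ι → ℤ)} (hB : ∀ β ∈ B, IsPosRoot M β) : wSet (1 : W M) B = B :=
  inPM_ext (wSet_pos _ _) hB fun v => by rw [inPM_wSet hB, inv_one, one_apply]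

theorem wSet_mul (w w' : W M) {B : Set (ι → ℤ)} (hB : ∀ β ∈ B, IsPosRoot M β) :
    wSet (w * w') B = wSet w (wSet w' B) :=
  inPM_ext (wSet_pos _ _) (wSet_pos _ _) fun v => by
    rw [inPM_wSet hB, inPM_wSet (wSet_pos _ _), inPM_wSet hB, mul_inv_rev, mul_apply]

theorem inPM_isRoot {B : Set (ι → ℤ)} (hB : ∀ β ∈ B, IsPosRoot M β) {v : ι → ℤ}
    (h : InPM B v) : IsRoot M v := by
  rcases h with h | h
  · exact (hB _ h).1
  · simpa using (hB _ h).1.neg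

theorem IsOrthogonalSet.form_eq {B : Set (ι → ℤ)} (hB : IsOrthogonalSet M B) {v v' : ι → ℤ}
    (h : InPM B v) (h' : InPM B v') : v = v' ∨ v = -v' ∨ form M v v' = 0 := by
  have key : ∀ β ∈ B, ∀ γ ∈ B, β = γ ∨ form M β γ = 0 := fun β hβ γ hγ => by
    by_cases e : β = γ
    · exact .inl e
    · exact .inr (hB.2 hβ hγ e)
  rcases h with h | h <;> rcases h' with h' | h' <;> rcases key _ h _ h' with e | e
  · exact .inl e
  · exact .inr (.inr e)
  · exact .inr (.inl e)
  · exact .inr (.inr (by simpa using e))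
  · exact .inr (.inl (by rw [← e, neg_neg]))
  · exact .inr (.inr (by simpa using e))
  · exact .inl (neg_injective e)
  · exact .inr (.inr (by simpa using e))

theorem isOrthogonalSet_wSet {B : Set (ι → ℤ)} (hB : IsOrthogonalSet M B) (w : W M) :
    IsOrthogonalSet M (wSet w B) := by
  refine ⟨wSet_pos _ _, fun β hβ γ hγ hne => ?_⟩
  rcases hB.form_eq (mem_wSet.1 hβ).2 (mem_wSet.1 hγ).2 with h | h | h
  · exact absurd ((w⁻¹).1.injective h) hne
  · rw [← map_neg] at h
    have := (w⁻¹).1.injective h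
    have h1 := hβ.1
    rw [this] at h1
    exact absurd h1 hγ.1.not_neg
  · rwa [form_invariant] at h

theorem inPM_pos {B : Set (ι → ℤ)} {v : ι → ℤ} (h : InPM B v) : ∃ β ∈ B, v = β ∨ v = -β := by
  rcases h with h | h
  · exact ⟨v, h, .inl rfl⟩
  · exact ⟨-v, h, .inr (neg_neg v).symm⟩

/-- Admissibility is insensitive to the signs of the three roots, since these affect neither their
reflections nor the absolute values. This form is the one that can be transported by the Weyl group.
-/
theorem IsAdmissible.inPM {B : Set (ι → ℤ)} (hB : IsAdmissible M B) {β₁ β₂ β₃ α : ι → ℤ}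
    (h1 : InPM B β₁) (h2 : InPM B β₂) (h3 : InPM B β₃) (h12 : form M β₁ β₂ = 0)
    (h13 : form M β₁ β₃ = 0) (h23 : form M β₂ β₃ = 0) (hα : IsRoot M α)
    (a1 : |form M α β₁| = 1) (a2 : |form M α β₂| = 1) (a3 : |form M α β₃| = 1) :
    InPM B (refl M α (refl M β₁ (refl M β₂ (refl M β₃ α)))) := by
  obtain ⟨γ₁, m1, e1⟩ := inPM_pos h1
  obtain ⟨γ₂, m2, e2⟩ := inPM_pos h2
  obtain ⟨γ₃, m3, e3⟩ := inPM_pos h3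
  have r1 : ∀ x, refl M β₁ x = refl M γ₁ x := fun x => by
    rcases e1 with rfl | rfl <;> simp [refl_neg_left]
  have r2 : ∀ x, refl M β₂ x = refl M γ₂ x := fun x => by
    rcases e2 with rfl | rfl <;> simp [refl_neg_left]
  have r3 : ∀ x, refl M β₃ x = refl M γ₃ x := fun x => by
    rcases e3 with rfl | rfl <;> simp [refl_neg_left]
  have f12 : form M γ₁ γ₂ = 0 := by rcases e1 with rfl | rfl <;> rcases e2 with rfl | rfl <;> simpa using h12
  have f13 : form M γ₁ γ₃ = 0 := by rcases e1 with rfl | rfl <;> rcases e3 with rfl | rfl <;> simpa using h13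
  have f23 : form M γ₂ γ₃ = 0 := by rcases e2 with rfl | rfl <;> rcases e3 with rfl | rfl <;> simpa using h23
  have b1 : |form M α γ₁| = 1 := by rcases e1 with rfl | rfl <;> simpa using a1
  have b2 : |form M α γ₂| = 1 := by rcases e2 with rfl | rfl <;> simpa using a2
  have b3 : |form M α γ₃| = 1 := by rcases e3 with rfl | rfl <;> simpa using a3
  have ne : ∀ {γ γ' : ι → ℤ}, γ ∈ B → form M γ γ' = 0 → γ ≠ γ' := fun hγ h e => by
    subst e
    rw [(hB.1.1 _ hγ).1.form_self] at h
    norm_num at h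
  rw [r1, r2, r3]
  set v := refl M α (refl M γ₁ (refl M γ₂ (refl M γ₃ α))) with hv
  have hr : IsRoot M v := by
    have := (((hα.apply (reflW γ₃ (hB.1.1 _ m3).1)).apply (reflW γ₂ (hB.1.1 _ m2).1)).apply
      (reflW γ₁ (hB.1.1 _ m1).1)).apply (reflW α hα)
    simpa using this
  rcases hr.pos_or_neg with h | h
  · exact .inl (hB.2 γ₁ m1 γ₂ m2 γ₃ m3 (ne m1 f12) (ne m1 f13) (ne m2 f23) α hα b1 b2 b3 v h
      (.inl rfl))
  · exact .inr (hB.2 γ₁ m1 γ₂ m2 γ₃ m3 (ne m1 f12) (ne m1 f13) (ne m2 f23) α hα b1 b2 b3 (-v) h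
      (.inr rfl))

theorem isAdmissible_wSet {B : Set (ι → ℤ)} (hB : IsAdmissible M B) (w : W M) :
    IsAdmissible M (wSet w B) := by
  refine ⟨isOrthogonalSet_wSet hB.1 w, fun β₁ h1 β₂ h2 β₃ h3 h12 h13 h23 α hα a1 a2 a3 γ hγ e => ?_⟩
  have ho := (isOrthogonalSet_wSet hB.1 w).2
  have := hB.inPM (mem_wSet.1 h1).2 (mem_wSet.1 h2).2 (mem_wSet.1 h3).2
    (α := w⁻¹.1 α) (by rw [form_invariant]; exact ho h1 h2 h12)
    (by rw [form_invariant]; exact ho h1 h3 h13) (by rw [form_invariant]; exact ho h2 h3 h23)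
    (hα.apply _) (by rwa [form_invariant]) (by rwa [form_invariant]) (by rwa [form_invariant])
  simp only [← apply_refl] at this
  refine mem_wSet.2 ⟨hγ, ?_⟩
  rcases e with rfl | rfl
  · exact this
  · rw [map_neg, inPM_neg]; exact this

/-- Two orthogonal roots whose sum is, up to signs, the sum of two elements of an admissible set
give reflections whose product fixes that set. -/
theorem IsAdmissible.wSet_reflW_mul_eq {B : Set (ι → ℤ)} (hB : IsAdmissible M B) {α α' β γ : ι → ℤ}
    (hα : IsRoot M α) (hα' : IsRoot M α') (hβ : InPM B β) (hγ : InPM B γ)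
    (hβγ : form M β γ = 0) (h : form M α α' = 0) (e : α + α' = β + γ) (h1 : form M α β = 1)
    (h2 : form M α γ = 1) : wSet (reflW α hα * reflW α' hα') B = B := by
  have hα2 := hα.form_self
  have hα2' := hα'.form_self
  have hβ2 := (inPM_isRoot hB.1.1 hβ).form_self
  have hγ2 := (inPM_isRoot hB.1.1 hγ).form_self
  have e' : α' = β + γ - α := by rw [← e]; abel
  -- Up to sign, β and γ are exchanged. Any other `v` is orthogonal to both, so it pairs to opposite
  -- values with α and α'. It is either fixed, or joined to α together with β and γ, and then
  -- admissibility yields its image up to sign.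
  have key : ∀ v, InPM B v → InPM B (refl M α (refl M α' v)) := fun v hv => by
    have hsum : form M (α + α') v = form M (β + γ) v := by rw [e]
    simp only [map_add, LinearMap.add_apply] at hsum
    have hv2 := (inPM_isRoot hB.1.1 hv).form_self
    have hex : refl M α (refl M α' v) = v - form M α v • α - form M α' v • α' := by
      simp only [refl, map_sub, map_smul, h, smul_zero, sub_zero]
      abel
    have hb : form M α' β = 1 := by
      rw [e']; simp [hβ2, form_symm M γ β, hβγ, h1]
    have hg : form M α' γ = 1 := by
      rw [e']; simp [hγ2, hβγ, h2]
    rcases hB.1.form_eq hv hβ with rfl | rfl | hvβ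
    · rw [hex, h1, hb, e', ← inPM_neg]
      convert hγ using 1; module
    · rw [hex, map_neg, map_neg, h1, hb, e']
      convert hγ using 1; module
    rcases hB.1.form_eq hv hγ with rfl | rfl | hvγ
    · rw [hex, h2, hg, e', ← inPM_neg]
      convert hβ using 1; module
    · rw [hex, map_neg, map_neg, h2, hg, e']
      convert hβ using 1; module
    rw [form_symm M β v, form_symm M γ v, hvβ, hvγ] at hsum
    by_cases h0 : form M α v = 0
    · rw [hex, h0, show form M α' v = 0 by omega]; simpa using hv
    have hb1 : |form M α v| = 1 := by
      have hne1 : α ≠ v := by rintro rfl; omega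
      have hne2 : α ≠ -v := by
        rintro rfl
        simp only [map_neg, LinearMap.neg_apply] at h1
        omega
      have := abs_form_le_one hα2 hv2 hne1 hne2
      rw [abs_eq one_pos.le]; omega
    have := hB.inPM hβ hγ hv hβγ (by rw [form_symm]; exact hvβ) (by rw [form_symm]; exact hvγ) hα
      (by rw [h1]; rfl) (by rw [h2]; rfl) hb1
    have hc : form M α v * form M α v = 1 := by
      rw [← abs_mul_abs_self, hb1]; rfl
    have hval : refl M α (refl M β (refl M γ (refl M v α))) =
        -(form M α v • (refl M α (refl M α' v))) := by
      have e3 : refl M β (refl M γ (refl M v α)) = -α' - form M α v • v := by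
        simp only [refl, map_sub, map_smul, form_symm M v α, form_symm M γ α, form_symm M β α,
          form_symm M β v, form_symm M γ v, hvβ, hvγ, h1, h2, hβγ, smul_zero, sub_zero, one_smul,
          e']
        module
      rw [e3, hex]
      have hα'v : form M α' v = - form M α v := by omega
      simp only [refl, map_sub, map_neg, map_smul, h, hα'v, smul_eq_mul, hc]
      have : ∀ c : ℤ, c * c = 1 → -α' - c • v - (-0 - 1 : ℤ) • α =
          -(c • (v - c • α - (-c) • α')) := fun c hc => by
        have h1 : c • c • α = α := by rw [smul_smul, hc, one_smul]
        have h2 : c • c • α' = α' := by rw [smul_smul, hc, one_smul]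
        rw [smul_sub, smul_sub, neg_smul, smul_neg, h1, h2]
        module
      exact this _ hc
    rw [hval, inPM_neg] at this
    rcases abs_eq one_pos.le |>.1 hb1 with h' | h'
    · rwa [h', one_smul] at this
    · rwa [h', neg_one_smul, inPM_neg] at this
  refine inPM_ext (wSet_pos _ _) hB.1.1 fun v => ?_
  rw [inPM_wSet hB.1.1]
  -- The product is an involution, so `key` gives both inclusions.
  have hinv : (reflW α hα * reflW α' hα')⁻¹ = reflW α hα * reflW α' hα' := by
    refine inv_eq_of_mul_eq_one_left ?_
    have hc : reflW α hα * reflW α' hα' = reflW α' hα' * reflW α hα := by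
      rw [mul_reflW]
      congr 1
      exact W_ext fun x => by simp [refl_of_perp h]
    calc _ = reflW α hα * reflW α' hα' * (reflW α' hα' * reflW α hα) := by rw [← hc]
      _ = 1 := by
        rw [mul_assoc, ← mul_assoc (reflW α' hα'), reflW_mul_self, one_mul, reflW_mul_self]
  have hval : ∀ v, (reflW α hα * reflW α' hα').1 v = refl M α (refl M α' v) := fun v => by
    rw [mul_apply]; simp
  rw [hinv, hval]
  refine ⟨fun hv => ?_, key v⟩
  have h3 := key _ hv
  rw [← hval, ← hval, ← mul_apply] at h3
  nth_rewrite 1 [← hinv] at h3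
  rwa [inv_mul_cancel, one_apply] at h3

end PosDef

end BrauerADE

namespace BrauerADE

set_option linter.unusedSectionVars false

variable {ι : Type*} [Fintype ι] [DecidableEq ι] {M : SimpleGraph ι}

/-! ### Raising nodes -/

variable (M) in
/-- The lowest of the roots of `B` moved by `r_k` is raised by `r_k`. -/
def Up (k : ι) (B : Set (ι → ℤ)) : Prop :=
  ∃ β ∈ B, form M (simpleRoot k) β = -1 ∧
    ∀ γ ∈ B, form M (simpleRoot k) γ = 1 → height β < height γ

section PosDef

variable [PosDefForm M] {B : Set (ι → ℤ)}

theorem IsOrthogonalSet.form_self (hB : IsOrthogonalSet M B) {β : ι → ℤ} (hβ : β ∈ B) :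
    form M β β = 2 := (hB.1 β hβ).1.form_self

theorem form_eq_zero_of_simpleRoot_mem (hB : IsOrthogonalSet M B) {k : ι}
    (hk : simpleRoot k ∈ B) {β : ι → ℤ} (hβ : β ∈ B) :
    β = simpleRoot k ∨ form M (simpleRoot k) β = 0 := by
  by_cases h : simpleRoot k = β
  · exact .inl h.symm
  · exact .inr (hB.2 hk hβ h)

theorem Up.not_mem (hB : IsOrthogonalSet M B) {k : ι} (h : Up M k B) : simpleRoot k ∉ B := by
  intro hk
  obtain ⟨β, hβ, h1, -⟩ := h
  rcases form_eq_zero_of_simpleRoot_mem hB hk hβ with rfl | h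
  · rw [form_simpleRoot_self] at h1; norm_num at h1
  · rw [h] at h1; norm_num at h1

theorem form_bound (hB : IsOrthogonalSet M B) {k : ι} (hk : simpleRoot k ∉ B) {β : ι → ℤ}
    (hβ : β ∈ B) :
    -1 ≤ form M (simpleRoot k) β ∧ form M (simpleRoot k) β ≤ 1 := by
  refine abs_form_le_one (form_simpleRoot_self M k) (hB.form_self hβ) ?_ ?_
  · rintro rfl; exact hk hβ
  · intro e
    have := isPosRoot_simpleRoot (M := M) k
    rw [e] at this
    exact (hB.1 β hβ).not_neg this

theorem form_sub_sub_self (hB : IsOrthogonalSet M B) {β γ : ι → ℤ} (hβ : β ∈ B) (hγ : γ ∈ B)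
    (hne : β ≠ γ) (u : ι → ℤ) : form M (γ - β - u) (γ - β - u) =
      4 + form M u u - 2 * (form M u γ - form M u β) := by
  have h0 := hB.2 hβ hγ hne
  simp only [map_sub, LinearMap.sub_apply, form_symm M γ, hB.form_self hβ, hB.form_self hγ, h0,
    form_symm M β u]
  ring

/-- Vectors of norm `2` have nonzero height, which restricts the heights in an orthogonal set. -/
theorem height_ne_add (hB : IsOrthogonalSet M B) {β γ : ι → ℤ} (hβ : β ∈ B) (hγ : γ ∈ B)
    (u : ι → ℤ) (h : form M u u + 2 = 2 * (form M u γ - form M u β)) :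
    height γ ≠ height β + height u := by
  intro e
  have hne : β ≠ γ := by
    rintro rfl
    have := form_self_nonneg (M := M) u
    omega
  have h2 : form M (γ - β - u) (γ - β - u) = 2 := by
    rw [form_sub_sub_self hB hβ hγ hne]; omega
  apply height_ne_zero h2
  rw [height_sub, height_sub, e]; ring

theorem eq_add_of_form (hB : IsOrthogonalSet M B) {β γ : ι → ℤ} (hβ : β ∈ B) (hγ : γ ∈ B)
    (u : ι → ℤ) (h : form M u u + 4 = 2 * (form M u γ - form M u β)) : γ = β + u := by
  have hne : β ≠ γ := by
    rintro rfl
    have := form_self_nonneg (M := M) u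
    omega
  have := PosDefForm.eq_zero_of_form_nonpos (M := M) (γ - β - u) (by
    rw [form_sub_sub_self hB hβ hγ hne]; omega)
  rw [sub_sub, sub_eq_zero] at this
  exact this

theorem height_ne_add_one (hB : IsOrthogonalSet M B) {β γ : ι → ℤ} (hβ : β ∈ B) (hγ : γ ∈ B)
    {k : ι} (h1 : form M (simpleRoot k) β = -1) (h2 : form M (simpleRoot k) γ = 1) :
    height γ ≠ height β + 1 := by
  have := height_ne_add hB hβ hγ (simpleRoot k) (by rw [form_simpleRoot_self]; omega)
  rwa [height_simpleRoot] at this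

theorem height_ne_add_two (hB : IsOrthogonalSet M B) {β γ : ι → ℤ} (hβ : β ∈ B) (hγ : γ ∈ B)
    {k i : ι} (hki : M.Adj k i) (h1 : form M (simpleRoot k) β = -1)
    (h2 : form M (simpleRoot k) γ = 1)
    (h3 : form M (simpleRoot i) β = form M (simpleRoot i) γ) :
    height γ ≠ height β + 2 := by
  have := height_ne_add hB hβ hγ (simpleRoot k + simpleRoot i) (by
    simp only [map_add, LinearMap.add_apply, form_simpleRoot_self, form_simpleRoot_of_adj hki,
      form_simpleRoot_of_adj hki.symm]
    omega)
  rw [height_add, height_simpleRoot, height_simpleRoot] at this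
  exact this

/-- The simple root itself is the only positive root made negative by its reflection, so no signs
have to be corrected. -/
theorem reflSet_eq_image (hB : ∀ β ∈ B, IsPosRoot M β) {i : ι} (hi : simpleRoot i ∉ B) :
    reflSet M i B = (fun β => refl M (simpleRoot i) β) '' B := by
  ext γ
  rw [reflSet_eq_wSet, mem_wSet, s_inv, s_apply]
  constructor
  · rintro ⟨h1, h2 | h2⟩
    · exact ⟨_, h2, refl_refl (form_simpleRoot_self M i) _⟩
    · exfalso
      by_cases e : γ = simpleRoot i
      · subst e
        rw [refl_self (form_simpleRoot_self M i), neg_neg] at h2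
        exact hi h2
      · exact (h1.refl_simpleRoot e).not_neg (hB _ h2)
  · rintro ⟨β, hβ, rfl⟩
    exact ⟨(hB β hβ).refl_simpleRoot fun e => hi (e ▸ hβ),
      .inl (by rwa [refl_refl (form_simpleRoot_self M i)])⟩

theorem reflSet_isOrthogonalSet (hB : IsOrthogonalSet M B) (i : ι) :
    IsOrthogonalSet M (reflSet M i B) := isOrthogonalSet_wSet hB (s M i)

theorem refl_mem_reflSet (hB : IsOrthogonalSet M B) {i : ι} (hi : simpleRoot i ∉ B) {β : ι → ℤ}
    (hβ : β ∈ B) : refl M (simpleRoot i) β ∈ reflSet M i B := by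
  rw [reflSet_eq_image hB.1 hi]
  exact ⟨β, hβ, rfl⟩

theorem reflSet_of_fixed (hB : IsOrthogonalSet M B) {i : ι}
    (h : ∀ β ∈ B, β = simpleRoot i ∨ form M (simpleRoot i) β = 0) : reflSet M i B = B := by
  have key : ∀ v, InPM B v → InPM B (refl M (simpleRoot i) v) := by
    rintro v hv
    have hv' : ∃ β ∈ B, v = β ∨ v = -β := inPM_pos hv
    obtain ⟨β, hβ, e⟩ := hv'
    rcases h β hβ with rfl | h0
    · rcases e with rfl | rfl
      · rw [refl_self (form_simpleRoot_self M i), inPM_neg]; exact hv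
      · rw [refl_neg_right, refl_self (form_simpleRoot_self M i), neg_neg]; exact .inl hβ
    · rw [refl_of_perp (by rcases e with rfl | rfl <;> simp [h0])]; exact hv
  refine inPM_ext (wSet_pos (s M i) B) hB.1 fun v => ?_
  rw [reflSet_eq_wSet, inPM_wSet hB.1, s_inv, s_apply]
  refine ⟨fun hv => ?_, key v⟩
  simpa [refl_refl (form_simpleRoot_self M i)] using key _ hv

theorem reflSet_of_perp (hB : IsOrthogonalSet M B) {i : ι} (h : Perp M i B) :
    reflSet M i B = B := reflSet_of_fixed hB fun β hβ => .inr (h β hβ)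

theorem reflSet_of_mem (hB : IsOrthogonalSet M B) {i : ι} (h : simpleRoot i ∈ B) :
    reflSet M i B = B := reflSet_of_fixed hB fun _ hβ => form_eq_zero_of_simpleRoot_mem hB h hβ

theorem reflSet_reflSet (hB : IsOrthogonalSet M B) (i : ι) :
    reflSet M i (reflSet M i B) = B := by
  rw [reflSet_eq_wSet, reflSet_eq_wSet, ← wSet_mul _ _ hB.1, s_mul_self, wSet_one hB.1]

/-- `B` is fixed by `r_i`, raised by `r_i`, or obtained by raising. -/
theorem perp_or_mem_or_up (hB : IsOrthogonalSet M B) (i : ι) :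
    Perp M i B ∨ simpleRoot i ∈ B ∨ Up M i B ∨ Up M i (reflSet M i B) := by
  by_cases hm : simpleRoot i ∈ B
  · exact .inr (.inl hm)
  by_cases hp : Perp M i B
  · exact .inl hp
  right; right
  let S : Set (ι → ℤ) := {β ∈ B | form M (simpleRoot i) β ≠ 0}
  have hS : S.Nonempty := by
    simp only [Perp, not_forall] at hp
    obtain ⟨β, hβ, h⟩ := hp
    exact ⟨β, hβ, h⟩
  -- This is the height of β plus the height of $r_i\beta$, the same for both roots. At a minimizer
  -- among the moved roots, the sign of $(\alpha_i,\beta)$ decides whether `B` or its reflected set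
  -- is the lower one.
  let f : (ι → ℤ) → ℕ := fun β => (2 * height β - form M (simpleRoot i) β).toNat
  have hf : ∀ β ∈ B, (f β : ℤ) = 2 * height β - form M (simpleRoot i) β := fun β hβ =>
    Int.toNat_of_nonneg (by
      have := (hB.1 β hβ).height_pos
      have := form_bound hB hm hβ
      omega)
  obtain ⟨β, ⟨hβ, h0⟩, hmin⟩ : ∃ β ∈ S, ∀ γ ∈ S, f β ≤ f γ := by
    obtain ⟨β, hβ, h⟩ := WellFounded.has_min (measure f).wf S hS
    exact ⟨β, hβ, fun γ hγ => not_lt.1 (h γ hγ)⟩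
  have hb := form_bound hB hm hβ
  have hmin' : ∀ γ ∈ B, form M (simpleRoot i) γ ≠ 0 → 2 * height β - form M (simpleRoot i) β ≤
      2 * height γ - form M (simpleRoot i) γ := fun γ hγ hγ0 => by
    rw [← hf β hβ, ← hf γ hγ]
    exact_mod_cast hmin γ ⟨hγ, hγ0⟩
  by_cases h1 : form M (simpleRoot i) β = -1
  · refine .inl ⟨β, hβ, h1, fun γ hγ h2 => ?_⟩
    have := hmin' γ hγ (by omega)
    omega
  · right
    simp only [Up, reflSet_eq_image hB.1 hm, Set.exists_mem_image, Set.forall_mem_image,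
      form_refl_right, height_refl, form_simpleRoot_self, height_simpleRoot]
    refine ⟨β, hβ, by omega, fun γ hγ h2 => ?_⟩
    have := hmin' γ hγ (by omega)
    omega

theorem not_perp_of_up {k : ι} (h : Up M k B) : ¬ Perp M k B := fun hp => by
  obtain ⟨β, hβ, h1, -⟩ := h
  rw [hp β hβ] at h1
  norm_num at h1

/-- A root with pairing 1 falls by one, so `Raises` asks for `height β < height γ - 1` where `Up`
asks for `height β < height γ`. The difference is the case `height γ = height β + 1`, which
`height_ne_add_one` excludes. -/
theorem raises_iff (hB : IsOrthogonalSet M B) {k : ι} : Raises M k B ↔ Up M k B := by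
  by_cases hm : simpleRoot k ∈ B
  · refine ⟨fun ⟨β, h, _⟩ => ?_, fun h => absurd hm (h.not_mem hB)⟩
    rw [reflSet_of_mem hB hm] at h
    exact absurd h.1 h.2
  have himg := reflSet_eq_image hB.1 hm
  have hmem : ∀ β ∈ B, (β ∈ reflSet M k B ↔ form M (simpleRoot k) β = 0) := fun β hβ => by
    have hb := form_bound hB hm hβ
    constructor
    · intro h
      rw [reflSet_eq_wSet, mem_wSet, s_inv, s_apply] at h
      have hf : form M (refl M (simpleRoot k) β) β = 2 - form M (simpleRoot k) β ^ 2 := by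
        simp only [refl, map_sub, LinearMap.sub_apply, map_smul, LinearMap.smul_apply, smul_eq_mul,
          hB.form_self hβ]; ring
      by_contra h0
      have h1 : form M (simpleRoot k) β ^ 2 = 1 := by
        rcases (by omega : form M (simpleRoot k) β = 1 ∨ form M (simpleRoot k) β = -1) with h | h
          <;> rw [h] <;> norm_num
      rw [h1] at hf
      rcases hB.form_eq h.2 (.inl hβ) with e | e | e
      · rw [e, hB.form_self hβ] at hf; norm_num at hf
      · rw [e] at hf; simp [hB.form_self hβ] at hf
      · omega
    · intro h
      rw [himg]
      exact ⟨β, hβ, refl_of_perp h⟩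
  have hmem' : ∀ β ∈ B, (refl M (simpleRoot k) β ∈ B ↔ form M (simpleRoot k) β = 0) :=
    fun β hβ => by
    rw [← hmem β hβ, reflSet_eq_wSet, mem_wSet, s_inv, s_apply]
    have hp := (hB.1 β hβ).refl_simpleRoot (i := k) fun e => hm (e ▸ hβ)
    rw [inPM_iff_of_pos hB.1 hp]
    exact (and_iff_right (hB.1 β hβ)).symm
  constructor
  · rintro ⟨β, ⟨hβ, h1⟩, h2⟩
    rw [hmem β hβ] at h1
    have hb := form_bound hB hm hβ
    have key : ∀ γ ∈ B, form M (simpleRoot k) γ ≠ 0 →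
        height β < height γ - form M (simpleRoot k) γ := fun γ hγ h0 => by
      have := h2 (refl M (simpleRoot k) γ) ⟨himg ▸ ⟨γ, hγ, rfl⟩, by rwa [hmem' γ hγ]⟩
      rwa [height_refl, height_simpleRoot, mul_one] at this
    have := key β hβ h1
    refine ⟨β, hβ, by omega, fun γ hγ h3 => ?_⟩
    have := key γ hγ (by omega)
    omega
  · rintro ⟨β₁, hβ₁, h1₁, h2₁⟩
    -- `Raises` compares with the raised roots too, so the lowest witness is taken.
    let S : Set (ι → ℤ) := {β ∈ B | form M (simpleRoot k) β = -1}
    obtain ⟨β, ⟨hβ, h1⟩, hmin⟩ : ∃ β ∈ S, ∀ γ ∈ S, height β ≤ height γ := by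
      obtain ⟨β, hβ, h⟩ := WellFounded.has_min (measure fun β : ι → ℤ => (height β).toNat).wf S
        ⟨β₁, hβ₁, h1₁⟩
      refine ⟨β, hβ, fun γ hγ => ?_⟩
      have h3 : ¬ (height γ).toNat < (height β).toNat := h γ hγ
      have := (hB.1 γ hγ.1).height_pos
      omega
    have h2 : ∀ γ ∈ B, form M (simpleRoot k) γ = 1 → height β < height γ := fun γ hγ h =>
      (hmin β₁ ⟨hβ₁, h1₁⟩).trans_lt (h2₁ γ hγ h)
    refine ⟨β, ⟨hβ, by rw [hmem β hβ]; omega⟩, ?_⟩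
    rintro γ' ⟨h3, h4⟩
    rw [himg] at h3
    obtain ⟨γ, hγ, rfl⟩ := h3
    simp only at h4 ⊢
    rw [hmem' γ hγ] at h4
    have hb := form_bound hB hm hγ
    rw [height_refl, height_simpleRoot, mul_one]
    rcases (by omega : form M (simpleRoot k) γ = -1 ∨ form M (simpleRoot k) γ = 1) with h | h
    · have := hmin γ ⟨hγ, h⟩; omega
    · have := h2 γ hγ h
      have := height_ne_add_one hB hβ hγ h1 h
      omega

/-! ### Local properties of raising nodes -/

theorem perp_reflSet_of_not_adj (hB : IsOrthogonalSet M B) {i j : ι} (hij : ¬ M.Adj i j)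
    (hi : Perp M i B) : Perp M i (reflSet M j B) := by
  by_cases e : i = j
  · subst e; rwa [reflSet_of_perp hB hi]
  intro γ hγ
  obtain ⟨-, β, hβ, rfl | rfl⟩ := hγ <;>
  simp [simpleRefl_apply, form_refl_right, hi β hβ, form_simpleRoot_of_not_adj e hij]

/-- For adjacent nodes $r_ir_j$ maps $\alpha_i$ to $\alpha_j$. -/
theorem perp_reflSet_reflSet {i j : ι} (hij : M.Adj i j)
    (hi : Perp M i B) : Perp M j (reflSet M i (reflSet M j B)) := by
  intro γ hγ
  obtain ⟨-, β', ⟨-, β, hβ, rfl | rfl⟩, rfl | rfl⟩ := hγ <;>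
  simp [simpleRefl_apply, form_refl_right, hi β hβ, form_simpleRoot_of_adj hij,
    form_simpleRoot_of_adj hij.symm, form_simpleRoot_self] <;> ring

/-- As $\alpha_i\perp B$, the pairing of $\alpha_i$ with $r_j\gamma$ is $(\alpha_j,\gamma)$, so the
same witness serves. It has risen by one and its competitors have fallen by one, so a gap of at
least 3 is needed; the gaps 1 and 2 do not occur. -/
theorem up_reflSet_of_perp_of_adj (hB : IsOrthogonalSet M B) {i j : ι} (hij : M.Adj i j)
    (hi : Perp M i B) (hj : Up M j B) : Up M i (reflSet M j B) := by
  have hm := hj.not_mem hB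
  obtain ⟨β, hβ, h1, h2⟩ := hj
  simp only [Up, reflSet_eq_image hB.1 hm, Set.exists_mem_image, Set.forall_mem_image,
      form_refl_right, height_refl, height_simpleRoot, form_simpleRoot_of_adj hij]
  refine ⟨β, hβ, by rw [hi β hβ]; omega, fun γ hγ h => ?_⟩
  rw [hi γ hγ] at h
  have hg : form M (simpleRoot j) γ = 1 := by omega
  have := h2 γ hγ hg
  have := height_ne_add_one hB hβ hγ h1 hg
  have := height_ne_add_two hB hβ hγ hij.symm h1 hg (by rw [hi β hβ, hi γ hγ])
  omega

/-- Pairings with $\alpha_k$ are unchanged by $r_j$, so only heights can interfere. The obstruction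
is a root with pairings (-1, -1) below one with pairings (1, 1); these differ by
$\alpha_j+\alpha_k$, and then $r_jr_k$ fixes `B` by admissibility. -/
theorem up_reflSet_of_up_of_not_adj (hB : IsAdmissible M B) {j k : ι} (hjk : ¬ M.Adj j k)
    (hj : Up M j B) (hk : Up M k B) :
    Up M k (reflSet M j B) ∨ reflSet M j B = reflSet M k B := by
  by_cases ejk : j = k
  · exact .inr (by rw [ejk])
  have c := form_simpleRoot_of_not_adj (M := M) ejk hjk
  have c' : form M (simpleRoot k) (simpleRoot j) = 0 := by rw [form_symm]; exact c
  have hmj := hj.not_mem hB.1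
  have hmk := hk.not_mem hB.1
  by_cases hex : ∃ β ∈ B, ∃ γ ∈ B, form M (simpleRoot j) β = -1 ∧ form M (simpleRoot k) β = -1 ∧
      form M (simpleRoot j) γ = 1 ∧ form M (simpleRoot k) γ = 1
  · right
    obtain ⟨β, hβ, γ, hγ, b1, b2, g1, g2⟩ := hex
    have e : γ = β + (simpleRoot j + simpleRoot k) := eq_add_of_form hB.1 hβ hγ _ (by
      simp only [map_add, LinearMap.add_apply, form_simpleRoot_self, c, c']; omega)
    have hne : γ ≠ β := by rintro rfl; omega
    have := hB.wSet_reflW_mul_eq (isRoot_simpleRoot j) (isRoot_simpleRoot k)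
      (β := γ) (γ := -β) (.inl hγ) (.inr (by simpa using hβ)) (by
        rw [map_neg, hB.1.2 hγ hβ hne, neg_zero]) c (by rw [e]; abel) g1 (by
        rw [map_neg, b1, neg_neg])
    rw [reflW_simpleRoot, reflW_simpleRoot, wSet_mul _ _ hB.1.1] at this
    have h2 := congrArg (reflSet M j) this
    rw [← reflSet_eq_wSet, ← reflSet_eq_wSet, reflSet_reflSet (reflSet_isOrthogonalSet hB.1 k)]
      at h2
    exact h2.symm
  · left
    obtain ⟨β, hβ, b1, b2⟩ := hk
    simp only [Up, reflSet_eq_image hB.1.1 hmj, Set.exists_mem_image, Set.forall_mem_image,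
      form_refl_right, height_refl, height_simpleRoot, c']
    refine ⟨β, hβ, by omega, fun γ hγ h => ?_⟩
    have g1 : form M (simpleRoot k) γ = 1 := by omega
    have h1 := b2 γ hγ g1
    have h2 := height_ne_add_one hB.1 hβ hγ b1 g1
    have := form_bound hB.1 hmj hβ
    have := form_bound hB.1 hmj hγ
    have : ¬ (form M (simpleRoot j) β = -1 ∧ form M (simpleRoot j) γ = 1) := fun ⟨a1, a2⟩ =>
      hex ⟨β, hβ, γ, hγ, a1, b1, a2, g1⟩
    omega

/-- Otherwise β would pair to -2 with the norm 2 vector $\alpha_j+\alpha_k$ and be its negative. -/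
theorem not_neg_one_neg_one (hB : IsOrthogonalSet M B) {j k : ι} (hjk : M.Adj j k) {β : ι → ℤ}
    (hβ : β ∈ B) (h1 : form M (simpleRoot j) β = -1) : form M (simpleRoot k) β ≠ -1 := fun h2 => by
  have h : β = -(simpleRoot j + simpleRoot k) := eq_neg_of_form_eq_neg_two (M := M)
    (hB.form_self hβ) (by
      simp only [map_add, LinearMap.add_apply, form_simpleRoot_self, form_simpleRoot_of_adj hjk,
        form_simpleRoot_of_adj hjk.symm]; norm_num)
    (by rw [form_symm]; simp only [map_add, LinearMap.add_apply]; omega)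
  have := (hB.1 β hβ).height_pos
  rw [h] at this
  simp at this

/-- After $r_j$ the relevant pairing is that with $\alpha_j+\alpha_k$. The new witness comes from
that of `j` or that of `k`: the only one whose new pairing is -1, or, if both qualify, the one that
is lower after the reflection. -/
theorem up_reflSet_of_up_of_adj (hB : IsOrthogonalSet M B) {j k : ι} (hjk : M.Adj j k)
    (hj : Up M j B) (hk : Up M k B) : Up M k (reflSet M j B) := by
  have hmj := hj.not_mem hB
  have hmk := hk.not_mem hB
  obtain ⟨β, hβ, b1, b2⟩ := hj
  obtain ⟨γ, hγ, g1, g2⟩ := hk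
  simp only [Up, reflSet_eq_image hB.1 hmj, Set.exists_mem_image, Set.forall_mem_image,
      form_refl_right, height_refl, height_simpleRoot, form_simpleRoot_of_adj hjk.symm]
  have nβ := not_neg_one_neg_one hB hjk hβ b1
  have nγ := mt (not_neg_one_neg_one hB hjk hγ) (not_not.2 g1)
  have bβ := form_bound hB hmk hβ
  have bγ := form_bound hB hmj hγ
  have gβ := b2 γ hγ
  have gγ := g2 β hβ
  have s0 := height_ne_add_one hB hβ hγ b1
  have key : ∀ δ ∈ B, form M (simpleRoot k) δ - form M (simpleRoot j) δ * -1 = 1 →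
      (form M (simpleRoot j) δ = 1 ∧ form M (simpleRoot k) δ = 0 ∧ height β + 1 < height δ ∧
        (form M (simpleRoot k) β = 0 → height β + 2 < height δ)) ∨
      (form M (simpleRoot j) δ = 0 ∧ form M (simpleRoot k) δ = 1 ∧ height γ < height δ) :=
      fun δ hδ h => by
    have := form_bound hB hmj hδ
    have := form_bound hB hmk hδ
    rcases (by omega : (form M (simpleRoot j) δ = 1 ∧ form M (simpleRoot k) δ = 0) ∨
      (form M (simpleRoot j) δ = 0 ∧ form M (simpleRoot k) δ = 1)) with ⟨h1, h2⟩ | ⟨h1, h2⟩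
    · have := b2 δ hδ h1
      have := height_ne_add_one hB hβ hδ b1 h1
      have := fun h : form M (simpleRoot k) β = 0 =>
        height_ne_add_two hB hβ hδ hjk b1 h1 (h.trans h2.symm)
      exact .inl ⟨h1, h2, by omega, fun h => by have := this h; omega⟩
    · exact .inr ⟨h1, h2, g2 δ hδ h2⟩
  rcases (by omega : form M (simpleRoot k) β = 1 ∨ form M (simpleRoot k) β = 0) with hb | hb
  · have hg : form M (simpleRoot j) γ = 0 := by omega
    refine ⟨γ, hγ, by omega, fun δ hδ h => ?_⟩
    rcases key δ hδ h with h | h <;> omega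
  · rcases (by omega : form M (simpleRoot j) γ = 1 ∨ form M (simpleRoot j) γ = 0) with hg | hg
    · refine ⟨β, hβ, by omega, fun δ hδ h => ?_⟩
      rcases key δ hδ h with h | h <;> omega
    · rcases le_total (height γ) (height β + 1) with hl | hl
      · refine ⟨γ, hγ, by omega, fun δ hδ h => ?_⟩
        rcases key δ hδ h with h | h <;> omega
      · refine ⟨β, hβ, by omega, fun δ hδ h => ?_⟩
        rcases key δ hδ h with h | h <;> omega

theorem reflSet_reflSet_eq_image (hB : IsOrthogonalSet M B) {i j : ι} (hj : simpleRoot j ∉ B)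
    (hi : simpleRoot i ∉ reflSet M j B) : reflSet M i (reflSet M j B) =
      (fun β => refl M (simpleRoot i) (refl M (simpleRoot j) β)) '' B := by
  rw [reflSet_eq_image (reflSet_isOrthogonalSet hB j).1 hi, reflSet_eq_image hB.1 hj,
    Set.image_image]

/-- Since $r_jr_k\alpha_j=\alpha_k$, the pairing of $\alpha_j$ after both reflections is that of
$\alpha_k$ before them, and the witness for `k` is reused. -/
theorem up_reflSet_reflSet_of_up_of_adj (hB : IsOrthogonalSet M B) {j k : ι} (hjk : M.Adj j k)
    (hj : Up M j B) (hk : Up M k B) : Up M j (reflSet M k (reflSet M j B)) := by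
  have hmj := hj.not_mem hB
  have hmk := hk.not_mem hB
  have hmkj := (up_reflSet_of_up_of_adj hB hjk hj hk).not_mem (reflSet_isOrthogonalSet hB j)
  obtain ⟨β, hβ, b1, b2⟩ := hk
  simp only [Up, reflSet_reflSet_eq_image hB hmj hmkj, Set.exists_mem_image, Set.forall_mem_image,
      form_refl_right, height_refl, height_simpleRoot, form_simpleRoot_of_adj hjk.symm,
      form_simpleRoot_of_adj hjk, form_simpleRoot_self]
  refine ⟨β, hβ, by omega, fun δ hδ h => ?_⟩
  have d1 : form M (simpleRoot k) δ = 1 := by omega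
  have := b2 δ hδ d1
  have := form_bound hB hmj hδ
  have := form_bound hB hmj hβ
  have := not_neg_one_neg_one hB hjk.symm hβ b1
  have := height_ne_add_one hB hβ hδ b1 d1
  have := fun h => height_ne_add_two hB hβ hδ hjk.symm b1 d1 h
  have hb := form_bound (reflSet_isOrthogonalSet hB j) hmkj (refl_mem_reflSet hB hmj hδ)
  rw [form_refl_right, form_simpleRoot_of_adj hjk.symm] at hb
  omega

/-! ### Local properties in rank three -/

/-- Pulled back to `B`, the pairing with $\alpha_k$ becomes that with $\alpha_j+\alpha_k$ in the
first claim and that with $\alpha_j$ in the second. The witnesses are therefore found as in rank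
two, but the extra reflection $r_i$ narrows the height gaps further. -/
theorem up_reflSet_reflSet_of_path (hB : IsOrthogonalSet M B) {i j k : ι} (hij : M.Adj i j)
    (hjk : M.Adj j k) (hik : ¬ M.Adj i k) (hne : i ≠ k) (hi : Perp M i B) (hj : Up M j B)
    (hk : Up M k B) : Up M k (reflSet M i (reflSet M j B)) ∧
      Up M k (reflSet M i (reflSet M j (reflSet M k B))) := by
  have hmj := hj.not_mem hB
  have hmk := hk.not_mem hB
  have hmij := (up_reflSet_of_perp_of_adj hB hij hi hj).not_mem (reflSet_isOrthogonalSet hB j)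
  have hujk := up_reflSet_of_up_of_adj hB hjk.symm hk hj
  have hmjk := hujk.not_mem (reflSet_isOrthogonalSet hB k)
  have hmijk := (up_reflSet_of_perp_of_adj (reflSet_isOrthogonalSet hB k) hij
    (perp_reflSet_of_not_adj hB hik hi) hujk).not_mem
    (reflSet_isOrthogonalSet (reflSet_isOrthogonalSet hB k) j)
  have cik := form_simpleRoot_of_not_adj (M := M) hne hik
  have cki : form M (simpleRoot k) (simpleRoot i) = 0 := by rw [form_symm]; exact cik
  obtain ⟨β, hβ, b1, b2⟩ := hj
  obtain ⟨γ, hγ, g1, g2⟩ := hk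
  have nβ := not_neg_one_neg_one hB hjk hβ b1
  have nγ := mt (not_neg_one_neg_one hB hjk hγ) (not_not.2 g1)
  have bβ := form_bound hB hmk hβ
  have bγ := form_bound hB hmj hγ
  have gβ := b2 γ hγ
  have gγ := g2 β hβ
  have s0 := height_ne_add_one hB hβ hγ b1
  -- Norm 0 forces $\delta=\beta+2\alpha_j+\alpha_i+\alpha_k$. Pairing with γ, which is orthogonal
  -- to β and δ, gives $2(\alpha_j,\gamma)=1$, impossible by parity.
  have swap : ∀ δ ∈ B, form M (simpleRoot j) δ = 1 → form M (simpleRoot k) δ = 0 →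
      form M (simpleRoot k) β ≠ 0 := fun δ hδ d1 d2 b3 => by
    have e := eq_add_of_form hB hβ hδ (simpleRoot j + simpleRoot j + simpleRoot i + simpleRoot k)
      (by
        simp only [map_add, LinearMap.add_apply, form_simpleRoot_self, form_simpleRoot_of_adj hjk,
          form_simpleRoot_of_adj hjk.symm, form_simpleRoot_of_adj hij,
          form_simpleRoot_of_adj hij.symm, cik, cki, hi β hβ, hi δ hδ]
        omega)
    have n1 : β ≠ γ := by rintro rfl; omega
    have n2 : δ ≠ γ := by rintro rfl; omega
    have f := hB.2 hδ hγ n2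
    rw [e] at f
    simp only [map_add, LinearMap.add_apply, hB.2 hβ hγ n1, hi γ hγ] at f
    omega
  constructor
  · simp only [Up, reflSet_reflSet_eq_image hB hmj hmij, Set.exists_mem_image,
      Set.forall_mem_image, form_refl_right, height_refl, height_simpleRoot,
      form_simpleRoot_of_adj hjk.symm, form_simpleRoot_of_adj hij, cki]
    have key : ∀ δ ∈ B, form M (simpleRoot k) δ + form M (simpleRoot j) δ = 1 →
      (form M (simpleRoot j) δ = 1 ∧ form M (simpleRoot k) δ = 0 ∧ height β + 1 < height δ ∧
        form M (simpleRoot k) β = 1) ∨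
      (form M (simpleRoot j) δ = 0 ∧ form M (simpleRoot k) δ = 1 ∧ height γ < height δ) :=
      fun δ hδ h => by
      have := form_bound hB hmj hδ
      have := form_bound hB hmk hδ
      rcases (by omega : (form M (simpleRoot j) δ = 1 ∧ form M (simpleRoot k) δ = 0) ∨
        (form M (simpleRoot j) δ = 0 ∧ form M (simpleRoot k) δ = 1)) with ⟨h1, h2⟩ | ⟨h1, h2⟩
      · have := b2 δ hδ h1
        have := height_ne_add_one hB hβ hδ b1 h1
        have := swap δ hδ h1 h2
        exact .inl ⟨h1, h2, by omega, by omega⟩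
      · exact .inr ⟨h1, h2, g2 δ hδ h2⟩
    have iγ := hi γ hγ
    have iβ := hi β hβ
    rcases (by omega : form M (simpleRoot k) β = 1 ∨ form M (simpleRoot k) β = 0) with hb | hb
    · have hg : form M (simpleRoot j) γ = 0 := by omega
      have s1 := height_ne_add_one hB hγ hβ g1 hb
      refine ⟨γ, hγ, by omega, fun δ hδ h => ?_⟩
      have iδ := hi δ hδ
      rcases key δ hδ (by omega) with h | h <;> omega
    · rcases (by omega : form M (simpleRoot j) γ = 1 ∨ form M (simpleRoot j) γ = 0) with hg | hg
      · refine ⟨β, hβ, by omega, fun δ hδ h => ?_⟩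
        have iδ := hi δ hδ
        rcases key δ hδ (by omega) with h | h <;> omega
      · rcases le_total (height γ) (height β + 2) with hl | hl
        · refine ⟨γ, hγ, by omega, fun δ hδ h => ?_⟩
          have iδ := hi δ hδ
          rcases key δ hδ (by omega) with h | h <;> omega
        · refine ⟨β, hβ, by omega, fun δ hδ h => ?_⟩
          have iδ := hi δ hδ
          rcases key δ hδ (by omega) with h | h <;> omega
  · rw [reflSet_reflSet_eq_image (reflSet_isOrthogonalSet hB k) hmjk hmijk,
      reflSet_eq_image hB.1 hmk]
    simp only [Up, Set.exists_mem_image,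
      Set.forall_mem_image, form_refl_right, height_refl, height_simpleRoot,
      form_simpleRoot_of_adj hjk.symm, form_simpleRoot_of_adj hjk, form_simpleRoot_of_adj hij,
      form_simpleRoot_self, cki, cik]
    have iβ := hi β hβ
    refine ⟨β, hβ, by omega, fun δ hδ h => ?_⟩
    have iδ := hi δ hδ
    have d1 : form M (simpleRoot j) δ = 1 := by omega
    have := form_bound hB hmk hδ
    have := b2 δ hδ d1
    have := height_ne_add_one hB hβ hδ b1 d1
    have := swap δ hδ d1
    have hb := form_bound (reflSet_isOrthogonalSet hB k) hmjk (refl_mem_reflSet hB hmk hδ)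
    rw [form_refl_right, form_simpleRoot_of_adj hjk] at hb
    omega

/-- As $\alpha_i\perp B$, the two pairings pull back to those with $\alpha_j+\alpha_k$ and with
$\alpha_k$. The third claim says that the two sides of the diagram really are distinct. -/
theorem up_reflSet_of_center (hB : IsOrthogonalSet M B) {i j k : ι} (hji : M.Adj j i)
    (hik : M.Adj i k) (hjk : ¬ M.Adj j k) (hne : j ≠ k) (hi : Perp M i B) (hj : Up M j B)
    (hk : Up M k B) : Up M k (reflSet M i (reflSet M j B)) ∧
      Up M i (reflSet M k (reflSet M i (reflSet M j B))) ∧ reflSet M j B ≠ reflSet M k B := by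
  have hmj := hj.not_mem hB
  have hmk := hk.not_mem hB
  have hmij := (up_reflSet_of_perp_of_adj hB hji.symm hi hj).not_mem (reflSet_isOrthogonalSet hB j)
  have cjk := form_simpleRoot_of_not_adj (M := M) hne hjk
  have ckj : form M (simpleRoot k) (simpleRoot j) = 0 := by rw [form_symm]; exact cjk
  have cji := form_simpleRoot_of_adj hji
  have cij := form_simpleRoot_of_adj hji.symm
  have cik := form_simpleRoot_of_adj hik
  have cki := form_simpleRoot_of_adj hik.symm
  obtain ⟨β, hβ, b1, b2⟩ := hj
  obtain ⟨γ, hγ, g1, g2⟩ := hk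
  have bβ := form_bound hB hmk hβ
  have bγ := form_bound hB hmj hγ
  have iγ := hi γ hγ
  have iβ := hi β hβ
  have nneg : ∀ δ ∈ B, form M (simpleRoot j) δ = -1 → form M (simpleRoot k) δ ≠ -1 :=
      fun δ hδ d1 d2 => by
    have h : δ = -(simpleRoot j + simpleRoot i + simpleRoot k) :=
      eq_neg_of_form_eq_neg_two (M := M) (hB.form_self hδ) (by
        simp only [map_add, LinearMap.add_apply, form_simpleRoot_self, cjk, ckj, cji, cij, cik, cki]
        norm_num)
      (by rw [form_symm]; simp only [map_add, LinearMap.add_apply, hi δ hδ]; omega)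
    have := (hB.1 δ hδ).height_pos
    rw [h] at this
    simp at this
  -- Such a δ equals $\alpha_j+\alpha_i+\alpha_k$, of height 3. Then β has height 1 and pairs to 1
  -- with $\alpha_k$, so that $\beta-\alpha_k$ has norm 2 and height 0.
  have npos : ∀ δ ∈ B, form M (simpleRoot j) δ = 1 → form M (simpleRoot k) δ ≠ 1 :=
      fun δ hδ d1 d2 => by
    have h : δ = simpleRoot j + simpleRoot i + simpleRoot k :=
      eq_of_form_eq_two (M := M) (hB.form_self hδ) (by
        simp only [map_add, LinearMap.add_apply, form_simpleRoot_self, cjk, ckj, cji, cij, cik, cki]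
        norm_num)
      (by rw [form_symm]; simp only [map_add, LinearMap.add_apply, hi δ hδ]; omega)
    have h0 := b2 δ hδ d1
    have n1 : δ ≠ β := by rintro rfl; omega
    have f := hB.2 hδ hβ n1
    rw [h] at f
    simp only [map_add, LinearMap.add_apply, iβ, b1] at f
    have h1 := height_ne_add_one hB hβ hδ b1 d1
    have h2 : height δ = 3 := by rw [h]; simp
    have h3 := (hB.1 β hβ).height_pos
    have h4 : form M (β - simpleRoot k) (β - simpleRoot k) = 2 := by
      rw [form_sub_self, form_symm M β (simpleRoot k), hB.form_self hβ, form_simpleRoot_self]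
      omega
    apply height_ne_zero h4
    rw [height_sub, height_simpleRoot]; omega
  -- The gaps 1, 2, 3, 4 are excluded by $\alpha_j$, $\alpha_j+\alpha_i$,
  -- $\alpha_j+\alpha_i+\alpha_k$ and $2\alpha_j+\alpha_i+\alpha_k$.
  have gap : ∀ {j k : ι}, M.Adj j i → M.Adj i k → form M (simpleRoot j) (simpleRoot k) = 0 →
      ∀ β ∈ B, ∀ δ ∈ B, form M (simpleRoot j) β = -1 → form M (simpleRoot j) δ = 1 →
      form M (simpleRoot k) β = 0 → form M (simpleRoot k) δ = 0 → height β < height δ →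
      height β + 4 < height δ := fun {j k} hji hik cjk β hβ δ hδ b1 d1 b2 d2 hlt => by
    have ckj : form M (simpleRoot k) (simpleRoot j) = 0 := by rw [form_symm]; exact cjk
    have iβ := hi β hβ
    have iδ := hi δ hδ
    have s1 := height_ne_add_one hB hβ hδ b1 d1
    have s2 := height_ne_add_two hB hβ hδ hji b1 d1 (by rw [iβ, iδ])
    have s3 := height_ne_add hB hβ hδ (simpleRoot j + simpleRoot i + simpleRoot k) (by
      simp only [map_add, LinearMap.add_apply, form_simpleRoot_self, cjk, ckj,
        form_simpleRoot_of_adj hji, form_simpleRoot_of_adj hji.symm, form_simpleRoot_of_adj hik,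
        form_simpleRoot_of_adj hik.symm]; omega)
    have s4 := height_ne_add hB hβ hδ (simpleRoot j + simpleRoot j + simpleRoot i + simpleRoot k)
      (by
        simp only [map_add, LinearMap.add_apply, form_simpleRoot_self, cjk, ckj,
        form_simpleRoot_of_adj hji, form_simpleRoot_of_adj hji.symm, form_simpleRoot_of_adj hik,
        form_simpleRoot_of_adj hik.symm]; omega)
    simp only [height_add, height_simpleRoot] at s3 s4
    omega
  have gapj := gap hji hik cjk
  have gapk := gap hik.symm hji.symm ckj
  have nβ := nneg β hβ b1
  have nγ : form M (simpleRoot j) γ ≠ -1 := fun h => nneg γ hγ h g1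
  have gβ := b2 γ hγ
  have gγ := g2 β hβ
  have s0 := height_ne_add_one hB hβ hγ b1
  have up1 : Up M k (reflSet M i (reflSet M j B)) := by
    simp only [Up, reflSet_reflSet_eq_image hB hmj hmij, Set.exists_mem_image,
      Set.forall_mem_image, form_refl_right, height_refl, height_simpleRoot,
      cij, cki, ckj]
    have key : ∀ δ ∈ B, form M (simpleRoot k) δ + form M (simpleRoot j) δ = 1 →
      (form M (simpleRoot j) δ = 1 ∧ form M (simpleRoot k) δ = 0 ∧ height β + 1 < height δ ∧
        (form M (simpleRoot k) β = 0 → height β + 4 < height δ)) ∨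
      (form M (simpleRoot j) δ = 0 ∧ form M (simpleRoot k) δ = 1 ∧ height γ + 1 < height δ) :=
      fun δ hδ h => by
      have := form_bound hB hmj hδ
      have := form_bound hB hmk hδ
      rcases (by omega : (form M (simpleRoot j) δ = 1 ∧ form M (simpleRoot k) δ = 0) ∨
        (form M (simpleRoot j) δ = 0 ∧ form M (simpleRoot k) δ = 1)) with ⟨h1, h2⟩ | ⟨h1, h2⟩
      · have h3 := b2 δ hδ h1
        have := height_ne_add_one hB hβ hδ b1 h1
        exact .inl ⟨h1, h2, by omega, fun h4 => gapj β hβ δ hδ b1 h1 h4 h2 h3⟩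
      · have := height_ne_add_one hB hγ hδ g1 h2
        have := g2 δ hδ h2
        exact .inr ⟨h1, h2, by omega⟩
    rcases (by omega : form M (simpleRoot k) β = 1 ∨ form M (simpleRoot k) β = 0) with hb | hb
    · have hg : form M (simpleRoot j) γ = 0 := by omega
      refine ⟨γ, hγ, by omega, fun δ hδ h => ?_⟩
      have iδ := hi δ hδ
      rcases key δ hδ (by omega) with h | h <;> omega
    · rcases (by omega : form M (simpleRoot j) γ = 1 ∨ form M (simpleRoot j) γ = 0) with hg | hg
      · refine ⟨β, hβ, by omega, fun δ hδ h => ?_⟩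
        have iδ := hi δ hδ
        rcases key δ hδ (by omega) with h | h <;> omega
      · rcases le_total (height γ) (height β + 2) with hl | hl
        · refine ⟨γ, hγ, by omega, fun δ hδ h => ?_⟩
          have iδ := hi δ hδ
          rcases key δ hδ (by omega) with h | h <;> omega
        · refine ⟨β, hβ, by omega, fun δ hδ h => ?_⟩
          have iδ := hi δ hδ
          rcases key δ hδ (by omega) with h | h <;> omega
  refine ⟨up1, ?_, fun e => ?_⟩
  · have hoij := reflSet_isOrthogonalSet (reflSet_isOrthogonalSet hB j) i
    rw [reflSet_eq_image hoij.1 (up1.not_mem hoij), reflSet_reflSet_eq_image hB hmj hmij]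
    simp only [Up, Set.exists_mem_image,
      Set.forall_mem_image, form_refl_right, height_refl, height_simpleRoot,
      cij, cki, ckj, cik, form_simpleRoot_self]
    refine ⟨γ, hγ, by omega, fun δ hδ h => ?_⟩
    have iδ := hi δ hδ
    have d1 : form M (simpleRoot k) δ = 1 := by omega
    have := form_bound hB hmj hδ
    have := npos δ hδ
    have h1 := g2 δ hδ d1
    have := height_ne_add_one hB hγ hδ g1 d1
    have := fun h2 h3 => gapk γ hγ δ hδ g1 d1 h2 h3 h1
    omega
  -- Comparing pairings gives $(\alpha_k,\beta)=1=(\alpha_j,\gamma)$, so each of the two witnesses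
  -- would be lower than the other.
  · have hm := refl_mem_reflSet hB hmj hβ
    have hm' := refl_mem_reflSet hB hmk hγ
    rw [e, reflSet_eq_image hB.1 hmk] at hm
    rw [← e, reflSet_eq_image hB.1 hmj] at hm'
    obtain ⟨δ, hδ, e1⟩ := hm
    obtain ⟨ε, hε, e2⟩ := hm'
    have f1 := congrArg (form M (simpleRoot i)) e1
    have f2 := congrArg (form M (simpleRoot k)) e1
    have f3 := congrArg (form M (simpleRoot i)) e2
    have f4 := congrArg (form M (simpleRoot j)) e2
    simp only [form_refl_right, form_simpleRoot_self, cij, cik, cjk, ckj] at f1 f2 f3 f4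
    have iδ := hi δ hδ
    have iε := hi ε hε
    have := b2 γ hγ (by omega)
    have := g2 β hβ (by omega)
    omega

/-- If some δ pairs to 1 with $\alpha_k$, norm 0 gives $\delta=\beta+2\alpha_k+\alpha_i+\alpha_j$.
Then β and δ are the only roots moved by $r_k$, and $r_ir_k$ and $r_jr_k$ agree on `B` with β and δ
interchanged. If there is no such δ, the witness β has no competitor. -/
theorem up_or_eq_of_perp_of_perp (hB : IsOrthogonalSet M B) {i j k : ι} (hik : M.Adj i k)
    (hkj : M.Adj k j) (hij : ¬ M.Adj i j) (hne : i ≠ j) (hi : Perp M i B) (hj : Perp M j B)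
    (hk : Up M k B) : Up M j (reflSet M i (reflSet M k B)) ∨
      reflSet M i (reflSet M k B) = reflSet M j (reflSet M k B) := by
  have hmk := hk.not_mem hB
  have hmik := (up_reflSet_of_perp_of_adj hB hik hi hk).not_mem (reflSet_isOrthogonalSet hB k)
  have hmjk := (up_reflSet_of_perp_of_adj hB hkj.symm hj hk).not_mem (reflSet_isOrthogonalSet hB k)
  have cij := form_simpleRoot_of_not_adj (M := M) hne hij
  have cji : form M (simpleRoot j) (simpleRoot i) = 0 := by rw [form_symm]; exact cij
  have cik := form_simpleRoot_of_adj hik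
  have cki := form_simpleRoot_of_adj hik.symm
  have ckj := form_simpleRoot_of_adj hkj
  have cjk := form_simpleRoot_of_adj hkj.symm
  obtain ⟨β, hβ, b1, b2⟩ := hk
  by_cases hex : ∃ δ ∈ B, form M (simpleRoot k) δ = 1
  · right
    obtain ⟨δ, hδ, d1⟩ := hex
    have e := eq_add_of_form hB hβ hδ (simpleRoot k + simpleRoot k + simpleRoot i + simpleRoot j)
      (by
        simp only [map_add, LinearMap.add_apply, form_simpleRoot_self, cij, cji, cik, cki, ckj, cjk,
          hi β hβ, hi δ hδ, hj β hβ, hj δ hδ]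
        omega)
    have hother : ∀ γ ∈ B, γ ≠ β → γ ≠ δ → form M (simpleRoot k) γ = 0 := fun γ hγ n1 n2 => by
      have f := hB.2 hδ hγ n2.symm
      rw [e] at f
      simp only [map_add, LinearMap.add_apply, hB.2 hβ hγ n1.symm, hi γ hγ, hj γ hγ] at f
      omega
    rw [reflSet_reflSet_eq_image hB hmk hmik, reflSet_reflSet_eq_image hB hmk hmjk]
    have key : ∀ γ ∈ B, refl M (simpleRoot i) (refl M (simpleRoot k) γ) =
        γ - form M (simpleRoot k) γ • (simpleRoot k + simpleRoot i) := fun γ hγ => by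
      simp only [refl, map_sub, map_smul, hi γ hγ, cik]; module
    have key' : ∀ γ ∈ B, refl M (simpleRoot j) (refl M (simpleRoot k) γ) =
        γ - form M (simpleRoot k) γ • (simpleRoot k + simpleRoot j) := fun γ hγ => by
      simp only [refl, map_sub, map_smul, hj γ hγ, cjk]; module
    have hcase : ∀ γ ∈ B, ∃ γ' ∈ B, γ - form M (simpleRoot k) γ • (simpleRoot k + simpleRoot i) =
        γ' - form M (simpleRoot k) γ' • (simpleRoot k + simpleRoot j) ∧
        γ' - form M (simpleRoot k) γ' • (simpleRoot k + simpleRoot i) =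
        γ - form M (simpleRoot k) γ • (simpleRoot k + simpleRoot j) := fun γ hγ => by
      by_cases n1 : γ = β
      · refine ⟨δ, hδ, ?_, ?_⟩ <;> rw [n1, d1, b1, e] <;> module
      by_cases n2 : γ = δ
      · refine ⟨β, hβ, ?_, ?_⟩ <;> rw [n2, d1, b1, e] <;> module
      · exact ⟨γ, hγ, by rw [hother γ hγ n1 n2]; module, by rw [hother γ hγ n1 n2]; module⟩
    ext v
    constructor
    · rintro ⟨γ, hγ, rfl⟩
      obtain ⟨γ', hγ', h1, h2⟩ := hcase γ hγ
      exact ⟨γ', hγ', by simp only [key γ hγ, key' γ' hγ', h1]⟩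
    · rintro ⟨γ, hγ, rfl⟩
      obtain ⟨γ', hγ', h1, h2⟩ := hcase γ hγ
      exact ⟨γ', hγ', by simp only [key γ' hγ', key' γ hγ, h2]⟩
  · left
    simp only [Up, reflSet_reflSet_eq_image hB hmk hmik, Set.exists_mem_image,
      Set.forall_mem_image, form_refl_right, height_refl, height_simpleRoot,
      cik, cji, cjk]
    have iβ := hi β hβ
    have jβ := hj β hβ
    refine ⟨β, hβ, by omega, fun δ hδ h => ?_⟩
    have iδ := hi δ hδ
    have jδ := hj δ hδ
    exact absurd ⟨δ, hδ, by omega⟩ hex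

end PosDef

end BrauerADE

namespace BrauerADE

set_option linter.unusedSectionVars false

variable {ι : Type*} [Fintype ι] [DecidableEq ι] {M : SimpleGraph ι}

/-! ### Raising terminates -/

section PosDef

variable [PosDefForm M]

/-- A root is determined by its pairings with the simple roots, and positive definiteness confines
these to the interval from -2 to 2. -/
theorem finite_roots : {v | IsRoot M v}.Finite := by
  have hinj : Set.InjOn (fun v : ι → ℤ => fun i => form M (simpleRoot i) v) {v | IsRoot M v} := by
    intro x _ y _ hxy
    refine sub_eq_zero.1 (PosDefForm.eq_zero_of_form_nonpos (M := M) (x - y) (le_of_eq ?_))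
    rw [form_eq_sum]
    refine Finset.sum_eq_zero fun i _ => ?_
    have := congrFun hxy i
    simp only at this
    rw [map_sub, this, sub_self, mul_zero]
  refine Set.Finite.of_finite_image (Set.Finite.subset
    (Set.Finite.pi' fun _ : ι => Set.finite_Icc (-2 : ℤ) 2) ?_) hinj
  rintro _ ⟨v, hv, rfl⟩ i
  have hv2 := (show IsRoot M v from hv).form_self
  constructor
  · by_contra! h
    have := eq_neg_of_form_eq_neg_two (form_simpleRoot_self M i) hv2 h.le
    rw [this] at h
    simp [hv2] at h
  · by_contra! h
    have := eq_of_form_eq_two (form_simpleRoot_self M i) hv2 h.le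
    rw [this, hv2] at h
    exact lt_irrefl _ h

open Classical in
variable (M) in
/-- A number that decreases when a set of roots is raised. -/
noncomputable def level (B : Set (ι → ℤ)) : ℕ :=
  let R := (finite_roots (M := M)).toFinset
  ∑ v ∈ R with v ∈ B, (R.card + 1) ^ ((∑ u ∈ R, |height u|) - height v).toNat

variable {B : Set (ι → ℤ)}

/-- In base `R.card + 1` a root weighs more the lower it is. One removed root is strictly lower than
all added ones, of which there are at most `R.card`, and so outweighs them together. -/
theorem level_reflSet_lt (hB : IsOrthogonalSet M B) {k : ι} (hk : Up M k B) :
    level M (reflSet M k B) < level M B := by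
  classical
  rw [← raises_iff hB] at hk
  obtain ⟨β, ⟨hβ, hβ'⟩, h⟩ := hk
  set R := (finite_roots (M := M)).toFinset with hR
  set H := ∑ u ∈ R, |height u| with hH
  have hle : ∀ v ∈ R, height v ≤ H := fun v hv =>
    (le_abs_self _).trans (Finset.single_le_sum (f := fun u : ι → ℤ => |height u|)
      (fun _ _ => abs_nonneg _) hv)
  have hmemR : ∀ v, IsPosRoot M v → v ∈ R := fun v hv => by simpa [hR] using hv.1
  set F : (ι → ℤ) → ℕ := fun v => (R.card + 1) ^ (H - height v).toNat with hF
  change ∑ v ∈ R with v ∈ reflSet M k B, F v < ∑ v ∈ R with v ∈ B, F v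
  set S := R.filter (· ∈ B)
  set S' := R.filter (· ∈ reflSet M k B)
  have e1 : ∑ v ∈ S, F v = ∑ v ∈ S \ S', F v + ∑ v ∈ S ∩ S', F v := by
    rw [← Finset.sum_union (Finset.disjoint_sdiff_inter S S'), Finset.sdiff_union_inter]
  have e2 : ∑ v ∈ S', F v = ∑ v ∈ S' \ S, F v + ∑ v ∈ S ∩ S', F v := by
    rw [Finset.inter_comm, ← Finset.sum_union (Finset.disjoint_sdiff_inter S' S),
      Finset.sdiff_union_inter]
  rw [e1, e2]
  refine Nat.add_lt_add_right ?_ _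
  have hβS : β ∈ S \ S' := by
    simp [S, S', hβ, hβ', hmemR β (hB.1 β hβ)]
  have h1 : F β ≤ ∑ v ∈ S \ S', F v := Finset.single_le_sum (fun _ _ => Nat.zero_le _) hβS
  refine lt_of_lt_of_le ?_ h1
  by_cases hem : (S' \ S) = ∅
  · rw [hem, Finset.sum_empty]
    exact pow_pos (Nat.succ_pos _) _
  obtain ⟨γ, hγ⟩ := Finset.nonempty_iff_ne_empty.2 hem
  have hγ' : ∀ γ ∈ S' \ S, height β < height γ ∧ γ ∈ R := fun γ hγ => by
    simp only [S, S', Finset.mem_sdiff, Finset.mem_filter, not_and] at hγ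
    exact ⟨h γ ⟨hγ.1.2, hγ.2 hγ.1.1⟩, hγ.1.1⟩
  obtain ⟨n, hn⟩ : ∃ n : ℕ, (H - height β).toNat = n + 1 := by
    have h2 := hle γ (hγ' γ hγ).2
    have := (hγ' γ hγ).1
    exact ⟨(H - height β).toNat - 1, by omega⟩
  have h2 : ∑ v ∈ S' \ S, F v ≤ (S' \ S).card • (R.card + 1) ^ n :=
    Finset.sum_le_card_nsmul _ _ _ fun v hv => by
      have := (hγ' v hv).1
      exact Nat.pow_le_pow_right (Nat.succ_pos _) (by omega)
  have h3 : (S' \ S).card < R.card + 1 :=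
    Nat.lt_succ_of_le (Finset.card_le_card
      (Finset.sdiff_subset.trans (Finset.filter_subset _ _)))
  calc _ ≤ _ := h2
    _ < (R.card + 1) * (R.card + 1) ^ n := by
      rw [smul_eq_mul]
      exact Nat.mul_lt_mul_of_pos_right h3 (pow_pos (Nat.succ_pos _) _)
    _ = F β := by rw [hF]; simp only; rw [hn, pow_succ, mul_comm]

/-! ### The highest element of an orbit -/

theorem s_comm {i j : ι} (h : ¬ M.Adj i j) : s M i * s M j = s M j * s M i := by
  by_cases e : i = j
  · rw [e]
  have c := form_simpleRoot_of_not_adj (M := M) e h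
  have c' : form M (simpleRoot j) (simpleRoot i) = 0 := by rw [form_symm]; exact c
  refine W_ext fun x => ?_
  simp only [mul_apply, s_apply, refl, map_sub, map_smul, c, c']
  module

theorem s_braid {i j : ι} (h : M.Adj i j) :
    s M i * s M j * s M i = s M j * s M i * s M j := by
  have c := form_simpleRoot_of_adj h
  have c' := form_simpleRoot_of_adj h.symm
  refine W_ext fun x => ?_
  simp only [mul_apply, s_apply, refl, map_sub, map_smul, c, c',
    form_simpleRoot_self]
  module

theorem reflSet_comm (hB : IsOrthogonalSet M B) {i j : ι} (h : ¬ M.Adj i j) :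
    reflSet M i (reflSet M j B) = reflSet M j (reflSet M i B) := by
  simp only [reflSet_eq_wSet]
  rw [← wSet_mul _ _ hB.1, ← wSet_mul _ _ hB.1, s_comm h]

theorem reflSet_braid (hB : IsOrthogonalSet M B) {i j : ι} (h : M.Adj i j) :
    reflSet M i (reflSet M j (reflSet M i B)) = reflSet M j (reflSet M i (reflSet M j B)) := by
  simp only [reflSet_eq_wSet]
  simp only [← wSet_mul _ _ hB.1, ← mul_assoc, s_braid h]

theorem isAdmissible_reflSet (hB : IsAdmissible M B) (i : ι) : IsAdmissible M (reflSet M i B) :=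
  isAdmissible_wSet hB (s M i)

variable (M) in
/-- `B'` is obtained from `B` by raising. -/
def UpStep (B B' : Set (ι → ℤ)) : Prop := ∃ i, Up M i B ∧ B' = reflSet M i B

variable (M) in
/-- No node raises `B`. -/
def IsTop (B : Set (ι → ℤ)) : Prop := ∀ i, ¬ Up M i B

/-- Local confluence: the braid hexagon for adjacent nodes, and otherwise a square, which may
collapse. -/
theorem exists_common_upper (hB : IsAdmissible M B) {j k : ι} (hj : Up M j B) (hk : Up M k B) :
    ∃ D, Relation.ReflTransGen (UpStep M) (reflSet M j B) D ∧
      Relation.ReflTransGen (UpStep M) (reflSet M k B) D := by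
  by_cases h : M.Adj j k
  · refine ⟨_, .tail (.single ⟨k, up_reflSet_of_up_of_adj hB.1 h hj hk, rfl⟩)
      ⟨j, up_reflSet_reflSet_of_up_of_adj hB.1 h hj hk, rfl⟩, ?_⟩
    rw [reflSet_braid hB.1 h]
    exact .tail (.single ⟨j, up_reflSet_of_up_of_adj hB.1 h.symm hk hj, rfl⟩)
      ⟨k, up_reflSet_reflSet_of_up_of_adj hB.1 h.symm hk hj, rfl⟩
  · rcases up_reflSet_of_up_of_not_adj hB h hj hk with h1 | h1
    · rcases up_reflSet_of_up_of_not_adj hB (fun h' => h h'.symm) hk hj with h2 | h2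
      · exact ⟨_, .single ⟨k, h1, rfl⟩, .single ⟨j, h2, reflSet_comm hB.1 fun h' => h h'.symm⟩⟩
      · exact ⟨_, .refl, h2 ▸ .refl⟩
    · exact ⟨_, .refl, h1 ▸ .refl⟩

theorem UpStep.isAdmissible {B' : Set (ι → ℤ)} (hB : IsAdmissible M B)
    (h : Relation.ReflTransGen (UpStep M) B B') : IsAdmissible M B' := by
  induction h with
  | refl => exact hB
  | tail _ h ih => obtain ⟨i, -, rfl⟩ := h; exact isAdmissible_reflSet ih i

theorem exists_isTop {B : Set (ι → ℤ)} (hB : IsAdmissible M B) :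
    ∃ T, Relation.ReflTransGen (UpStep M) B T ∧ IsTop M T := by
  by_cases h : ∃ i, Up M i B
  · obtain ⟨i, hi⟩ := h
    have := level_reflSet_lt hB.1 hi
    obtain ⟨T, h1, h2⟩ := exists_isTop (isAdmissible_reflSet hB i)
    exact ⟨T, .head ⟨i, hi, rfl⟩ h1, h2⟩
  · exact ⟨B, .refl, not_exists.1 h⟩
termination_by level M B

/-- Newman's lemma, by induction on the level. -/
theorem isTop_unique {B : Set (ι → ℤ)} (hB : IsAdmissible M B) {T T' : Set (ι → ℤ)}
    (h1 : Relation.ReflTransGen (UpStep M) B T) (h1' : Relation.ReflTransGen (UpStep M) B T')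
    (h2 : IsTop M T) (h2' : IsTop M T') : T = T' := by
  rcases h1.cases_head with rfl | ⟨C, ⟨j, hj, rfl⟩, hC⟩
  · rcases h1'.cases_head with rfl | ⟨C', ⟨k, hk, -⟩, -⟩
    · rfl
    · exact absurd hk (h2 k)
  · rcases h1'.cases_head with rfl | ⟨C', ⟨k, hk, rfl⟩, hC'⟩
    · exact absurd hj (h2' j)
    · obtain ⟨D, hD, hD'⟩ := exists_common_upper hB hj hk
      have hl := level_reflSet_lt hB.1 hj
      have hl' := level_reflSet_lt hB.1 hk
      obtain ⟨U, hU, hU'⟩ := exists_isTop (UpStep.isAdmissible (isAdmissible_reflSet hB j) hD)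
      exact (isTop_unique (isAdmissible_reflSet hB j) hC (hD.trans hU) h2 hU').trans
        (isTop_unique (isAdmissible_reflSet hB k) hC' (hD'.trans hU) h2' hU').symm
termination_by level M B

theorem InOrbit.isAdmissible {X : Set (ι → ℤ)} (hX : IsAdmissible M X) (h : InOrbit M X B) :
    IsAdmissible M B := by
  induction h with
  | refl => exact hX
  | tail _ h ih => obtain ⟨i, rfl⟩ := h; exact isAdmissible_reflSet ih i

theorem InOrbit.of_upStep {X B' : Set (ι → ℤ)} (h : InOrbit M X B)
    (h' : Relation.ReflTransGen (UpStep M) B B') : InOrbit M X B' :=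
  h.trans (by
    induction h' with
    | refl => exact .refl
    | tail _ h ih => obtain ⟨i, -, e⟩ := h; exact ih.tail ⟨i, e⟩)

/-- A simple reflection fixes a set, raises it or undoes a raising, so the top reached by raising is
constant along the orbit. -/
theorem InOrbit.isTop_unique {X T T' : Set (ι → ℤ)} (hX : IsAdmissible M X) (h : InOrbit M X B)
    (h1 : Relation.ReflTransGen (UpStep M) X T) (h1' : Relation.ReflTransGen (UpStep M) B T')
    (h2 : IsTop M T) (h2' : IsTop M T') : T = T' := by
  induction h generalizing T' with
  | refl => exact BrauerADE.isTop_unique hX h1 h1' h2 h2'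
  | @tail B C h h' ih =>
    obtain ⟨i, rfl⟩ := h'
    have hB : IsAdmissible M B := InOrbit.isAdmissible hX h
    rcases perp_or_mem_or_up hB.1 i with hi | hi | hi | hi
    · rw [reflSet_of_perp hB.1 hi] at h1'; exact ih h1' h2'
    · rw [reflSet_of_mem hB.1 hi] at h1'; exact ih h1' h2'
    · exact ih (.head ⟨i, hi, rfl⟩ h1') h2'
    · obtain ⟨U, hU, hU'⟩ := exists_isTop hB
      rw [ih hU hU']
      exact BrauerADE.isTop_unique (isAdmissible_reflSet hB i)
        (.head ⟨i, hi, (reflSet_reflSet hB.1 i).symm⟩ hU) h1' hU' h2'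

theorem below_iff (hB : IsAdmissible M B) {B' : Set (ι → ℤ)} :
    Below M B B' ↔ Relation.TransGen (UpStep M) B B' := by
  constructor
  · intro h
    have : Relation.TransGen (UpStep M) B B' ∧ IsAdmissible M B' := by
      induction h with
      | single h =>
        obtain ⟨i, hi, rfl⟩ := h
        exact ⟨.single ⟨i, (raises_iff hB.1).1 hi, rfl⟩, isAdmissible_reflSet hB i⟩
      | tail _ h ih =>
        obtain ⟨i, hi, rfl⟩ := h
        exact ⟨ih.1.tail ⟨i, (raises_iff ih.2.1).1 hi, rfl⟩, isAdmissible_reflSet ih.2 i⟩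
    exact this.1
  · intro h
    have : Below M B B' ∧ IsAdmissible M B' := by
      induction h with
      | single h =>
        obtain ⟨i, hi, rfl⟩ := h
        exact ⟨.single ⟨i, (raises_iff hB.1).2 hi, rfl⟩, isAdmissible_reflSet hB i⟩
      | tail _ h ih =>
        obtain ⟨i, hi, rfl⟩ := h
        exact ⟨ih.1.tail ⟨i, (raises_iff ih.2.1).2 hi, rfl⟩, isAdmissible_reflSet ih.2 i⟩
    exact this.1

theorem isHighest_iff {X : Set (ι → ℤ)} (hX : IsAdmissible M X) :
    IsHighest M X B ↔ InOrbit M X B ∧ IsTop M B := by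
  refine and_congr_right fun h => ?_
  have hB := InOrbit.isAdmissible hX h
  constructor
  · intro hb i hi
    exact hb _ (h.tail ⟨i, rfl⟩) ((below_iff hB).2 (.single ⟨i, hi, rfl⟩))
  · intro ht B' _ hb
    rw [below_iff hB] at hb
    obtain ⟨C, ⟨i, hi, -⟩, -⟩ := Relation.TransGen.head'_iff.1 hb
    exact ht i hi

theorem existsUnique_isHighest {X : Set (ι → ℤ)} (hX : IsAdmissible M X) :
    ∃! B₀, IsHighest M X B₀ := by
  obtain ⟨T, h1, h2⟩ := exists_isTop hX
  refine ⟨T, (isHighest_iff hX).2 ⟨InOrbit.of_upStep .refl h1, h2⟩, fun T' h => ?_⟩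
  replace h := (isHighest_iff hX).1 h
  exact (InOrbit.isTop_unique hX h.1 h1 .refl h2 h.2).symm

theorem IsHighest.eq_of_isTop {X B₀ T : Set (ι → ℤ)} (hX : IsAdmissible M X)
    (h₀ : IsHighest M X B₀) (h : InOrbit M X T) (hT : IsTop M T) : T = B₀ :=
  (existsUnique_isHighest hX).unique ((isHighest_iff hX).2 ⟨h, hT⟩) h₀

end PosDef

end BrauerADE

namespace BrauerADE

set_option linter.unusedSectionVars false

variable {ι : Type*} [Fintype ι] [DecidableEq ι] {M : SimpleGraph ι}

/-! ### The labels `h_{B,i}` -/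

section PosDef

variable [PosDefForm M] {B B₀ : Set (ι → ℤ)}

/-- The simple roots of a triangle would have a sum of norm 0. -/
theorem not_adj_of_adj_of_adj {i j k : ι} (hij : M.Adj i j) (hik : M.Adj i k) : ¬ M.Adj j k := by
  intro hjk
  have := PosDefForm.eq_zero_of_form_nonpos (M := M) (simpleRoot i + simpleRoot j + simpleRoot k)
    (by simp only [map_add, LinearMap.add_apply, form_simpleRoot_self, form_simpleRoot_of_adj hij,
          form_simpleRoot_of_adj hij.symm, form_simpleRoot_of_adj hik, form_simpleRoot_of_adj hik.symm,
          form_simpleRoot_of_adj hjk, form_simpleRoot_of_adj hjk.symm]; norm_num)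
  have := congrArg height this
  simp [height] at this
  simp [simpleRoot, Finset.sum_add_distrib] at this

variable (M B₀) in
/-- `h_{B,i} = h_{B',i'}`. -/
def SameLabel (B : Set (ι → ℤ)) (i : ι) (B' : Set (ι → ℤ)) (i' : ι) : Prop :=
  ∀ m, HRel M B₀ B i m ↔ HRel M B₀ B' i' m

theorem SameLabel.symm {B B' : Set (ι → ℤ)} {i i' : ι} (h : SameLabel M B₀ B i B' i') :
    SameLabel M B₀ B' i' B i := fun m => (h m).symm

theorem SameLabel.trans {B B' B'' : Set (ι → ℤ)} {i i' i'' : ι} (h : SameLabel M B₀ B i B' i')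
    (h' : SameLabel M B₀ B' i' B'' i'') : SameLabel M B₀ B i B'' i'' :=
  fun m => (h m).trans (h' m)

theorem SameLabel.of_eq {B B' : Set (ι → ℤ)} (h : B = B') (i : ι) : SameLabel M B₀ B i B' i :=
  fun _ => by rw [h]

variable (M B₀) in
/-- The rules for `h_{B,i}` hold in both directions at `B`. -/
def RulesAt (B : Set (ι → ℤ)) : Prop := ∀ i j, Perp M i B → Up M j B →
  (¬ M.Adj i j → SameLabel M B₀ B i (reflSet M j B) i) ∧
  (M.Adj i j → SameLabel M B₀ B i (reflSet M i (reflSet M j B)) j)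

theorem sameLabel_of_not_adj (hB : IsOrthogonalSet M B) {i j : ι} (hi : Perp M i B)
    (hij : ¬ M.Adj i j) (g : RulesAt M B₀ B) (g' : RulesAt M B₀ (reflSet M j B)) :
    SameLabel M B₀ B i (reflSet M j B) i := by
  rcases perp_or_mem_or_up hB j with h | h | h | h
  · exact .of_eq (reflSet_of_perp hB h).symm i
  · exact .of_eq (reflSet_of_mem hB h).symm i
  · exact (g i j hi h).1 hij
  · have := (g' i j (perp_reflSet_of_not_adj hB hij hi) h).1 hij
    rw [reflSet_reflSet hB] at this
    exact this.symm

variable (M B₀) in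
/-- The value of `h_{B,i}` given by the rule for the raising node `j`. -/
def RuleLabel (B : Set (ι → ℤ)) (i j m : ι) : Prop :=
  (¬ M.Adj i j ∧ HRel M B₀ (reflSet M j B) i m) ∨
  (M.Adj i j ∧ HRel M B₀ (reflSet M i (reflSet M j B)) j m)

/-! ### Independence of the label from the raising node -/

section Above

variable (hB : IsAdmissible M B)
  (ih : ∀ B', IsAdmissible M B' → level M B' < level M B → RulesAt M B₀ B')

-- Neither rule changes the node `i`, so its label can be carried along both sides of the hexagon or
-- square that joins the two sets.
include hB ih in
theorem sameLabel_of_not_adj_of_not_adj {i j k : ι} (hi : Perp M i B) (hj : Up M j B)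
    (hk : Up M k B) (hij : ¬ M.Adj i j) (hik : ¬ M.Adj i k) :
    SameLabel M B₀ (reflSet M j B) i (reflSet M k B) i := by
  have aj := isAdmissible_reflSet hB j
  have ak := isAdmissible_reflSet hB k
  have lj := level_reflSet_lt hB.1 hj
  have lk := level_reflSet_lt hB.1 hk
  have pj := perp_reflSet_of_not_adj hB.1 hij hi
  have pk := perp_reflSet_of_not_adj hB.1 hik hi
  by_cases hjk : M.Adj j k
  · have key : ∀ {j k : ι}, M.Adj j k → Up M j B → Up M k B → ¬ M.Adj i j → ¬ M.Adj i k →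
        SameLabel M B₀ (reflSet M j B) i (reflSet M j (reflSet M k (reflSet M j B))) i :=
        fun {j k} hjk hj hk hij hik => by
      have aj := isAdmissible_reflSet hB j
      have lj := level_reflSet_lt hB.1 hj
      have pj := perp_reflSet_of_not_adj hB.1 hij hi
      have u1 := up_reflSet_of_up_of_adj hB.1 hjk hj hk
      have u2 := up_reflSet_reflSet_of_up_of_adj hB.1 hjk hj hk
      have l1 := level_reflSet_lt aj.1 u1
      exact ((ih _ aj lj i k pj u1).1 hik).trans ((ih _ (isAdmissible_reflSet aj k) (l1.trans lj)
        i j (perp_reflSet_of_not_adj aj.1 hik pj) u2).1 hij)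
    have h1 := key hjk hj hk hij hik
    rw [reflSet_braid hB.1 hjk] at h1
    exact h1.trans (key hjk.symm hk hj hik hij).symm
  · rcases up_reflSet_of_up_of_not_adj hB hjk hj hk with h1 | h1
    · rcases up_reflSet_of_up_of_not_adj hB (fun h' => hjk h'.symm) hk hj with h2 | h2
      · have e1 := (ih _ aj lj i k pj h1).1 hik
        rw [reflSet_comm hB.1 fun h' => hjk h'.symm] at e1
        exact e1.trans ((ih _ ak lk i j pk h2).1 hij).symm
      · exact .of_eq h2.symm i
    · exact .of_eq h1 i

-- For `j ∼ k` the two labels become those of `k` at $r_jr_kr_ir_jB$ and at $r_jr_kr_ir_jr_kB$, and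
-- these sets differ by $r_i$ with $i\not\sim k$. For $j\not\sim k$ a square is completed; it cannot
-- collapse, as $\alpha_i\perp r_kB$ while $r_i$ raises $r_jB$.
include hB ih in
theorem sameLabel_of_adj_of_not_adj {i j k : ι} (hi : Perp M i B) (hj : Up M j B)
    (hk : Up M k B) (hij : M.Adj i j) (hik : ¬ M.Adj i k) :
    SameLabel M B₀ (reflSet M i (reflSet M j B)) j (reflSet M k B) i := by
  have aj := isAdmissible_reflSet hB j
  have aij := isAdmissible_reflSet aj i
  have ak := isAdmissible_reflSet hB k
  have lj := level_reflSet_lt hB.1 hj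
  have lk := level_reflSet_lt hB.1 hk
  have pk := perp_reflSet_of_not_adj hB.1 hik hi
  have uij := up_reflSet_of_perp_of_adj hB.1 hij hi hj
  have lij := (level_reflSet_lt aj.1 uij).trans lj
  have pij := perp_reflSet_reflSet hij hi
  have ajk := isAdmissible_reflSet ak j
  have aijk := isAdmissible_reflSet ajk i
  have pijk := perp_reflSet_reflSet hij pk
  by_cases hjk : M.Adj j k
  · have hik' : i ≠ k := by rintro rfl; exact not_perp_of_up hk hi
    obtain ⟨u1, u2⟩ := up_reflSet_reflSet_of_path hB.1 hij hjk hik hik' hi hj hk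
    have ujk := up_reflSet_of_up_of_adj hB.1 hjk.symm hk hj
    have uijk := up_reflSet_of_perp_of_adj ak.1 hij pk ujk
    have ljk := (level_reflSet_lt ak.1 ujk).trans lk
    have lijk := (level_reflSet_lt ajk.1 uijk).trans ljk
    have e1 := (ih _ aij lij j k pij u1).2 hjk
    have e2 := (ih _ ak lk i j pk ujk).2 hij
    have e3 := (ih _ aijk lijk j k pijk u2).2 hjk
    have a3 := isAdmissible_reflSet (isAdmissible_reflSet aij k) j
    have a4 := isAdmissible_reflSet (isAdmissible_reflSet aijk k) j
    have l3 := ((level_reflSet_lt (isAdmissible_reflSet aij k).1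
      (up_reflSet_of_perp_of_adj aij.1 hjk pij u1)).trans (level_reflSet_lt aij.1 u1)).trans lij
    have l4 := ((level_reflSet_lt (isAdmissible_reflSet aijk k).1
      (up_reflSet_of_perp_of_adj aijk.1 hjk pijk u2)).trans (level_reflSet_lt aijk.1 u2)).trans lijk
    have hset : reflSet M i (reflSet M j (reflSet M k (reflSet M i (reflSet M j B)))) =
        reflSet M j (reflSet M k (reflSet M i (reflSet M j (reflSet M k B)))) := by
      rw [← reflSet_comm aj.1 hik, reflSet_braid (isAdmissible_reflSet aj k).1 hij,
        reflSet_comm ajk.1 (fun h' => hik h'.symm), reflSet_braid hB.1 hjk]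
    have e4 := sameLabel_of_not_adj (B₀ := B₀) a3.1 (i := k) (j := i)
      (perp_reflSet_reflSet hjk pij) (fun h' => hik h'.symm) (ih _ a3 l3)
      (by rw [hset]; exact ih _ a4 l4)
    rw [hset] at e4
    exact e1.trans (e4.trans (e3.symm.trans e2.symm))
  · rcases up_reflSet_of_up_of_not_adj hB (fun h' => hjk h'.symm) hk hj with ujk | h2
    · have uijk := up_reflSet_of_perp_of_adj ak.1 hij pk ujk
      have ljk := (level_reflSet_lt ak.1 ujk).trans lk
      have lijk := (level_reflSet_lt ajk.1 uijk).trans ljk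
      have e2 := (ih _ ak lk i j pk ujk).2 hij
      have hset : reflSet M k (reflSet M i (reflSet M j B)) =
          reflSet M i (reflSet M j (reflSet M k B)) := by
        rw [reflSet_comm hB.1 hjk, reflSet_comm aj.1 hik]
      have e3 := sameLabel_of_not_adj (B₀ := B₀) aij.1 (i := j) (j := k) pij hjk (ih _ aij lij)
        (by rw [hset]; exact ih _ aijk lijk)
      rw [hset] at e3
      exact e3.trans e2.symm
    · rw [h2] at pk
      exact absurd pk (not_perp_of_up uij)

-- There are no triangles, so distinct `j` and `k` are not adjacent, and both sides climb to
-- $r_jr_ir_kr_ir_jB=r_kr_ir_jr_ir_kB$, where the label is that of `i`.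
include hB ih in
theorem sameLabel_of_adj_of_adj {i j k : ι} (hi : Perp M i B) (hj : Up M j B)
    (hk : Up M k B) (hij : M.Adj i j) (hik : M.Adj i k) :
    SameLabel M B₀ (reflSet M i (reflSet M j B)) j (reflSet M i (reflSet M k B)) k := by
  by_cases e : j = k
  · rw [e]; exact fun _ => Iff.rfl
  have hjk := not_adj_of_adj_of_adj hij hik
  have key : ∀ {j k : ι}, j ≠ k → ¬ M.Adj j k → Up M j B → Up M k B → M.Adj i j → M.Adj i k →
      SameLabel M B₀ (reflSet M i (reflSet M j B)) j
        (reflSet M j (reflSet M i (reflSet M k (reflSet M i (reflSet M j B))))) i :=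
      fun {j k} hne hjk hj hk hij hik => by
    obtain ⟨u1, u2, -⟩ := up_reflSet_of_center hB.1 hij.symm hik hjk hne hi hj hk
    have aj := isAdmissible_reflSet hB j
    have aij := isAdmissible_reflSet aj i
    have lj := level_reflSet_lt hB.1 hj
    have uij := up_reflSet_of_perp_of_adj hB.1 hij hi hj
    have lij := (level_reflSet_lt aj.1 uij).trans lj
    have pij := perp_reflSet_reflSet hij hi
    have e1 := (ih _ aij lij j k pij u1).1 hjk
    exact e1.trans ((ih _ (isAdmissible_reflSet aij k) ((level_reflSet_lt aij.1 u1).trans lij) j i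
      (perp_reflSet_of_not_adj aij.1 hjk pij) u2).2 hij.symm)
  have h1 := key e hjk hj hk hij hik
  have h2 := key (Ne.symm e) (fun h' => hjk h'.symm) hk hj hik hij
  have hset : reflSet M j (reflSet M i (reflSet M k (reflSet M i (reflSet M j B)))) =
      reflSet M k (reflSet M i (reflSet M j (reflSet M i (reflSet M k B)))) := by
    have aj := isAdmissible_reflSet hB j
    have ak := isAdmissible_reflSet hB k
    rw [reflSet_braid aj.1 hik, reflSet_braid ak.1 hij, reflSet_comm hB.1 hjk,
      reflSet_comm (isAdmissible_reflSet (isAdmissible_reflSet aj k) i).1 hjk]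
  rw [hset] at h1
  exact h1.trans h2.symm

include hB ih in
theorem ruleLabel_iff {i j k : ι} (hi : Perp M i B) (hj : Up M j B) (hk : Up M k B) (m : ι) :
    RuleLabel M B₀ B i j m ↔ RuleLabel M B₀ B i k m := by
  by_cases hij : M.Adj i j <;> by_cases hik : M.Adj i k <;>
    simp only [RuleLabel, hij, hik, not_true, not_false_iff, true_and, false_and, or_false,
      false_or]
  · exact sameLabel_of_adj_of_adj hB ih hi hj hk hij hik m
  · exact sameLabel_of_adj_of_not_adj hB ih hi hj hk hij hik m
  · exact (sameLabel_of_adj_of_not_adj hB ih hi hk hj hik hij m).symm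
  · exact sameLabel_of_not_adj_of_not_adj hB ih hi hj hk hij hik m

end Above

theorem hRel_iff_of_isTop (hB : IsOrthogonalSet M B) (ht : IsTop M B) {i m : ι} :
    HRel M B₀ B i m ↔ B = B₀ ∧ i = m ∧ Perp M i B := by
  constructor
  · intro h
    cases h with
    | top _ h => exact ⟨rfl, rfl, h⟩
    | comm _ _ j _ _ hj => exact absurd ((raises_iff hB).1 hj) (ht j)
    | braid _ _ j _ _ hj => exact absurd ((raises_iff hB).1 hj) (ht j)
  · rintro ⟨rfl, rfl, h⟩
    exact .top i h

/-- Induction on the level: if the rules hold below this level, all raising nodes give the same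
label, so a derivation through any one of them can be replaced by one through the given node. -/
theorem rulesAt (ht : IsTop M B₀) {B : Set (ι → ℤ)} (hB : IsAdmissible M B) : RulesAt M B₀ B := by
  induction hn : level M B using Nat.strong_induction_on generalizing B with
  | _ n ih =>
  subst hn
  replace ih : ∀ B', IsAdmissible M B' → level M B' < level M B → RulesAt M B₀ B' :=
    fun B' h1 h2 => ih _ h2 h1 rfl
  intro i j hi hj
  have key : ∀ m, HRel M B₀ B i m ↔ RuleLabel M B₀ B i j m := fun m => by
    constructor
    · intro h
      cases h with
      | top => exact absurd hj (ht j)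
      | comm _ _ k _ _ hk hik h =>
        rw [raises_iff hB.1] at hk
        exact (ruleLabel_iff hB ih hi hk hj m).1 (.inl ⟨hik, h⟩)
      | braid _ _ k _ _ hk hik h =>
        rw [raises_iff hB.1] at hk
        exact (ruleLabel_iff hB ih hi hk hj m).1 (.inr ⟨hik, h⟩)
    · rintro (⟨hij, h⟩ | ⟨hij, h⟩)
      · exact .comm _ _ _ _ hi ((raises_iff hB.1).2 hj) hij h
      · exact .braid _ _ _ _ hi ((raises_iff hB.1).2 hj) hij h
  constructor
  · intro hij m
    rw [key]; simp [RuleLabel, hij]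
  · intro hij m
    rw [key]; simp [RuleLabel, hij]

/-- `h_{B,i} = h_{r_j B,i}` for `j ≁ i`. -/
theorem sameLabel_reflSet (ht : IsTop M B₀) (hB : IsAdmissible M B) {i j : ι} (hi : Perp M i B)
    (hij : ¬ M.Adj i j) : SameLabel M B₀ B i (reflSet M j B) i :=
  sameLabel_of_not_adj hB.1 hi hij (rulesAt ht hB) (rulesAt ht (isAdmissible_reflSet hB j))

/-- `h_{B,i} = h_{r_i r_j B,j}` for `j ∼ i`. -/
theorem sameLabel_reflSet_reflSet (ht : IsTop M B₀) (hB : IsAdmissible M B) {i j : ι}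
    (hi : Perp M i B) (hj : ¬ Perp M j B) (hij : M.Adj i j) :
    SameLabel M B₀ B i (reflSet M i (reflSet M j B)) j := by
  have aj := isAdmissible_reflSet hB j
  have aij := isAdmissible_reflSet aj i
  have hback : reflSet M j (reflSet M i (reflSet M i (reflSet M j B))) = B := by
    rw [reflSet_reflSet aj.1, reflSet_reflSet hB.1]
  rcases perp_or_mem_or_up hB.1 j with h | h | h | h
  · exact absurd h hj
  · have := hi _ h
    rw [form_simpleRoot_of_adj hij] at this
    norm_num at this
  · exact (rulesAt ht hB i j hi h).2 hij
  · have pij := perp_reflSet_reflSet hij hi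
    rcases perp_or_mem_or_up aij.1 i with h' | h' | h' | h'
    · rw [reflSet_of_perp aij.1 h', reflSet_of_perp aij.1 pij] at hback
      rw [hback] at pij
      exact absurd pij hj
    · have := pij _ h'
      rw [form_simpleRoot_of_adj hij.symm] at this
      norm_num at this
    · have := (rulesAt (B₀ := B₀) ht aij j i pij h').2 hij.symm
      rw [hback] at this
      exact this.symm
    -- Here both `i` and `j` would raise $r_jB$. On that set $\alpha_i$ and $\alpha_j$ have opposite
    -- pairings, so each witness would be lower than the other.
    · rw [reflSet_reflSet aj.1] at h'
      exfalso
      have hsum : ∀ β ∈ reflSet M j B, form M (simpleRoot i) β = -form M (simpleRoot j) β := by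
        rintro γ ⟨-, β, hβ, rfl | rfl⟩ <;>
        simp [simpleRefl_apply, form_refl_right, hi β hβ, form_simpleRoot_of_adj hij,
          form_simpleRoot_self] <;> ring
      obtain ⟨β, hβ, b1, b2⟩ := h
      obtain ⟨γ, hγ, g1, g2⟩ := h'
      have := hsum β hβ
      have := hsum γ hγ
      have := b2 γ hγ (by omega)
      have := g2 β hβ (by omega)
      omega

theorem HRel.perp_right {B : Set (ι → ℤ)} {i m : ι} (h : HRel M B₀ B i m) : Perp M m B₀ := by
  induction h with
  | top _ h => exact h
  | comm _ _ _ _ _ _ _ _ ih => exact ih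
  | braid _ _ _ _ _ _ _ _ ih => exact ih

theorem HRel.perp_left {B : Set (ι → ℤ)} {i m : ι} (h : HRel M B₀ B i m) : Perp M i B := by
  cases h with
  | top _ h => exact h
  | comm _ _ _ _ h => exact h
  | braid _ _ _ _ h => exact h

theorem hRel_iff_ruleLabel (ht : IsTop M B₀) (hB : IsAdmissible M B) {i j : ι} (hi : Perp M i B)
    (hj : Up M j B) : (¬ M.Adj i j ∧ SameLabel M B₀ B i (reflSet M j B) i) ∨
      (M.Adj i j ∧ SameLabel M B₀ B i (reflSet M i (reflSet M j B)) j) := by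
  by_cases hij : M.Adj i j
  · exact .inr ⟨hij, (rulesAt ht hB i j hi hj).2 hij⟩
  · exact .inl ⟨hij, (rulesAt ht hB i j hi hj).1 hij⟩

theorem hRel_unique (ht : IsTop M B₀) {B : Set (ι → ℤ)} (hB : IsAdmissible M B) {i m n : ι}
    (hm : HRel M B₀ B i m) (hn : HRel M B₀ B i n) : m = n := by
  by_cases h : ∃ j, Up M j B
  · obtain ⟨j, hj⟩ := h
    have l1 := level_reflSet_lt hB.1 hj
    have aj := isAdmissible_reflSet hB j
    rcases hRel_iff_ruleLabel (B₀ := B₀) ht hB hm.perp_left hj with ⟨_, h⟩ | ⟨hij, h⟩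
    · exact hRel_unique ht aj ((h m).1 hm) ((h n).1 hn)
    · have l2 := level_reflSet_lt aj.1 (up_reflSet_of_perp_of_adj hB.1 hij hm.perp_left hj)
      exact hRel_unique ht (isAdmissible_reflSet aj i) ((h m).1 hm) ((h n).1 hn)
  · rw [hRel_iff_of_isTop hB.1 (not_exists.1 h)] at hm hn
    exact hm.2.1.symm.trans hn.2.1
termination_by level M B

theorem hRel_exists {X : Set (ι → ℤ)} (hX : IsAdmissible M X) (h₀ : IsHighest M X B₀)
    {B : Set (ι → ℤ)} (hB : InOrbit M X B) {i : ι} (hi : Perp M i B) : ∃ m, HRel M B₀ B i m := by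
  have ht := ((isHighest_iff hX).1 h₀).2
  have aB := InOrbit.isAdmissible hX hB
  by_cases h : ∃ j, Up M j B
  · obtain ⟨j, hj⟩ := h
    have l1 := level_reflSet_lt aB.1 hj
    have aj := isAdmissible_reflSet aB j
    have oj : InOrbit M X (reflSet M j B) := hB.tail ⟨j, rfl⟩
    rcases hRel_iff_ruleLabel (B₀ := B₀) ht aB hi hj with ⟨hij, h⟩ | ⟨hij, h⟩
    · obtain ⟨m, hm⟩ := hRel_exists hX h₀ oj (perp_reflSet_of_not_adj aB.1 hij hi)
      exact ⟨m, (h m).2 hm⟩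
    · have l2 := level_reflSet_lt aj.1 (up_reflSet_of_perp_of_adj aB.1 hij hi hj)
      obtain ⟨m, hm⟩ := hRel_exists hX h₀ (oj.tail ⟨i, rfl⟩ : InOrbit M X (reflSet M i _))
        (perp_reflSet_reflSet hij hi)
      exact ⟨m, (h m).2 hm⟩
  · have e := h₀.eq_of_isTop hX hB (not_exists.1 h)
    exact ⟨i, (hRel_iff_of_isTop aB.1 (not_exists.1 h)).2 ⟨e, rfl, hi⟩⟩
termination_by level M B

theorem existsUnique_hRel {X : Set (ι → ℤ)} (hX : IsAdmissible M X) (h₀ : IsHighest M X B₀)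
    {B : Set (ι → ℤ)} (hB : InOrbit M X B) {i : ι} (hi : Perp M i B) :
    ∃! k, k ∈ nodesC M B₀ ∧ HRel M B₀ B i k := by
  obtain ⟨m, hm⟩ := hRel_exists hX h₀ hB hi
  exact ⟨m, ⟨hm.perp_right, hm⟩, fun n hn =>
    hRel_unique ((isHighest_iff hX).1 h₀).2 (InOrbit.isAdmissible hX hB) hn.2 hm⟩

/-- The labels preserve adjacency and non-adjacency. -/
theorem HRel.adj_iff (ht : IsTop M B₀) {B : Set (ι → ℤ)} (hB : IsAdmissible M B) {i j m n : ι}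
    (hm : HRel M B₀ B i m) (hn : HRel M B₀ B j n) : M.Adj i j ↔ M.Adj m n := by
  have hi := hm.perp_left
  have hj := hn.perp_left
  by_cases h : ∃ k, Up M k B
  · obtain ⟨k, hk⟩ := h
    have ak := isAdmissible_reflSet hB k
    have lk := level_reflSet_lt hB.1 hk
    have key : ∀ {i j m n : ι}, HRel M B₀ B i m → HRel M B₀ B j n → Perp M i B → Perp M j B →
        M.Adj i k → ¬ M.Adj j k → (M.Adj i j ↔ M.Adj m n) :=
        fun {i j m n} hm hn hi hj hik hjk => by
      have h1 := (rulesAt (B₀ := B₀) ht hB i k hi hk).2 hik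
      have h2 := (rulesAt (B₀ := B₀) ht hB j k hj hk).1 hjk
      have aik := isAdmissible_reflSet ak i
      have u1 := up_reflSet_of_perp_of_adj hB.1 hik hi hk
      have lik := level_reflSet_lt ak.1 u1
      have pjk := perp_reflSet_of_not_adj hB.1 hjk hj
      have pkik := perp_reflSet_reflSet hik hi
      -- Higher up, the pair of nodes carrying the two labels becomes `(k, i)` if `i ∼ j` and `(k,
      -- j)` otherwise, with the same adjacency in either case.
      by_cases hij : M.Adj i j
      · have h3 := (rulesAt (B₀ := B₀) ht ak j i pjk u1).2 hij.symm
        have u2 := up_reflSet_of_perp_of_adj ak.1 hij.symm pjk u1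
        have lj := level_reflSet_lt aik.1 u2
        have h4 := (rulesAt (B₀ := B₀) ht aik k j pkik u2).1 fun h' => hjk h'.symm
        have := HRel.adj_iff ht (isAdmissible_reflSet aik j) ((h4 m).1 ((h1 m).1 hm))
          ((h3 n).1 ((h2 n).1 hn))
        exact ⟨fun _ => this.1 hik.symm, fun _ => hij⟩
      · have h3 := (rulesAt (B₀ := B₀) ht ak j i pjk u1).1 fun h' => hij h'.symm
        have := HRel.adj_iff ht aik ((h1 m).1 hm) ((h3 n).1 ((h2 n).1 hn))
        exact ⟨fun h' => absurd h' hij, fun h' => absurd (this.2 h').symm hjk⟩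
    by_cases hik : M.Adj i k <;> by_cases hjk : M.Adj j k
    -- Without triangles `i` and `j` are not adjacent. Either $r_ir_kB=r_jr_kB$ and the labels
    -- coincide, or they become the labels of `j` and `i` at $r_kr_ir_jr_kB$.
    · have hij := not_adj_of_adj_of_adj hik.symm hjk.symm
      refine ⟨fun h' => absurd h' hij, fun h' => ?_⟩
      have h1 := (rulesAt (B₀ := B₀) ht hB i k hi hk).2 hik
      have h2 := (rulesAt (B₀ := B₀) ht hB j k hj hk).2 hjk
      have key2 : reflSet M i (reflSet M k B) = reflSet M j (reflSet M k B) → False := fun e => by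
        rw [e] at h1
        have e2 := hRel_unique ht (isAdmissible_reflSet ak j) ((h1 m).1 hm) ((h2 n).1 hn)
        exact M.loopless.irrefl m (e2 ▸ h')
      have hne : i ≠ j := by
        rintro rfl
        exact key2 rfl
      have v1 := (up_or_eq_of_perp_of_perp hB.1 hik hjk.symm hij hne hi hj hk).resolve_right key2
      have v2 := (up_or_eq_of_perp_of_perp hB.1 hjk hik.symm (fun h => hij h.symm) hne.symm hj hi
        hk).resolve_right fun e => key2 e.symm
      have aik := isAdmissible_reflSet ak i
      have ajk := isAdmissible_reflSet ak j
      have h3 := (rulesAt (B₀ := B₀) ht aik k j (perp_reflSet_reflSet hik hi) v1).2 hjk.symm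
      have h4 := (rulesAt (B₀ := B₀) ht ajk k i (perp_reflSet_reflSet hjk hj) v2).2 hik.symm
      rw [reflSet_comm ak.1 fun h => hij h.symm] at h3
      have l1 := level_reflSet_lt ak.1 (up_reflSet_of_perp_of_adj hB.1 hjk hj hk)
      have l2 := level_reflSet_lt ajk.1 v2
      have l3 := level_reflSet_lt (isAdmissible_reflSet ajk i).1
        (up_reflSet_of_perp_of_adj ajk.1 hik.symm (perp_reflSet_reflSet hjk hj) v2)
      have := HRel.adj_iff ht (isAdmissible_reflSet (isAdmissible_reflSet ajk i) k)
        ((h3 m).1 ((h1 m).1 hm)) ((h4 n).1 ((h2 n).1 hn))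
      exact absurd (this.2 h').symm hij
    · exact key hm hn hi hj hik hjk
    · rw [M.adj_comm i j, M.adj_comm m n]
      exact key hn hm hj hi hjk hik
    · have h1 := (rulesAt (B₀ := B₀) ht hB i k hi hk).1 hik
      have h2 := (rulesAt (B₀ := B₀) ht hB j k hj hk).1 hjk
      exact HRel.adj_iff ht ak ((h1 m).1 hm) ((h2 n).1 hn)
  · rw [hRel_iff_of_isTop hB.1 (not_exists.1 h)] at hm hn
    rw [hm.2.1, hn.2.1]
termination_by level M B

end PosDef

end BrauerADE

namespace BrauerADE

set_option linter.unusedSectionVars false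

variable {ι : Type*} [Fintype ι] [DecidableEq ι] {M : SimpleGraph ι}

/-! ### The Coxeter presentation of the Weyl group -/

section Presentation

variable [PosDefForm M]

theorem mul_s_of_apply_eq {w : W M} {i j : ι} (h : w.1 (simpleRoot i) = simpleRoot j) :
    w * s M i = s M j * w := by
  rw [← reflW_simpleRoot, ← reflW_simpleRoot, mul_reflW]
  congr 1
  exact W_ext fun x => by simp [h]

variable (M) in
/-- Involutions satisfying the braid relations of `M`. -/
structure IsCoxeterFamily {G : Type*} [Monoid G] (T : ι → G) : Prop where
  sq (i : ι) : T i * T i = 1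
  comm (i j : ι) : ¬ M.Adj i j → T i * T j = T j * T i
  braid (i j : ι) : M.Adj i j → T i * T j * T i = T j * T i * T j

variable {G : Type*} [Monoid G] {T : ι → G}

/-- The exchange condition, carried out in `G` and in the Weyl group at once. At the letter `a`
where the image of the simple root turns negative, that image is the simple root of `a`; the
intertwining relation `key` for the remaining suffix then cancels this letter against `T i`. -/
theorem exists_shorter_word (hT : IsCoxeterFamily M T) (l : List ι)
    (key : ∀ t : List ι, t.length < l.length → ∀ i j : ι,
      ((t.map (s M)).prod).1 (simpleRoot i) = simpleRoot j →
      T j * (t.map T).prod = (t.map T).prod * T i)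
    {i : ι} (hneg : IsPosRoot M (-((l.map (s M)).prod).1 (simpleRoot i))) :
    ∃ l' : List ι, l'.length + 1 = l.length ∧ (l.map T).prod * T i = (l'.map T).prod ∧
      (l.map (s M)).prod * s M i = (l'.map (s M)).prod := by
  induction l with
  | nil =>
    exact absurd hneg (by simpa using (isPosRoot_simpleRoot i).not_neg)
  | cons a t ih =>
    simp only [List.map_cons, List.prod_cons, mul_apply, s_apply] at hneg ⊢
    set v := ((t.map (s M)).prod).1 (simpleRoot i) with hv
    have hr : IsRoot M v := (isRoot_simpleRoot i).apply _
    rcases hr.pos_or_neg with hp | hp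
    · have hva : v = simpleRoot a := by
        by_contra h
        exact (hp.refl_simpleRoot h).not_neg hneg
      refine ⟨t, rfl, ?_, ?_⟩
      · rw [mul_assoc, ← key t (by simp) i a hva, ← mul_assoc, hT.sq, one_mul]
      · rw [mul_assoc, mul_s_of_apply_eq hva, ← mul_assoc, s_mul_self, one_mul]
    · obtain ⟨t', h1, h2, h3⟩ := ih (fun u hu => key u (hu.trans (by simp))) hp
      refine ⟨a :: t', by simp [h1], ?_, ?_⟩
      · rw [mul_assoc, h2]; simp
      · rw [mul_assoc, h3]; simp

/-- The relation $wr_i=r_jw$ is lifted to `G` by induction on the length. A last letter `k` not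
adjacent to `i` commutes past. If `k = i`, the exchange condition shortens the prefix. If `k ∼ i`,
the prefix sends $\alpha_i+\alpha_k$ to a simple root, so by heights it makes $\alpha_i$ or
$\alpha_k$ negative and can be shortened there. -/
theorem intertwine_word (hT : IsCoxeterFamily M T) (l : List ι) (i j : ι)
    (h : ((l.map (s M)).prod).1 (simpleRoot i) = simpleRoot j) :
    T j * (l.map T).prod = (l.map T).prod * T i := by
  induction hn : l.length using Nat.strong_induction_on generalizing l i j with
  | _ n ih =>
  subst hn
  rcases l.eq_nil_or_concat with rfl | ⟨l₀, k, rfl⟩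
  · have hij : i = j := by
      by_contra hij
      have := congrFun h i
      simp [simpleRoot, hij] at this
    simp [hij]
  · have hlen : (l₀.concat k).length = l₀.length + 1 := by simp
    have hprod : ((l₀.concat k).map T).prod = (l₀.map T).prod * T k := by simp
    have hprodW : ((l₀.concat k).map (s M)).prod = (l₀.map (s M)).prod * s M k := by simp
    have ih' : ∀ t : List ι, t.length < l₀.length + 1 → ∀ i j : ι,
        ((t.map (s M)).prod).1 (simpleRoot i) = simpleRoot j →
        T j * (t.map T).prod = (t.map T).prod * T i := fun t ht i j h =>
      ih t.length (by rw [hlen]; exact ht) t i j h rfl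
    have E : ∀ i, IsPosRoot M (-((l₀.map (s M)).prod).1 (simpleRoot i)) →
        ∃ l' : List ι, l'.length + 1 = l₀.length ∧ (l₀.map T).prod * T i = (l'.map T).prod ∧
        (l₀.map (s M)).prod * s M i = (l'.map (s M)).prod := fun i hi =>
      exists_shorter_word hT l₀ (fun t ht i j' h' => ih' t (by omega) i j' h') hi
    rw [hprod]
    rw [hprodW] at h
    by_cases hki : k = i
    · subst hki
      obtain ⟨l', h1, h2, h3⟩ := E k (by
        rw [mul_apply, s_apply, refl_self (form_simpleRoot_self M k), map_neg] at h
        rw [h]; exact isPosRoot_simpleRoot j)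
      rw [h2]
      rw [h3] at h
      exact ih' l' (by omega) k j h
    by_cases hadj : M.Adj k i
    · have hk : (s M k).1 (simpleRoot i) = simpleRoot i + simpleRoot k := by
        rw [s_apply, refl, form_simpleRoot_of_adj hadj]; module
      rw [mul_apply, hk, map_add] at h
      set w := (l₀.map (s M)).prod
      rcases ((isRoot_simpleRoot i).apply w).pos_or_neg with hi | hi
      · rcases ((isRoot_simpleRoot k).apply w).pos_or_neg with hk' | hk'
        · have h1 := hi.height_pos
          have h2 := hk'.height_pos
          have h3 := congrArg height h
          rw [height_add, height_simpleRoot] at h3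
          omega
        · obtain ⟨l', h1, h2, h3⟩ := E k hk'
          rw [h2]
          refine ih' l' (by omega) i j ?_
          rw [← h3, mul_apply, hk, map_add, h]
      · obtain ⟨l', h1, h2, h3⟩ := E i hi
        have h4 : (l₀.map T).prod = (l'.map T).prod * T i := by
          rw [← h2, mul_assoc, hT.sq, mul_one]
        have h5 : ((l'.map (s M)).prod).1 (simpleRoot k) = simpleRoot j := by
          have : (s M i).1 (simpleRoot k) = simpleRoot i + simpleRoot k := by
            rw [s_apply, refl, form_simpleRoot_of_adj hadj.symm]; module
          rw [← h3, mul_apply, this, map_add, h]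
        have h6 := ih' l' (by omega) k j h5
        rw [h4]
        calc T j * ((l'.map T).prod * T i * T k) = T j * (l'.map T).prod * T i * T k := by
              simp only [mul_assoc]
          _ = (l'.map T).prod * (T k * T i * T k) := by rw [h6]; simp only [mul_assoc]
          _ = (l'.map T).prod * T i * T k * T i := by
            rw [hT.braid k i hadj]; simp only [mul_assoc]
    · have h1 : ((l₀.map (s M)).prod).1 (simpleRoot i) = simpleRoot j := by
        rwa [mul_apply, s_apply, refl_of_perp (form_simpleRoot_of_not_adj hki hadj)] at h
      rw [← mul_assoc, ih' l₀ (by omega) i j h1, mul_assoc, mul_assoc, hT.comm k i hadj]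

/-- Without its last letter `k` the word represents $r_k$, which makes $\alpha_k$ negative; the
exchange condition gives a word shorter by two. -/
theorem word_eq_one (hT : IsCoxeterFamily M T) (l : List ι) (h : (l.map (s M)).prod = 1) :
    (l.map T).prod = 1 := by
  induction hn : l.length using Nat.strong_induction_on generalizing l with
  | _ n ih =>
  subst hn
  rcases l.eq_nil_or_concat with rfl | ⟨l₀, k, rfl⟩
  · rfl
  · have hprod : ((l₀.concat k).map T).prod = (l₀.map T).prod * T k := by simp
    have hprodW : ((l₀.concat k).map (s M)).prod = (l₀.map (s M)).prod * s M k := by simp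
    rw [hprodW] at h
    have hw : (l₀.map (s M)).prod = s M k := by
      rw [← mul_one (l₀.map (s M)).prod, ← s_mul_self k, ← mul_assoc, h, one_mul]
    obtain ⟨l', h1, h2, h3⟩ := exists_shorter_word hT l₀
      (fun t _ i j h => intertwine_word hT t i j h) (i := k) (by
        rw [hw, s_apply, refl_self (form_simpleRoot_self M k), neg_neg]
        exact isPosRoot_simpleRoot k)
    rw [hprod, h2]
    exact ih l'.length (by simp; omega) l' (by rw [← h3, h]) rfl

theorem prod_mul_prod_reverse {T : ι → G} (h : ∀ i, T i * T i = 1) (l : List ι) :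
    (l.map T).prod * (l.reverse.map T).prod = 1 := by
  induction l with
  | nil => simp
  | cons a t ih =>
    simp only [List.map_cons, List.prod_cons, List.reverse_cons, List.map_append, List.prod_append,
      List.map_nil, List.prod_nil, mul_one]
    rw [mul_assoc, ← mul_assoc _ _ (T a), ih, one_mul, h]

theorem word_eq_word (hT : IsCoxeterFamily M T) (l l' : List ι)
    (h : (l.map (s M)).prod = (l'.map (s M)).prod) : (l.map T).prod = (l'.map T).prod := by
  have h1 := word_eq_one hT (l'.reverse ++ l) (by
    rw [List.map_append, List.prod_append, h]
    simpa using prod_mul_prod_reverse (s_mul_self (M := M)) l'.reverse)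
  rw [List.map_append, List.prod_append] at h1
  have h2 := prod_mul_prod_reverse hT.sq l'
  calc (l.map T).prod = (l'.map T).prod * (l'.reverse.map T).prod * (l.map T).prod := by
        rw [h2, one_mul]
    _ = _ := by rw [mul_assoc, h1, mul_one]

variable (M) in
theorem exists_word (w : W M) : ∃ l : List ι, (l.map (s M)).prod = w := by
  induction w using W_induction with
  | one => exact ⟨[], rfl⟩
  | s_mul i w ih =>
    obtain ⟨l, rfl⟩ := ih
    exact ⟨i :: l, by simp⟩

/-- The homomorphism from the Weyl group given by involutions satisfying the braid relations. -/
noncomputable def liftW (hT : IsCoxeterFamily M T) : W M →* G where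
  toFun w := ((exists_word M w).choose.map T).prod
  map_one' := word_eq_word hT _ [] (exists_word M 1).choose_spec
  map_mul' w w' := by
    rw [← List.prod_append, ← List.map_append]
    refine word_eq_word hT _ _ ?_
    rw [(exists_word M (w * w')).choose_spec, List.map_append, List.prod_append,
      (exists_word M w).choose_spec, (exists_word M w').choose_spec]

theorem liftW_s (hT : IsCoxeterFamily M T) (i : ι) : liftW hT (s M i) = T i := by
  have := word_eq_word hT _ [i] ((exists_word M (s M i)).choose_spec.trans (by simp))
  exact this.trans (by simp)

end Presentation

/-! ### The representation of the Weyl group -/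

section RepW

variable [PosDefForm M] {X B₀ B : Set (ι → ℤ)}

theorem h_of_not_perp {i : ι} (hi : ¬ Perp M i B) : h M B₀ B i = 1 := by
  rw [h, dif_neg]
  rintro ⟨k, hk⟩
  exact hi hk.perp_left

theorem h_congr {B' : Set (ι → ℤ)} {i i' : ι} (e : SameLabel M B₀ B i B' i') :
    h M B₀ B i = h M B₀ B' i' := by
  have : HRel M B₀ B i = HRel M B₀ B' i' := funext fun m => propext (e m)
  by_cases hk : ∃ k : nodesC M B₀, HRel M B₀ B i k.1
  · have hk' : ∃ k : nodesC M B₀, HRel M B₀ B' i' k.1 := this ▸ hk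
    have hc : hk.choose = hk'.choose := by
      congr 1
      rw [this]
    rw [h, h, dif_pos hk, dif_pos hk']
    exact Subtype.ext (congrArg (fun k : nodesC M B₀ => s M k.1) hc)
  · rw [h, h, dif_neg hk, dif_neg (this ▸ hk)]

theorem h_eq_one_or (i : ι) : h M B₀ B i = 1 ∨
    ∃ k, HRel M B₀ B i k ∧ (h M B₀ B i : W M) = s M k := by
  by_cases hk : ∃ k : nodesC M B₀, HRel M B₀ B i k.1
  · right
    exact ⟨_, hk.choose_spec, by rw [h, dif_pos hk]⟩
  · left
    rw [h, dif_neg hk]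

theorem h_mul_self (i : ι) : h M B₀ B i * h M B₀ B i = 1 := by
  rcases h_eq_one_or (M := M) (B₀ := B₀) (B := B) i with e | ⟨k, -, e⟩
  · rw [e, one_mul]
  · apply Subtype.ext
    rw [Subgroup.coe_mul, e, s_mul_self, Subgroup.coe_one]

theorem h_comm (ht : IsTop M B₀) (hB : IsAdmissible M B) {i j : ι} (hij : ¬ M.Adj i j) :
    h M B₀ B i * h M B₀ B j = h M B₀ B j * h M B₀ B i := by
  rcases h_eq_one_or (M := M) (B₀ := B₀) (B := B) i with e | ⟨k, hk, e⟩
  · rw [e, one_mul, mul_one]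
  rcases h_eq_one_or (M := M) (B₀ := B₀) (B := B) j with e' | ⟨k', hk', e'⟩
  · rw [e', one_mul, mul_one]
  apply Subtype.ext
  rw [Subgroup.coe_mul, Subgroup.coe_mul, e, e', s_comm (mt (hk.adj_iff ht hB hk').2 hij)]

theorem h_of_hRel (ht : IsTop M B₀) (hB : IsAdmissible M B) {i k : ι} (hk : HRel M B₀ B i k) :
    (h M B₀ B i : W M) = s M k := by
  have hex : ∃ k : nodesC M B₀, HRel M B₀ B i k.1 := ⟨⟨k, hk.perp_right⟩, hk⟩
  rw [h, dif_pos hex]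
  simp only
  rw [hRel_unique ht hB hex.choose_spec hk]

theorem h_braid (hX : IsAdmissible M X) (h₀ : IsHighest M X B₀) (hB : InOrbit M X B) {i j : ι}
    (hi : Perp M i B) (hj : Perp M j B) (hij : M.Adj i j) :
    h M B₀ B i * h M B₀ B j * h M B₀ B i = h M B₀ B j * h M B₀ B i * h M B₀ B j := by
  have ht := ((isHighest_iff hX).1 h₀).2
  have aB := InOrbit.isAdmissible hX hB
  obtain ⟨k, hk⟩ := hRel_exists hX h₀ hB hi
  obtain ⟨k', hk'⟩ := hRel_exists hX h₀ hB hj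
  apply Subtype.ext
  simp only [Subgroup.coe_mul, h_of_hRel ht aB hk, h_of_hRel ht aB hk',
    s_braid ((hk.adj_iff ht aB hk').1 hij)]

theorem perp_reflSet_iff_of_not_adj (hB : IsOrthogonalSet M B) {i j : ι} (hij : ¬ M.Adj i j) :
    Perp M i (reflSet M j B) ↔ Perp M i B := by
  refine ⟨fun h => ?_, perp_reflSet_of_not_adj hB hij⟩
  have := perp_reflSet_of_not_adj (reflSet_isOrthogonalSet hB j) hij h
  rwa [reflSet_reflSet hB] at this

theorem perp_reflSet_self_iff (hB : IsOrthogonalSet M B) {i : ι} :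
    Perp M i (reflSet M i B) ↔ Perp M i B :=
  perp_reflSet_iff_of_not_adj hB (M.loopless.irrefl i)

theorem perp_reflSet_reflSet_iff (hB : IsOrthogonalSet M B) {i j : ι} (hij : M.Adj i j) :
    Perp M j (reflSet M i (reflSet M j B)) ↔ Perp M i B := by
  refine ⟨fun h => ?_, perp_reflSet_reflSet hij⟩
  have := perp_reflSet_reflSet hij.symm h
  rwa [reflSet_reflSet (reflSet_isOrthogonalSet hB j), reflSet_reflSet hB] at this

theorem perp_reflSet_symm (hB : IsOrthogonalSet M B) {i j : ι} (hij : M.Adj i j) :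
    Perp M j (reflSet M i B) ↔ Perp M i (reflSet M j B) := by
  have := perp_reflSet_reflSet_iff (reflSet_isOrthogonalSet hB j) hij
  rw [reflSet_reflSet hB] at this
  exact this

theorem h_reflSet_of_not_adj (ht : IsTop M B₀) (hB : IsAdmissible M B) {i j : ι}
    (hij : ¬ M.Adj i j) : h M B₀ (reflSet M j B) i = h M B₀ B i := by
  by_cases hi : Perp M i B
  · exact (h_congr (sameLabel_reflSet ht hB hi hij)).symm
  · rw [h_of_not_perp hi, h_of_not_perp (mt (perp_reflSet_iff_of_not_adj hB.1 hij).1 hi)]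

/-- In the excluded case both reflections fix `B`, and the left side is $h_{B,j}$. -/
theorem h_reflSet_reflSet (ht : IsTop M B₀) (hB : IsAdmissible M B) {i j : ι}
    (hj : ¬ (Perp M i B ∧ Perp M j B)) (hij : M.Adj i j) :
    h M B₀ (reflSet M i (reflSet M j B)) j = h M B₀ B i := by
  by_cases hi : Perp M i B
  · exact (h_congr (sameLabel_reflSet_reflSet ht hB hi (fun h => hj ⟨hi, h⟩) hij)).symm
  · rw [h_of_not_perp hi, h_of_not_perp (mt (perp_reflSet_reflSet_iff hB.1 hij).1 hi)]

variable (M X B₀) in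
/-- The operator by which `r_i` acts. -/
noncomputable def opR (i : ι) : Module.End K (V M X B₀) :=
  Finsupp.lsum K fun B : Orbit M X => (Finsupp.lsingle (act M i B)).comp
    (LinearMap.mulLeft K (MonoidAlgebra.of K _ (h M B₀ B.1 i)))

theorem opR_xi (i : ι) (B : Orbit M X) (a : GroupAlg M B₀) :
    opR M X B₀ i (xi B a) = xi (act M i B) (MonoidAlgebra.of K _ (h M B₀ B.1 i) * a) := by
  simp [opR, xi]

theorem end_ext {f g : Module.End K (V M X B₀)} (H : ∀ B a, f (xi B a) = g (xi B a)) : f = g :=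
  Finsupp.lhom_ext H

/-- The relations hold on the orbit, so only identities between labels remain. In the braid
relation, if both simple roots are orthogonal to `B` this is `h_braid`; otherwise each side has at
most one nontrivial factor, and transport of labels identifies the two. -/
theorem isCoxeterFamily_opR (hX : IsAdmissible M X) (h₀ : IsHighest M X B₀) :
    IsCoxeterFamily M (opR M X B₀) := by
  have ht := ((isHighest_iff hX).1 h₀).2
  refine ⟨fun i => end_ext fun B a => ?_, fun i j hij => end_ext fun B a => ?_,
    fun i j hij => end_ext fun B a => ?_⟩
  · have aB := InOrbit.isAdmissible hX B.2
    have e1 : act M i (act M i B) = B := Subtype.ext (reflSet_reflSet aB.1 i)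
    have e2 : h M B₀ (act M i B).1 i = h M B₀ B.1 i :=
      h_reflSet_of_not_adj ht aB (M.loopless.irrefl i)
    rw [Module.End.mul_apply, opR_xi, opR_xi, e1, e2, ← mul_assoc, ← map_mul, h_mul_self,
      map_one, one_mul, Module.End.one_apply]
  · have aB := InOrbit.isAdmissible hX B.2
    have hji : ¬ M.Adj j i := fun h => hij h.symm
    have e1 : act M i (act M j B) = act M j (act M i B) :=
      Subtype.ext (reflSet_comm aB.1 hij)
    have e2 : h M B₀ (act M j B).1 i = h M B₀ B.1 i := h_reflSet_of_not_adj ht aB hij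
    have e3 : h M B₀ (act M i B).1 j = h M B₀ B.1 j := h_reflSet_of_not_adj ht aB hji
    simp only [Module.End.mul_apply, opR_xi, e1, e2, e3, ← mul_assoc, ← map_mul,
      h_comm ht aB hij]
  · have aB := InOrbit.isAdmissible hX B.2
    have e1 : act M i (act M j (act M i B)) = act M j (act M i (act M j B)) :=
      Subtype.ext (reflSet_braid aB.1 hij)
    suffices hg : h M B₀ (reflSet M j (reflSet M i B.1)) i * h M B₀ (reflSet M i B.1) j * h M B₀ B.1 i =
      h M B₀ (reflSet M i (reflSet M j B.1)) j * h M B₀ (reflSet M j B.1) i * h M B₀ B.1 j by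
      simp only [Module.End.mul_apply, opR_xi, e1, ← mul_assoc, ← map_mul]
      exact congrArg (fun g => xi (act M j (act M i (act M j B))) (MonoidAlgebra.of K _ g * a)) hg
    by_cases hi : Perp M i B.1
    · rw [reflSet_of_perp aB.1 hi]
      by_cases hj : Perp M j B.1
      · rw [reflSet_of_perp aB.1 hj, reflSet_of_perp aB.1 hi]
        exact h_braid hX h₀ B.2 hi hj hij
      · have n1 : ¬ Perp M i (reflSet M j B.1) := by
          rwa [← perp_reflSet_symm aB.1 hij, reflSet_of_perp aB.1 hi]
        rw [h_of_not_perp hj, h_of_not_perp n1, h_reflSet_reflSet ht aB (fun h => hj h.2) hij]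
        simp
    · by_cases hj : Perp M j B.1
      · have n1 : ¬ Perp M j (reflSet M i B.1) := by
          rwa [perp_reflSet_symm aB.1 hij, reflSet_of_perp aB.1 hj]
        rw [reflSet_of_perp aB.1 hj, h_of_not_perp hi, h_of_not_perp n1,
          h_reflSet_reflSet ht aB (fun h => hi h.2) hij.symm]
        simp
      · rw [h_of_not_perp hi, h_of_not_perp hj, h_reflSet_reflSet ht aB (fun h => hi h.1) hij,
          h_reflSet_reflSet ht aB (fun h => hj h.1) hij.symm, h_of_not_perp hi, h_of_not_perp hj,
          one_mul, one_mul, mul_one, mul_one]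
        have := h_reflSet_reflSet ht (isAdmissible_reflSet aB i) (i := j) (j := i)
          (fun h' => hi ((perp_reflSet_self_iff aB.1).1 h'.2)) hij.symm
        rw [reflSet_reflSet aB.1] at this
        exact this.symm

end RepW

end BrauerADE

namespace BrauerADE

set_option linter.unusedSectionVars false

variable {ι : Type*} [Fintype ι] [DecidableEq ι] {M : SimpleGraph ι}

/-! ### The action of the Weyl group on an orbit -/

section OrbitAction

variable [PosDefForm M] {X B₀ : Set (ι → ℤ)}

theorem inOrbit_wSet (hX : IsAdmissible M X) (w : W M) {B : Set (ι → ℤ)} (hB : InOrbit M X B) :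
    InOrbit M X (wSet w B) := by
  have hp := (InOrbit.isAdmissible hX hB).1.1
  induction w using W_induction with
  | one => rwa [wSet_one hp]
  | s_mul i w ih =>
    rw [wSet_mul _ _ hp]
    exact ih.tail ⟨i, rfl⟩

/-- The action of the Weyl group on the orbit. -/
def actW (hX : IsAdmissible M X) (w : W M) (B : Orbit M X) : Orbit M X :=
  ⟨wSet w B.1, inOrbit_wSet hX w B.2⟩

theorem Orbit.isAdmissible (hX : IsAdmissible M X) (B : Orbit M X) : IsAdmissible M B.1 :=
  InOrbit.isAdmissible hX B.2

theorem actW_s (hX : IsAdmissible M X) (i : ι) (B : Orbit M X) : actW hX (s M i) B = act M i B :=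
  rfl

theorem actW_one (hX : IsAdmissible M X) (B : Orbit M X) : actW hX 1 B = B :=
  Subtype.ext (wSet_one (B.isAdmissible hX).1.1)

theorem actW_mul (hX : IsAdmissible M X) (w w' : W M) (B : Orbit M X) :
    actW hX (w * w') B = actW hX w (actW hX w' B) :=
  Subtype.ext (wSet_mul w w' (B.isAdmissible hX).1.1)

theorem inPM_actW (hX : IsAdmissible M X) {w : W M} {B : Orbit M X} {v : ι → ℤ} :
    InPM (actW hX w B).1 v ↔ InPM B.1 (w⁻¹.1 v) :=
  inPM_wSet (B.isAdmissible hX).1.1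

theorem inPM_actW_apply (hX : IsAdmissible M X) {w : W M} {B : Orbit M X} {v : ι → ℤ} :
    InPM (actW hX w B).1 (w.1 v) ↔ InPM B.1 v := by
  rw [inPM_actW, inv_apply_apply]

theorem exists_actW_eq (hX : IsAdmissible M X) (B B' : Orbit M X) : ∃ w, actW hX w B = B' := by
  have key : ∀ B : Orbit M X, ∃ w, actW hX w ⟨X, .refl⟩ = B := by
    rintro ⟨B, hB⟩
    induction hB with
    | refl => exact ⟨1, actW_one hX _⟩
    | tail _ h ih =>
      obtain ⟨w, hw⟩ := ih
      obtain ⟨i, rfl⟩ := h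
      exact ⟨s M i * w, by rw [actW_mul, hw]; rfl⟩
  obtain ⟨w, rfl⟩ := key B
  obtain ⟨w', rfl⟩ := key B'
  exact ⟨w' * w⁻¹, by rw [← actW_mul, inv_mul_cancel_right]⟩

theorem perp_iff_inPM {B : Set (ι → ℤ)} {i : ι} :
    Perp M i B ↔ ∀ β, InPM B β → form M (simpleRoot i) β = 0 := by
  refine ⟨fun h β hβ => ?_, fun h β hβ => h β (.inl hβ)⟩
  rcases hβ with hβ | hβ
  · exact h _ hβ
  · simpa using h _ hβ

theorem inPM_simpleRoot {B : Set (ι → ℤ)} (hB : ∀ β ∈ B, IsPosRoot M β) {i : ι} :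
    InPM B (simpleRoot i) ↔ simpleRoot i ∈ B :=
  inPM_iff_of_pos hB (isPosRoot_simpleRoot i)

theorem IsReflectionIn.unique {w w' : W M} {β : ι → ℤ} (h : IsReflectionIn M w β)
    (h' : IsReflectionIn M w' β) : w = w' :=
  W_ext fun x => by rw [h, h']

theorem IsReflectionIn.neg {w : W M} {β : ι → ℤ} (h : IsReflectionIn M w β) :
    IsReflectionIn M w (-β) := fun x => by rw [h, refl_neg_left]

theorem isReflectionIn_s (i : ι) : IsReflectionIn M (s M i) (simpleRoot i) := s_apply i

theorem IsReflectionIn.conj {r : W M} {β : ι → ℤ} (h : IsReflectionIn M r β) (w : W M) :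
    IsReflectionIn M (w * r * w⁻¹) (w.1 β) := fun x => by
  rw [mul_apply, mul_apply, h, apply_refl, apply_inv_apply]

theorem IsReflectionIn.mul_self {r : W M} {β : ι → ℤ} (h : IsReflectionIn M r β)
    (hβ : IsRoot M β) : r * r = 1 :=
  W_ext fun x => by rw [mul_apply, h, h, refl_refl hβ.form_self, one_apply]

/-- Two orthogonal roots are conjugate to two orthogonal simple roots, up to sign. -/
theorem exists_simpleRoot_pair {i : ι} {γ : ι → ℤ} (hγ : IsPosRoot M γ)
    (h : form M (simpleRoot i) γ = 0) :
    ∃ (w : W M) (k l : ι), w.1 (simpleRoot i) = simpleRoot k ∧ w.1 γ = simpleRoot l := by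
  obtain ⟨n, hn⟩ : ∃ n : ℕ, height γ ≤ n := ⟨(height γ).toNat, Int.self_le_toNat _⟩
  induction n generalizing i γ with
  | zero => exact absurd hγ.height_pos (by simpa using hn)
  | succ n ih =>
  obtain ⟨j, hj⟩ := exists_form_pos hγ.1.form_self hγ.2
  by_cases hjγ : γ = simpleRoot j
  · exact ⟨1, i, j, rfl, hjγ⟩
  have hpos := hγ.refl_simpleRoot hjγ
  have h1 : form M (simpleRoot j) γ = 1 := by
    have := abs_form_le_one (form_simpleRoot_self M j) hγ.1.form_self (Ne.symm hjγ) (fun e => by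
      rw [e] at hj
      have := hγ.1.form_self
      have := hj.2
      simp only [map_neg, LinearMap.neg_apply] at hj
      omega)
    have := hj.2
    omega
  have hji : j ≠ i := by rintro rfl; omega
  have hh : height (refl M (simpleRoot j) γ) = height γ - 1 := by
    rw [height_refl, h1, height_simpleRoot, one_mul]
  by_cases hadj : M.Adj j i
  -- Here $r_j$ alone would make $\alpha_i$ non-simple; $r_ir_j$ replaces it by $\alpha_j$ and
  -- lowers γ by two.
  · have e1 : (s M i * s M j).1 (simpleRoot i) = simpleRoot j := by
      rw [mul_apply, s_apply, s_apply]
      simp only [refl, form_simpleRoot_of_adj hadj, map_sub, map_smul, form_simpleRoot_self,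
        form_simpleRoot_of_adj hadj.symm]
      module
    have h2 : form M (simpleRoot i) (refl M (simpleRoot j) γ) = 1 := by
      rw [refl, map_sub, map_smul, h, h1, form_simpleRoot_of_adj hadj.symm]; rfl
    have hpos2 := hpos.refl_simpleRoot (i := i) (fun e => by
      rw [e, form_simpleRoot_self] at h2; omega)
    have e2 : (s M i * s M j).1 γ = refl M (simpleRoot i) (refl M (simpleRoot j) γ) := by
      rw [mul_apply, s_apply, s_apply]
    obtain ⟨w, k, l, hk, hl⟩ := ih hpos2 (i := j) (by
      rw [← e2, ← e1, form_invariant, h]) (by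
      rw [height_refl, h2, hh, height_simpleRoot]; push_cast at hn; omega)
    exact ⟨w * (s M i * s M j), k, l, by rw [mul_apply, e1, hk], by rw [mul_apply, e2, hl]⟩
  · have e1 : (s M j).1 (simpleRoot i) = simpleRoot i := by
      rw [s_apply, refl_of_perp (form_simpleRoot_of_not_adj hji hadj)]
    obtain ⟨w, k, l, hk, hl⟩ := ih hpos (i := i) (by
      rw [← s_apply, ← e1, form_invariant, h]) (by
      rw [hh]; push_cast at hn; omega)
    exact ⟨w * s M j, k, l, by rw [mul_apply, e1, hk], by rw [mul_apply, s_apply, hl]⟩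

end OrbitAction

/-! ### Monomial representations of the Weyl group -/

section Monomial

variable [PosDefForm M] {X B₀ : Set (ι → ℤ)} {ρW : W M →* Module.End K (V M X B₀)}

/-- The simple reflections act by `r_i ξ_B = ξ_{r_i B} h_{B,i}`. -/
def IsWeylRep (ρW : W M →* Module.End K (V M X B₀)) : Prop :=
  ∀ (i : ι) (B : Orbit M X) (a : GroupAlg M B₀),
    ρW (s M i) (xi B a) = xi (act M i B) (MonoidAlgebra.of K _ (h M B₀ B.1 i) * a)

theorem rep_mul_apply (w w' : W M) (v : V M X B₀) : ρW (w * w') v = ρW w (ρW w' v) := by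
  rw [map_mul, Module.End.mul_apply]

theorem rep_inv_rep (w : W M) (v : V M X B₀) : ρW w⁻¹ (ρW w v) = v := by
  rw [← rep_mul_apply, inv_mul_cancel, map_one, Module.End.one_apply]

theorem rep_rep_inv (w : W M) (v : V M X B₀) : ρW w (ρW w⁻¹ v) = v := by
  rw [← rep_mul_apply, mul_inv_cancel, map_one, Module.End.one_apply]

theorem IsWeylRep.exists_eq (hρ : IsWeylRep ρW) (hX : IsAdmissible M X) (w : W M) (B : Orbit M X) :
    ∃ g : parabolic M (nodesC M B₀), ∀ a,
      ρW w (xi B a) = xi (actW hX w B) (MonoidAlgebra.of K _ g * a) := by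
  induction w using W_induction with
  | one => exact ⟨1, fun a => by rw [map_one, map_one, one_mul, actW_one, Module.End.one_apply]⟩
  | s_mul i w ih =>
    obtain ⟨g, hg⟩ := ih
    refine ⟨h M B₀ (actW hX w B).1 i * g, fun a => ?_⟩
    rw [rep_mul_apply, hg, hρ, actW_mul, actW_s, map_mul, mul_assoc]

/-- After conjugation β is a simple root $\alpha_i$ lying in the set. Then $r_i$ fixes the set, and
the label is 1 because $\alpha_i$ is not orthogonal to itself. -/
theorem IsWeylRep.rep_of_inPM (hρ : IsWeylRep ρW) (hX : IsAdmissible M X) {r : W M} {β : ι → ℤ}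
    (hr : IsReflectionIn M r β) {B : Orbit M X} (hβ : InPM B.1 β) (a : GroupAlg M B₀) :
    ρW r (xi B a) = xi B a := by
  obtain ⟨w, i, rfl⟩ := inPM_isRoot (B.isAdmissible hX).1.1 hβ
  obtain rfl := hr.unique ((isReflectionIn_s i).conj w)
  obtain ⟨g, hg⟩ := hρ.exists_eq hX w⁻¹ B
  have hi : InPM (actW hX w⁻¹ B).1 (simpleRoot i) := by rwa [inPM_actW, inv_inv]
  have aB := (actW hX w⁻¹ B).isAdmissible hX
  rw [inPM_simpleRoot aB.1.1] at hi
  rw [rep_mul_apply, rep_mul_apply, hg, hρ, h_of_not_perp (fun hp => by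
    have := hp _ hi
    rw [form_simpleRoot_self] at this
    omega), map_one, one_mul,
    show act M i (actW hX w⁻¹ B) = actW hX w⁻¹ B from Subtype.ext (reflSet_of_mem aB.1 hi), ← hg,
    rep_rep_inv]

/-- The pair is conjugated to two simple roots; neither is orthogonal to the moved set, so both
labels are 1. -/
theorem IsWeylRep.rep_mul_of_perp (hρ : IsWeylRep ρW) (hX : IsAdmissible M X) {r r' : W M}
    {α α' : ι → ℤ} (hα : IsRoot M α) (hα' : IsRoot M α') (hr : IsReflectionIn M r α)
    (hr' : IsReflectionIn M r' α') (h : form M α α' = 0) {B : Orbit M X}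
    (hB : actW hX (r * r') B = B) {β β' : ι → ℤ} (hβ : InPM B.1 β) (hβ' : InPM B.1 β')
    (hαβ : form M α β ≠ 0) (hαβ' : form M α' β' ≠ 0) (a : GroupAlg M B₀) :
    ρW r (ρW r' (xi B a)) = xi B a := by
  -- Replacing `α'` by its negative does not change its reflection.
  wlog hpos : ∃ w : W M, IsPosRoot M (w.1 α') ∧ ∃ i, w.1 α = simpleRoot i generalizing α'
  · obtain ⟨w, i, rfl⟩ := hα
    rcases (hα'.apply w⁻¹).pos_or_neg with hp | hp
    · exact this hα' hr' h hαβ' ⟨w⁻¹, hp, i, inv_apply_apply _ _⟩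
    · exact this hα'.neg hr'.neg (by rwa [map_neg, neg_eq_zero])
        (by rwa [map_neg, LinearMap.neg_apply, neg_ne_zero])
        ⟨w⁻¹, by rwa [map_neg], i, inv_apply_apply _ _⟩
  obtain ⟨w, k, l, hk, hl⟩ : ∃ (w : W M) (k l : ι), w.1 α = simpleRoot k ∧ w.1 α' = simpleRoot l := by
    obtain ⟨w, hp, i, hi⟩ := hpos
    obtain ⟨w', k, l, hk, hl⟩ := exists_simpleRoot_pair hp (i := i) (by
      rw [← hi, form_invariant, h])
    exact ⟨w' * w, k, l, by rw [mul_apply, hi, hk], by rw [mul_apply, hl]⟩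
  have er : r = w⁻¹ * s M k * w := by
    have := (isReflectionIn_s (M := M) k).conj w⁻¹
    rw [← hk, inv_apply_apply, inv_inv] at this
    exact hr.unique this
  have er' : r' = w⁻¹ * s M l * w := by
    have := (isReflectionIn_s (M := M) l).conj w⁻¹
    rw [← hl, inv_apply_apply, inv_inv] at this
    exact hr'.unique this
  subst er er'
  have hkl : ¬ M.Adj k l := fun hadj => by
    have := form_simpleRoot_of_adj hadj
    rw [← hk, ← hl, form_invariant, h] at this
    omega
  obtain ⟨g, hg⟩ := hρ.exists_eq hX w B
  have aB := (actW hX w B).isAdmissible hX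
  have nk : ¬ Perp M k (actW hX w B).1 := fun hp => hαβ (by
    rw [← form_invariant M w, hk]
    exact perp_iff_inPM.1 hp _ ((inPM_actW_apply hX).2 hβ))
  have nl : ¬ Perp M l (actW hX w B).1 := fun hp => hαβ' (by
    rw [← form_invariant M w, hl]
    exact perp_iff_inPM.1 hp _ ((inPM_actW_apply hX).2 hβ'))
  have e : act M k (act M l (actW hX w B)) = actW hX w B := by
    have hg : w * (w⁻¹ * s M k * w * (w⁻¹ * s M l * w)) = s M k * (s M l * w) := by group
    rw [← actW_s hX, ← actW_s hX, ← actW_mul, ← actW_mul, mul_assoc, ← hg, actW_mul, hB]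
  have hk1 : BrauerADE.h M B₀ (act M l (actW hX w B)).1 k = 1 :=
    h_of_not_perp (mt (perp_reflSet_iff_of_not_adj aB.1 hkl).1 nk)
  rw [← rep_mul_apply, show w⁻¹ * s M k * w * (w⁻¹ * s M l * w) = w⁻¹ * (s M k * (s M l * w)) by group,
    rep_mul_apply, rep_mul_apply, rep_mul_apply, hg, hρ, h_of_not_perp nl, hρ,
    hk1, map_one, one_mul, one_mul, e,
    ← hg, rep_inv_rep]

/-- The two roots `α` and `α' = β + γ - α` have the same reflection on `ξ_B`. -/
theorem IsWeylRep.rep_eq_rep (hρ : IsWeylRep ρW) (hX : IsAdmissible M X) {r r' : W M}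
    {α α' β γ : ι → ℤ} {B : Orbit M X} (hα : IsRoot M α) (hα' : IsRoot M α')
    (hr : IsReflectionIn M r α) (hr' : IsReflectionIn M r' α')
    (hβ : InPM B.1 β) (hγ : InPM B.1 γ) (hβγ : form M β γ = 0) (e : α + α' = β + γ)
    (h1 : form M α β = 1) (h2 : form M α γ = 1) (a : GroupAlg M B₀) :
    ρW r (xi B a) = ρW r' (xi B a) := by
  have aB := B.isAdmissible hX
  have e' : α' = β + γ - α := by rw [← e]; abel
  have h : form M α α' = 0 := by
    rw [e']; simp [h1, h2, hα.form_self]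
  have h3 : form M α' β = 1 := by
    rw [e']
    simp [h1, form_symm M γ β, hβγ, (inPM_isRoot aB.1.1 hβ).form_self]
  have := hρ.rep_mul_of_perp hX hα hα' hr hr' h (B := B) (Subtype.ext (by
    rw [(isReflectionIn_iff hα).1 hr, (isReflectionIn_iff hα').1 hr']
    exact aB.wSet_reflW_mul_eq hα hα' hβ hγ hβγ h e h1 h2)) hβ hβ (by omega) (by omega) a
  conv_lhs => rw [← this]
  rw [← rep_mul_apply, hr.mul_self hα, map_one, Module.End.one_apply]

/-- This makes $e_i\xi_B$ independent of the chosen β. The root $\beta+\gamma-\alpha$ is $-r_\gamma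
r_\beta\alpha$, so its reflection is the conjugate of $r_\alpha$ by $r_\gamma r_\beta$, which fixes
$\xi_B$. By `IsWeylRep.rep_eq_rep` it acts on $\xi_B$ as $r_\alpha$ does. -/
theorem IsWeylRep.rep_mul_eq (hρ : IsWeylRep ρW) (hX : IsAdmissible M X) {r t t' : W M}
    {α β γ : ι → ℤ} {B : Orbit M X} (hα : IsRoot M α) (hr : IsReflectionIn M r α)
    (ht : IsReflectionIn M t β) (ht' : IsReflectionIn M t' γ)
    (hβ : InPM B.1 β) (hγ : InPM B.1 γ) (hβγ : form M β γ = 0)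
    (h1 : form M α β = 1) (h2 : form M α γ = 1) (a : GroupAlg M B₀) :
    ρW t (ρW r (xi B a)) = ρW t' (ρW r (xi B a)) := by
  have aB := B.isAdmissible hX
  have hγr := inPM_isRoot aB.1.1 hγ
  have e : (t' * t).1 α = α - β - γ := by
    rw [mul_apply, ht, ht']
    simp only [refl, map_sub, map_smul, form_symm M β α, form_symm M γ α, h1, h2,
      form_symm M γ β, hβγ]
    module
  have hα' : IsRoot M (β + γ - α) := by
    have := (hα.apply (t' * t)).neg
    rw [e] at this
    convert this using 1
    abel
  have hr' : IsReflectionIn M (t' * t * r * (t' * t)⁻¹) (β + γ - α) := by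
    have := (hr.conj (t' * t)).neg
    rw [e] at this
    convert this using 1
    abel
  have h3 := hρ.rep_eq_rep hX hα hα' hr hr' hβ hγ hβγ (by abel) h1 h2 a
  have h4' : ρW (t' * t) (xi B a) = xi B a := by
    rw [rep_mul_apply, hρ.rep_of_inPM hX ht hβ, hρ.rep_of_inPM hX ht' hγ]
  have h4 : ρW (t' * t)⁻¹ (xi B a) = xi B a := by
    conv_lhs => rw [← h4']
    rw [rep_inv_rep]
  rw [rep_mul_apply, h4, rep_mul_apply, rep_mul_apply] at h3
  have h5 := congrArg (ρW t') h3
  rw [← rep_mul_apply t' t', ht'.mul_self hγr, map_one, Module.End.one_apply] at h5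
  exact h5.symm

end Monomial

end BrauerADE

namespace BrauerADE

set_option linter.unusedSectionVars false

variable {ι : Type*} [Fintype ι] [DecidableEq ι] {M : SimpleGraph ι}

/-! ### The operators attached to the roots -/

section Operators

variable [PosDefForm M] {X B₀ : Set (ι → ℤ)} {ρW : W M →* Module.End K (V M X B₀)}

theorem root_cases {B : Set (ι → ℤ)} (hB : IsOrthogonalSet M B) {α : ι → ℤ} (hα : IsRoot M α) :
    InPM B α ∨ (∀ β, InPM B β → form M α β = 0) ∨ ∃ β, InPM B β ∧ form M α β = 1 := by
  by_cases h1 : InPM B α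
  · exact .inl h1
  by_cases h2 : ∀ β, InPM B β → form M α β = 0
  · exact .inr (.inl h2)
  push Not at h2
  obtain ⟨β, hβ, h3⟩ := h2
  have h4 := abs_form_le_one hα.form_self (inPM_isRoot hB.1 hβ).form_self
    (by rintro rfl; exact h1 hβ) (by rintro rfl; exact h1 (inPM_neg.2 hβ))
  by_cases h5 : form M α β = 1
  · exact .inr (.inr ⟨β, hβ, h5⟩)
  · exact .inr (.inr ⟨-β, inPM_neg.2 hβ, by rw [map_neg]; omega⟩)

/-- `E` acts as the Brauer algebra element attached to the root `α`. -/
structure IsRootOperator (ρW : W M →* Module.End K (V M X B₀)) (α : ι → ℤ)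
    (E : Module.End K (V M X B₀)) : Prop where
  mem (B : Orbit M X) (a : GroupAlg M B₀) : InPM B.1 α → E (xi B a) = (RatFunc.X : K) • xi B a
  perp (B : Orbit M X) (a : GroupAlg M B₀) : (∀ β, InPM B.1 β → form M α β = 0) → E (xi B a) = 0
  adj (B : Orbit M X) (a : GroupAlg M B₀) (β : ι → ℤ) (t r : W M) : InPM B.1 β →
    form M α β = 1 → IsReflectionIn M t β → IsReflectionIn M r α →
    E (xi B a) = ρW t (ρW r (xi B a))

variable {α γ : ι → ℤ} {E F : Module.End K (V M X B₀)}

theorem IsRootOperator.unique (hX : IsAdmissible M X) (hα : IsRoot M α)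
    (hE : IsRootOperator ρW α E) (hF : IsRootOperator ρW α F) : E = F := by
  refine end_ext fun B a => ?_
  have aB := B.isAdmissible hX
  rcases root_cases aB.1 hα with h | h | ⟨β, hβ, h⟩
  · rw [hE.mem B a h, hF.mem B a h]
  · rw [hE.perp B a h, hF.perp B a h]
  · obtain ⟨t, ht⟩ := exists_isReflectionIn M (inPM_isRoot aB.1.1 hβ)
    obtain ⟨r, hr⟩ := exists_isReflectionIn M hα
    rw [hE.adj B a β t r hβ h ht hr, hF.adj B a β t r hβ h ht hr]

theorem IsRootOperator.neg (hE : IsRootOperator ρW α E) : IsRootOperator ρW (-α) E where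
  mem B a h := hE.mem B a (inPM_neg.1 h)
  perp B a h := hE.perp B a fun β hβ => by simpa using h β hβ
  adj B a β t r hβ h ht hr := hE.adj B a (-β) t r (inPM_neg.2 hβ)
    (by rw [map_neg, ← h, map_neg, LinearMap.neg_apply]) ht.neg (by simpa using hr.neg)

theorem IsRootOperator.conj (hρ : IsWeylRep ρW) (hX : IsAdmissible M X)
    (hE : IsRootOperator ρW α E) (w : W M) :
    IsRootOperator ρW (w.1 α) (ρW w * E * ρW w⁻¹) where
  mem B a h := by
    obtain ⟨g, hg⟩ := hρ.exists_eq hX w⁻¹ B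
    rw [Module.End.mul_apply, Module.End.mul_apply, hg, hE.mem _ _ (by
      rwa [inPM_actW, inv_inv]), ← hg, map_smul, rep_rep_inv]
  perp B a h := by
    obtain ⟨g, hg⟩ := hρ.exists_eq hX w⁻¹ B
    rw [Module.End.mul_apply, Module.End.mul_apply, hg, hE.perp _ _ fun β hβ => by
      rw [inPM_actW, inv_inv] at hβ
      rw [← form_invariant M w]
      exact h _ hβ, map_zero]
  adj B a β t r hβ h ht hr := by
    obtain ⟨g, hg⟩ := hρ.exists_eq hX w⁻¹ B
    have ht' := ht.conj w⁻¹
    have hr' := hr.conj w⁻¹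
    rw [inv_apply_apply] at hr'
    rw [Module.End.mul_apply, Module.End.mul_apply, hg, hE.adj _ _ (w⁻¹.1 β) _ _ (by
      rwa [inPM_actW, inv_inv, apply_inv_apply]) (by
      rw [← form_invariant M w, apply_inv_apply, h]) ht' hr', ← hg]
    simp only [← rep_mul_apply]
    congr 2
    group

/-- A Weyl group element that maps `α` to `± γ` intertwines the operators of `α` and `γ`. -/
theorem IsRootOperator.intertwine (hρ : IsWeylRep ρW) (hX : IsAdmissible M X) (hα : IsRoot M α)
    (hE : IsRootOperator ρW α E) (hF : IsRootOperator ρW γ F) {w : W M}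
    (h : w.1 α = γ ∨ w.1 α = -γ) : ρW w * E = F * ρW w := by
  have h1 : ρW w * E * ρW w⁻¹ = F := by
    refine (hE.conj hρ hX w).unique hX (hα.apply w) ?_
    rcases h with h | h
    · rwa [h]
    · rw [h]; exact hF.neg
  rw [← h1, mul_assoc (ρW w * E), ← map_mul, inv_mul_cancel, map_one, mul_one]

/-- The three rules exclude one another, and the third is consistent by `IsWeylRep.rep_mul_eq`. -/
theorem exists_isRootOperator (hρ : IsWeylRep ρW) (hX : IsAdmissible M X) (hα : IsRoot M α) :
    ∃ E, IsRootOperator ρW α E := by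
  have key : ∀ B : Orbit M X, ∃ f : Module.End K (V M X B₀),
      (InPM B.1 α → ∀ a, f (xi B a) = (RatFunc.X : K) • xi B a) ∧
      ((∀ β, InPM B.1 β → form M α β = 0) → ∀ a, f (xi B a) = 0) ∧
      ∀ (a : GroupAlg M B₀) (β : ι → ℤ) (t r : W M), InPM B.1 β →
        form M α β = 1 → IsReflectionIn M t β → IsReflectionIn M r α →
        f (xi B a) = ρW t (ρW r (xi B a)) := fun B => by
    have aB := B.isAdmissible hX
    have hself : InPM B.1 α → ∀ β, InPM B.1 β → form M α β ≠ 1 := fun h β hβ e => by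
      rcases aB.1.form_eq h hβ with rfl | rfl | e'
      · have := hα.form_self; omega
      · have := (inPM_isRoot aB.1.1 hβ).form_self
        rw [map_neg, LinearMap.neg_apply] at e
        omega
      · omega
    rcases root_cases aB.1 hα with h | h | ⟨β, hβ, h⟩
    · refine ⟨(RatFunc.X : K) • 1, fun _ a => rfl, fun h' => ?_, fun a β t r hβ h' =>
        absurd h' (hself h β hβ)⟩
      have := h' _ h
      rw [hα.form_self] at this
      omega
    · refine ⟨0, fun h' => ?_, fun _ a => rfl, fun a β t r hβ h' => ?_⟩
      · have := h _ h'
        rw [hα.form_self] at this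
        omega
      · rw [h β hβ] at h'; omega
    · obtain ⟨t, ht⟩ := exists_isReflectionIn M (inPM_isRoot aB.1.1 hβ)
      obtain ⟨r, hr⟩ := exists_isReflectionIn M hα
      refine ⟨ρW t * ρW r, fun h' => absurd h (hself h' β hβ), fun h' => ?_,
        fun a β' t' r' hβ' h' ht' hr' => ?_⟩
      · rw [h' β hβ] at h; omega
      · obtain rfl := hr.unique hr'
        rw [Module.End.mul_apply]
        rcases aB.1.form_eq hβ hβ' with rfl | rfl | e
        · rw [ht.unique ht']
        · rw [map_neg] at h; omega
        · exact hρ.rep_mul_eq hX hα hr ht ht' hβ hβ' e h h' a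
  choose f hf1 hf2 hf3 using key
  refine ⟨Finsupp.lsum K fun B => (f B).comp (Finsupp.lsingle B), ?_⟩
  have hv : ∀ B a, (Finsupp.lsum K fun B => (f B).comp (Finsupp.lsingle B)) (xi B a) =
      f B (xi B a) := fun B a => by simp [xi]
  exact ⟨fun B a h => by rw [hv, hf1 B h], fun B a h => by rw [hv, hf2 B h],
    fun B a β t r hβ h ht hr => by rw [hv, hf3 B a β t r hβ h ht hr]⟩

/-- The operator of `α` sends `ξ_B` to `0` or to some `ξ_{B'}` with `α ∈ B'`. -/
theorem IsRootOperator.exists_eq (hρ : IsWeylRep ρW) (hX : IsAdmissible M X) (hα : IsRoot M α)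
    (hE : IsRootOperator ρW α E) {B : Orbit M X} (hB : ¬ InPM B.1 α)
    (hp : ¬ ∀ β, InPM B.1 β → form M α β = 0) :
    ∃ (B' : Orbit M X) (g : parabolic M (nodesC M B₀)), InPM B'.1 α ∧
      (∀ β, InPM B.1 β → form M α β = 0 → InPM B'.1 β) ∧
      ∀ a, E (xi B a) = xi B' (MonoidAlgebra.of K _ g * a) := by
  have aB := B.isAdmissible hX
  obtain ⟨β, hβ, h⟩ := ((root_cases aB.1 hα).resolve_left hB).resolve_left hp
  have hβ2 := (inPM_isRoot aB.1.1 hβ).form_self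
  obtain ⟨t, ht⟩ := exists_isReflectionIn M (inPM_isRoot aB.1.1 hβ)
  obtain ⟨r, hr⟩ := exists_isReflectionIn M hα
  obtain ⟨g, hg⟩ := hρ.exists_eq hX (t * r) B
  refine ⟨actW hX (t * r) B, g, ?_, fun β' hβ' h' => ?_, fun a => by
    rw [hE.adj B a β t r hβ h ht hr, ← rep_mul_apply, hg]⟩
  · have : (t * r).1 β = -α := by
      rw [mul_apply, ht, hr]
      simp only [refl, h, form_symm M β α, map_sub, map_smul, hβ2]
      module
    rw [← inPM_neg, ← this, inPM_actW_apply]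
    exact hβ
  · have : (t * r).1 β' = β' := by
      rw [mul_apply, ht, hr, refl_of_perp h', refl_of_perp]
      rcases aB.1.form_eq hβ hβ' with rfl | rfl | e
      · omega
      · rw [map_neg] at h; omega
      · exact e
    rw [← this, inPM_actW_apply]
    exact hβ'

end Operators

/-! ### The Brauer relations for the root operators -/

section Relations

variable [PosDefForm M] {X B₀ : Set (ι → ℤ)} {ρW : W M →* Module.End K (V M X B₀)}
  {α γ : ι → ℤ} {E F : Module.End K (V M X B₀)}

theorem xi_zero (B : Orbit M X) : xi B (0 : GroupAlg M B₀) = 0 := Finsupp.single_zero B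

theorem smul_xi (c : K) (B : Orbit M X) (a : GroupAlg M B₀) : c • xi B a = xi B (c • a) :=
  Finsupp.smul_single c B a

/-- The operator of `α` sends `ξ_B` to some `ξ_{B'}` with `α ∈ B'`, if it is not `0` on it. -/
theorem IsRootOperator.exists_xi (hρ : IsWeylRep ρW) (hX : IsAdmissible M X) (hα : IsRoot M α)
    (hE : IsRootOperator ρW α E) (B : Orbit M X) (a : GroupAlg M B₀) :
    E (xi B a) = 0 ∨ ∃ (B' : Orbit M X) (b : GroupAlg M B₀), InPM B'.1 α ∧
      (∀ β, InPM B.1 β → form M α β = 0 → InPM B'.1 β) ∧ E (xi B a) = xi B' b := by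
  by_cases h1 : InPM B.1 α
  · exact .inr ⟨B, _, h1, fun _ h _ => h, by rw [hE.mem B a h1, smul_xi]⟩
  by_cases h2 : ∀ β, InPM B.1 β → form M α β = 0
  · exact .inl (hE.perp B a h2)
  obtain ⟨B', g, h3, h4, h5⟩ := hE.exists_eq hρ hX hα h1 h2
  exact .inr ⟨B', _, h3, h4, h5 a⟩

theorem IsRootOperator.rep_mul (hρ : IsWeylRep ρW) (hX : IsAdmissible M X) (hα : IsRoot M α)
    (hE : IsRootOperator ρW α E) {r : W M} (hr : IsReflectionIn M r α) : ρW r * E = E := by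
  refine end_ext fun B a => ?_
  rw [Module.End.mul_apply]
  rcases hE.exists_xi hρ hX hα B a with h | ⟨B', b, h1, -, h2⟩
  · rw [h, map_zero]
  · rw [h2, hρ.rep_of_inPM hX hr h1]

theorem IsRootOperator.mul_rep (hρ : IsWeylRep ρW) (hX : IsAdmissible M X) (hα : IsRoot M α)
    (hE : IsRootOperator ρW α E) {r : W M} (hr : IsReflectionIn M r α) : E * ρW r = E := by
  rw [← hE.intertwine hρ hX hα hE (w := r) (.inr (by rw [hr, refl_self hα.form_self])),
    hE.rep_mul hρ hX hα hr]

theorem IsRootOperator.mul_self (hρ : IsWeylRep ρW) (hX : IsAdmissible M X) (hα : IsRoot M α)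
    (hE : IsRootOperator ρW α E) : E * E = (RatFunc.X : K) • E := by
  refine end_ext fun B a => ?_
  rw [Module.End.mul_apply, LinearMap.smul_apply]
  rcases hE.exists_xi hρ hX hα B a with h | ⟨B', b, h1, -, h2⟩
  · rw [h, map_zero, smul_zero]
  · rw [h2, hE.mem _ _ h1]

/-- The image of `F` involves only sets containing γ up to sign, and there -γ is an admissible
choice in the third rule for α. -/
theorem IsRootOperator.rep_mul_rep_mul (hρ : IsWeylRep ρW) (hX : IsAdmissible M X)
    (hγ : IsRoot M γ) (hE : IsRootOperator ρW α E) (hF : IsRootOperator ρW γ F)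
    (h : form M α γ = -1) {r t : W M} (hr : IsReflectionIn M r α) (ht : IsReflectionIn M t γ) :
    ρW t * ρW r * F = E * F := by
  refine end_ext fun B a => ?_
  simp only [Module.End.mul_apply]
  rcases hF.exists_xi hρ hX hγ B a with h' | ⟨B', b, h1, -, h2⟩
  · simp only [h', map_zero]
  · rw [h2, hE.adj B' b (-γ) t r (inPM_neg.2 h1) (by rw [map_neg, h, neg_neg]) ht.neg hr]

theorem IsRootOperator.comm_rep (hρ : IsWeylRep ρW) (hX : IsAdmissible M X) (hα : IsRoot M α)
    (hE : IsRootOperator ρW α E) {t : W M} {β : ι → ℤ} (ht : IsReflectionIn M t β)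
    (h : form M α β = 0) (v : V M X B₀) : E (ρW t v) = ρW t (E v) := by
  have := hE.intertwine hρ hX hα hE (w := t) (.inl (by
    rw [ht, refl_of_perp (by rw [form_symm, h])]))
  exact (LinearMap.congr_fun this v).symm

/-- On $\xi_B$ the operator `F` is a product of reflections in β and γ, both orthogonal to α, so `E`
passes through it. As β survives in the set produced by `E`, the same reflections give `F` there. -/
theorem IsRootOperator.comm_apply_of_adj (hρ : IsWeylRep ρW) (hX : IsAdmissible M X)
    (hα : IsRoot M α) (hγ : IsRoot M γ) (hE : IsRootOperator ρW α E)
    (hF : IsRootOperator ρW γ F) (h : form M α γ = 0) {B : Orbit M X} (a : GroupAlg M B₀)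
    {β : ι → ℤ} (hβ : InPM B.1 β) (h1 : form M γ β = 1) (h2 : form M α β = 0) :
    E (F (xi B a)) = F (E (xi B a)) := by
  obtain ⟨t, ht⟩ := exists_isReflectionIn M (inPM_isRoot (B.isAdmissible hX).1.1 hβ)
  obtain ⟨r, hr⟩ := exists_isReflectionIn M hγ
  rw [hF.adj B a β t r hβ h1 ht hr, hE.comm_rep hρ hX hα ht h2, hE.comm_rep hρ hX hα hr h]
  rcases hE.exists_xi hρ hX hα B a with h3 | ⟨B', b, -, h4, h5⟩
  · simp only [h3, map_zero]
  · rw [h5, hF.adj B' b β t r (h4 β hβ h2) h1 ht hr]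

theorem IsRootOperator.comm_apply_of_perp (hρ : IsWeylRep ρW) (hX : IsAdmissible M X)
    (hα : IsRoot M α) (hγ : IsRoot M γ) (hE : IsRootOperator ρW α E)
    (hF : IsRootOperator ρW γ F) (h : form M α γ = 0) {B : Orbit M X} (a : GroupAlg M B₀)
    (h1 : ∀ β, InPM B.1 β → form M α β = 0) : E (F (xi B a)) = F (E (xi B a)) := by
  have aB := B.isAdmissible hX
  rw [hE.perp B a h1, map_zero]
  rcases root_cases aB.1 hγ with h' | h' | ⟨β, hβ, h'⟩
  · rw [hF.mem B a h', map_smul, hE.perp B a h1, smul_zero]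
  · rw [hF.perp B a h', map_zero]
  · rw [hE.comm_apply_of_adj hρ hX hα hγ hF h a hβ h' (h1 β hβ), hE.perp B a h1, map_zero]

/-- The set $r_\beta r_\alpha B$ produced by `E` is orthogonal to γ, since $(\gamma,r_\beta r_\alpha
u)=(\gamma,u)-(\beta,u)+(\alpha,u)$. -/
theorem IsRootOperator.mul_apply_eq_zero (hρ : IsWeylRep ρW) (hX : IsAdmissible M X)
    (hα : IsRoot M α) (hγ : IsRoot M γ) (hE : IsRootOperator ρW α E)
    (hF : IsRootOperator ρW γ F) (h : form M α γ = 0) {B : Orbit M X} (a : GroupAlg M B₀)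
    (nγ : ¬ InPM B.1 γ) {β : ι → ℤ} (hβ : InPM B.1 β) (h1 : form M α β = 1) (h2 : form M γ β = 1)
    (h3 : ∀ v, InPM B.1 v → form M γ v = 0 → form M α v = 0)
    (h4 : ∀ v, InPM B.1 v → form M β v = 0 → form M γ v = 1 → form M α v = -1) :
    F (E (xi B a)) = 0 := by
  have aB := B.isAdmissible hX
  have hβr := inPM_isRoot aB.1.1 hβ
  obtain ⟨t, ht⟩ := exists_isReflectionIn M hβr
  obtain ⟨r, hr⟩ := exists_isReflectionIn M hα
  obtain ⟨g, hg⟩ := hρ.exists_eq hX (t * r) B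
  rw [hE.adj B a β t r hβ h1 ht hr, ← rep_mul_apply, hg]
  refine hF.perp _ _ fun v hv => ?_
  rw [inPM_actW] at hv
  obtain ⟨u, rfl⟩ : ∃ u, v = (t * r).1 u := ⟨_, (apply_inv_apply _ _).symm⟩
  rw [inv_apply_apply] at hv
  have e : form M γ ((t * r).1 u) = form M γ u - form M β u + form M α u := by
    rw [mul_apply, ht, hr]
    simp only [refl, map_sub, map_smul, form_symm M β α, h1, h2, form_symm M γ α, h, smul_eq_mul]
    ring
  rw [e]
  rcases aB.1.form_eq hβ hv with rfl | rfl | h5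
  · rw [h1, h2, hβr.form_self]; rfl
  · have := (inPM_isRoot aB.1.1 hv).form_self
    simp only [map_neg, LinearMap.neg_apply] at h1 h2 ⊢
    omega
  · have h6 := abs_form_le_one hγ.form_self (inPM_isRoot aB.1.1 hv).form_self
      (by rintro rfl; exact nγ hv) (by rintro rfl; exact nγ (inPM_neg.2 hv))
    have h7 := h3 u hv
    have h8 := h4 u hv h5
    have h9 := h4 (-u) (inPM_neg.2 hv) (by rw [map_neg, h5, neg_zero])
    simp only [map_neg] at h9
    omega

/-- Here α and γ are joined to the same roots of `B`. If a second root `v` pairs to 1 with both,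
then $\alpha+\gamma=\beta+v$, the operators agree on $\xi_B$, and both products are δ times the
common value. Otherwise the remaining joined roots have opposite pairings, and both products vanish.
-/
theorem IsRootOperator.comm_apply_of_common (hρ : IsWeylRep ρW) (hX : IsAdmissible M X)
    (hα : IsRoot M α) (hγ : IsRoot M γ) (hE : IsRootOperator ρW α E)
    (hF : IsRootOperator ρW γ F) (h : form M α γ = 0) {B : Orbit M X} (a : GroupAlg M B₀)
    (nα : ¬ InPM B.1 α) (nγ : ¬ InPM B.1 γ) {β : ι → ℤ} (hβ : InPM B.1 β) (m1 : form M α β = 1)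
    (hγβ : form M γ β = 1) (q1 : ∀ v, InPM B.1 v → form M γ v = 1 → form M α v ≠ 0)
    (q2 : ∀ v, InPM B.1 v → form M α v = 1 → form M γ v ≠ 0) :
    E (F (xi B a)) = F (E (xi B a)) := by
  have aB := B.isAdmissible hX
  have h' : form M γ α = 0 := by rw [form_symm, h]
  have bound : ∀ δ, IsRoot M δ → ¬ InPM B.1 δ → ∀ v, InPM B.1 v →
      -1 ≤ form M δ v ∧ form M δ v ≤ 1 := fun δ hδ nδ v hv =>
    abs_form_le_one hδ.form_self (inPM_isRoot aB.1.1 hv).form_self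
      (by rintro rfl; exact nδ hv) (by rintro rfl; exact nδ (inPM_neg.2 hv))
  have c1 : ∀ v, InPM B.1 v → form M γ v = 0 → form M α v = 0 := fun v hv e => by
    have := bound α hα nα v hv
    have h1 := q2 v hv
    have h2 := q2 (-v) (inPM_neg.2 hv)
    simp only [map_neg] at h2
    omega
  have c2 : ∀ v, InPM B.1 v → form M α v = 0 → form M γ v = 0 := fun v hv e => by
    have := bound γ hγ nγ v hv
    have h1 := q1 v hv
    have h2 := q1 (-v) (inPM_neg.2 hv)
    simp only [map_neg] at h2
    omega
  by_cases d : ∃ v, InPM B.1 v ∧ form M β v = 0 ∧ form M γ v = 1 ∧ form M α v = 1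
  · obtain ⟨v, hv, h1, h2, h3⟩ := d
    have hv2 := (inPM_isRoot aB.1.1 hv).form_self
    have hβ2 := (inPM_isRoot aB.1.1 hβ).form_self
    have e : α + γ = β + v := by
      have : form M (α + γ - β - v) (α + γ - β - v) = 0 := by
        simp only [map_sub, map_add, LinearMap.sub_apply, LinearMap.add_apply, hα.form_self,
          hγ.form_self, hv2, hβ2, h, h', form_symm M β α, form_symm M β γ, form_symm M v α,
          form_symm M v γ, m1, hγβ, h1, h2, h3, form_symm M v β]
        norm_num
      have := PosDefForm.eq_zero_of_form_nonpos _ this.le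
      rw [sub_sub, sub_eq_zero] at this
      exact this
    obtain ⟨t, ht⟩ := exists_isReflectionIn M (inPM_isRoot aB.1.1 hβ)
    obtain ⟨r, hr⟩ := exists_isReflectionIn M hα
    obtain ⟨r', hr'⟩ := exists_isReflectionIn M hγ
    have hEF : E (xi B a) = F (xi B a) := by
      rw [hE.adj B a β t r hβ m1 ht hr, hF.adj B a β t r' hβ hγβ ht hr',
        hρ.rep_eq_rep hX hα hγ hr hr' hβ hv h1 e m1 h3]
    rw [← hEF, ← Module.End.mul_apply, hE.mul_self hρ hX hα, LinearMap.smul_apply, hEF,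
      ← Module.End.mul_apply, hF.mul_self hρ hX hγ, LinearMap.smul_apply]
  · push Not at d
    rw [hE.mul_apply_eq_zero hρ hX hα hγ hF h a nγ hβ m1 hγβ c1 fun v hv e1 e2 => by
        have := bound α hα nα v hv
        have := d v hv e1 e2
        have := q1 v hv e2
        omega,
      hF.mul_apply_eq_zero hρ hX hγ hα hE h' a nα hβ hγβ m1 c2 fun v hv e1 e2 => by
        have := bound γ hγ nγ v hv
        have e4 : form M γ v ≠ 1 := fun e3 => d v hv e1 e3 e2
        have := q2 v hv e2
        omega]

/-- Outside the easy cases each root of `B` is joined to both of α, γ or to neither. The sign of γ,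
which does not affect its operator, is then chosen so that one root pairs to 1 with both. -/
theorem IsRootOperator.comm (hρ : IsWeylRep ρW) (hX : IsAdmissible M X)
    (hα : IsRoot M α) (hγ : IsRoot M γ) (hE : IsRootOperator ρW α E)
    (hF : IsRootOperator ρW γ F) (h : form M α γ = 0) : E * F = F * E := by
  refine end_ext fun B a => ?_
  rw [Module.End.mul_apply, Module.End.mul_apply]
  have aB := B.isAdmissible hX
  have h' : form M γ α = 0 := by rw [form_symm, h]
  by_cases p1 : ∀ β, InPM B.1 β → form M α β = 0
  · exact hE.comm_apply_of_perp hρ hX hα hγ hF h a p1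
  by_cases p2 : ∀ β, InPM B.1 β → form M γ β = 0
  · exact (hF.comm_apply_of_perp hρ hX hγ hα hE h' a p2).symm
  by_cases q1 : ∃ β, InPM B.1 β ∧ form M γ β = 1 ∧ form M α β = 0
  · obtain ⟨β, hβ, h1, h2⟩ := q1
    exact hE.comm_apply_of_adj hρ hX hα hγ hF h a hβ h1 h2
  by_cases q2 : ∃ β, InPM B.1 β ∧ form M α β = 1 ∧ form M γ β = 0
  · obtain ⟨β, hβ, h1, h2⟩ := q2
    exact (hF.comm_apply_of_adj hρ hX hγ hα hE h' a hβ h1 h2).symm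
  push Not at q1 q2
  rcases root_cases aB.1 hα with m1 | m1 | ⟨β, hβ, m1⟩
  · rcases root_cases aB.1 hγ with m2 | m2 | ⟨β, hβ, m2⟩
    · rw [hE.mem B a m1, hF.mem B a m2, map_smul, map_smul, hE.mem B a m1, hF.mem B a m2]
    · exact absurd m2 p2
    · rcases aB.1.form_eq m1 hβ with rfl | rfl | e
      · omega
      · rw [map_neg] at h'; omega
      · exact absurd e (q1 β hβ m2)
  · exact absurd m1 p1
  have nγ : ¬ InPM B.1 γ := fun m2 => by
    rcases aB.1.form_eq m2 hβ with rfl | rfl | e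
    · omega
    · rw [map_neg] at h; omega
    · exact q2 β hβ m1 e
  have nα : ¬ InPM B.1 α := fun m2 => by
    rcases aB.1.form_eq m2 hβ with rfl | rfl | e
    · have := hα.form_self; omega
    · have := hα.form_self
      rw [map_neg] at this; omega
    · omega
  have bγ : form M γ β = 1 ∨ form M γ β = -1 := by
    have := q2 β hβ m1
    have := abs_form_le_one hγ.form_self (inPM_isRoot aB.1.1 hβ).form_self
      (by rintro rfl; exact nγ hβ) (by rintro rfl; exact nγ (inPM_neg.2 hβ))
    omega
  rcases bγ with bγ | bγ
  · exact hE.comm_apply_of_common hρ hX hα hγ hF h a nα nγ hβ m1 bγ q1 q2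
  · refine hE.comm_apply_of_common hρ hX hα hγ.neg hF.neg (by rwa [map_neg, neg_eq_zero]) a nα
      (by rwa [inPM_neg]) hβ m1 (by rw [map_neg, LinearMap.neg_apply, bγ, neg_neg])
      (fun v hv e => ?_) fun v hv e => ?_
    · have := q1 (-v) (inPM_neg.2 hv)
      simp only [map_neg, LinearMap.neg_apply] at this e
      rw [neg_ne_zero] at this
      exact this e
    · rw [map_neg, LinearMap.neg_apply, neg_ne_zero]
      exact q2 v hv e

end Relations

end BrauerADE

namespace BrauerADE

set_option linter.unusedSectionVars false

variable {ι : Type*} [Fintype ι] [DecidableEq ι] {M : SimpleGraph ι}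

/-! ### The representation of the Brauer algebra -/

section Existence

variable [PosDefForm M] {X B₀ : Set (ι → ℤ)}

/-- The operators by which the generators of the Brauer monoid act. -/
noncomputable def genOp (ρW : W M →* Module.End K (V M X B₀)) (E : ι → Module.End K (V M X B₀)) :
    BrauerGen ι → Module.End K (V M X B₀)
  | .r i => ρW (s M i)
  | .e i => E i
  | .delta => (RatFunc.X : K) • 1
  | .deltaInv => (RatFunc.X : K)⁻¹ • 1

theorem genOp_rel {ρW : W M →* Module.End K (V M X B₀)} (hρ : IsWeylRep ρW) (hX : IsAdmissible M X)
    {E : ι → Module.End K (V M X B₀)} (hE : ∀ i, IsRootOperator ρW (simpleRoot i) (E i))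
    (a b : FreeMonoid (BrauerGen ι)) (h : BrauerRel M a b) :
    FreeMonoid.lift (genOp ρW E) a = FreeMonoid.lift (genOp ρW E) b := by
  have hroot := isRoot_simpleRoot (M := M)
  have hs := isReflectionIn_s (M := M)
  have hcomm : ∀ i j, ¬ M.Adj i j → i ≠ j → form M (simpleRoot i) (simpleRoot j) = 0 :=
    fun i j h hij => form_simpleRoot_of_not_adj hij h
  cases h <;> simp only [map_mul, map_one, FreeMonoid.lift_eval_of, genOp]
  case delta_central => rw [smul_mul_assoc, mul_smul_comm, one_mul, mul_one]
  case delta_inv =>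
    rw [smul_mul_smul_comm, mul_one, mul_inv_cancel₀ RatFunc.X_ne_zero, one_smul]
  case RSrr i => rw [← map_mul, s_mul_self, map_one]
  case RSer i => exact (hE i).mul_rep hρ hX (hroot i) (hs i)
  case RSre i => exact (hE i).rep_mul hρ hX (hroot i) (hs i)
  case HSee i => rw [smul_mul_assoc, one_mul, (hE i).mul_self hρ hX (hroot i)]
  case HCrr i j hij => rw [← map_mul, ← map_mul, s_comm hij]
  case HCer i j hij =>
    refine ((hE i).intertwine hρ hX (hroot i) (hE i) ?_).symm
    rw [s_apply]
    by_cases e : i = j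
    · subst e
      exact .inr (refl_self (form_simpleRoot_self M i))
    · exact .inl (refl_of_perp (by rw [form_symm, hcomm i j hij e]))
  case HCee i j hij =>
    by_cases e : i = j
    · rw [e]
    · exact (hE i).comm hρ hX (hroot i) (hroot j) (hE j) (hcomm i j hij e)
  case HNrrr i j hij => rw [← map_mul, ← map_mul, ← map_mul, ← map_mul, s_braid hij]
  case HNrer i j hij =>
    -- Since $r_ir_j\alpha_i=\alpha_j$, this product intertwines the two operators; the relation
    -- follows by cancelling squares.
    have h1 := (hE i).intertwine hρ hX (hroot i) (hE j) (w := s M i * s M j) (.inl (by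
      rw [mul_apply, s_apply, s_apply]
      simp only [refl, form_simpleRoot_of_adj hij, form_simpleRoot_of_adj hij.symm, map_sub,
        map_smul, form_simpleRoot_self]
      module))
    have h2 : ∀ k, ρW (s M k) * ρW (s M k) = 1 := fun k => by rw [← map_mul, s_mul_self, map_one]
    rw [map_mul] at h1
    calc ρW (s M j) * E i * ρW (s M j)
        = ρW (s M i) * (ρW (s M i) * ρW (s M j) * E i) * ρW (s M j) := by
          rw [mul_assoc (ρW (s M i)) _ (E i), ← mul_assoc (ρW (s M i)) (ρW (s M i)), h2, one_mul]
      _ = ρW (s M i) * E j * ρW (s M i) * (ρW (s M j) * ρW (s M j)) := by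
          rw [h1]; simp only [mul_assoc]
      _ = _ := by rw [h2, mul_one]
  case RNrre i j hij =>
    exact (hE i).rep_mul_rep_mul hρ hX (hroot j) (hE j) (form_simpleRoot_of_adj hij) (hs i) (hs j)

theorem exists_isBrauerRep (hX : IsAdmissible M X) (h₀ : IsHighest M X B₀) :
    ∃ (ρW : W M →* Module.End K (V M X B₀)) (ρ : BrauerAlgebra M →+* Module.End K (V M X B₀)),
      IsBrauerRep ρW ρ := by
  have hρ : IsWeylRep (liftW (isCoxeterFamily_opR hX h₀)) := fun i B a => by
    rw [liftW_s, opR_xi]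
  generalize liftW (isCoxeterFamily_opR hX h₀) = ρW at hρ
  choose E hE using fun i => exists_isRootOperator hρ hX (isRoot_simpleRoot (M := M) i)
  let ρ : BrauerAlgebra M →+* Module.End K (V M X B₀) :=
    (MonoidAlgebra.lift ℤ _ _ (PresentedMonoid.lift (genOp ρW E) (genOp_rel hρ hX hE))).toRingHom
  have hgen : ∀ g, ρ (brGen M g) = genOp ρW E g := fun g => MonoidAlgebra.lift_of _ _
  refine ⟨ρW, ρ, hρ, fun i => hgen _, fun v => ?_, fun i B a h => ?_, fun i B a h => ?_,
    fun i B a β t hβ h ht => ?_⟩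
  · rw [hgen, genOp, LinearMap.smul_apply, Module.End.one_apply]
  · rw [hgen, genOp, (hE i).mem B a (.inl h)]
  · rw [hgen, genOp, (hE i).perp B a (perp_iff_inPM.1 h)]
  · rw [hgen, genOp]
    rw [form_symm] at h
    rcases (abs_eq one_pos.le).1 h with h | h
    · exact (hE i).adj B a β t _ (.inl hβ) h ht (isReflectionIn_s i)
    · exact (hE i).adj B a (-β) t _ (inPM_neg.2 (.inl hβ)) (by rw [map_neg, h, neg_neg]) ht.neg
        (isReflectionIn_s i)

end Existence

/-! ### Operators in the image of the Brauer algebra -/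

section Image

variable [PosDefForm M] {X B₀ : Set (ι → ℤ)} {ρW : W M →* Module.End K (V M X B₀)}
  {ρ : BrauerAlgebra M →+* Module.End K (V M X B₀)}

theorem IsBrauerRep.isWeylRep (hb : IsBrauerRep ρW ρ) : IsWeylRep ρW := hb.simple

theorem IsBrauerRep.isRootOperator (hb : IsBrauerRep ρW ρ) (hX : IsAdmissible M X) (i : ι) :
    IsRootOperator ρW (simpleRoot i) (ρ (brGen M (.e i))) where
  mem B a h := hb.gen_e_mem i B a ((inPM_simpleRoot (B.isAdmissible hX).1.1).1 h)
  perp B a h := hb.gen_e_perp i B a (perp_iff_inPM.2 h)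
  adj B a β t r hβ h ht hr := by
    obtain rfl := hr.unique (isReflectionIn_s i)
    rw [form_symm] at h
    rcases hβ with hβ | hβ
    · exact hb.gen_e_adj i B a β t hβ (by rw [h]; rfl) ht
    · exact hb.gen_e_adj i B a (-β) t hβ (by
        rw [map_neg, LinearMap.neg_apply, h]; rfl) ht.neg

theorem IsBrauerRep.exists_rep_eq (hb : IsBrauerRep ρW ρ) (w : W M) : ∃ b, ρ b = ρW w := by
  induction w using W_induction with
  | one => exact ⟨1, by rw [map_one, map_one]⟩
  | s_mul i w ih =>
    obtain ⟨b, hb'⟩ := ih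
    exact ⟨brGen M (.r i) * b, by rw [map_mul, map_mul, hb.gen_r, hb']⟩

theorem IsBrauerRep.exists_isRootOperator (hb : IsBrauerRep ρW ρ) (hX : IsAdmissible M X)
    {α : ι → ℤ} (hα : IsRoot M α) : ∃ b, IsRootOperator ρW α (ρ b) := by
  obtain ⟨w, i, rfl⟩ := hα
  obtain ⟨b, hw⟩ := hb.exists_rep_eq w
  obtain ⟨b', hw'⟩ := hb.exists_rep_eq w⁻¹
  refine ⟨b * brGen M (.e i) * b', ?_⟩
  rw [map_mul, map_mul, hw, hw']
  exact (hb.isRootOperator hX i).conj hb.isWeylRep hX w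

/-- The sets of an orbit are finite and, counted with signs, have equally many elements. -/
theorem Orbit.eq_of_subset (hX : IsAdmissible M X) {B B' : Orbit M X} (h : B.1 ⊆ B'.1) :
    B = B' := by
  obtain ⟨w, rfl⟩ := exists_actW_eq hX B B'
  have hp := (B.isAdmissible hX).1.1
  have hp' := ((actW hX w B).isAdmissible hX).1.1
  have himg : {v | InPM (actW hX w B).1 v} = w.1 '' {v | InPM B.1 v} := by
    ext v
    constructor
    · intro hv
      exact ⟨w⁻¹.1 v, (inPM_actW hX).1 hv, apply_inv_apply _ _⟩
    · rintro ⟨u, hu, rfl⟩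
      exact (inPM_actW_apply hX).2 hu
  have hfin : {v | InPM (actW hX w B).1 v}.Finite :=
    (finite_roots (M := M)).subset fun v hv => inPM_isRoot hp' hv
  have heq := Set.eq_of_subset_of_ncard_le (s := {v | InPM B.1 v}) (t := {v | InPM (actW hX w B).1 v})
    (fun v hv => hv.imp (fun hv => h hv) fun hv => h hv)
    (by rw [himg, Set.ncard_image_of_injective _ w.1.injective]) hfin
  exact Subtype.ext (inPM_ext hp hp' fun v => Set.ext_iff.1 heq v)

/-- The element is a product of root operators. Such an operator gives a factor δ only if its root
already lies in the set; otherwise it gives zero, or inserts the root without a factor, keeping the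
earlier roots because they are orthogonal to it. -/
theorem IsBrauerRep.exists_prod (hb : IsBrauerRep ρW ρ) (hX : IsAdmissible M X) (B : Orbit M X)
    (S : Finset (ι → ℤ)) (hS : ↑S ⊆ B.1) : ∃ b : BrauerAlgebra M,
      (∀ B' : Orbit M X, ↑S ⊆ B'.1 → ∀ a, ρ b (xi B' a) = (RatFunc.X : K) ^ S.card • xi B' a) ∧
      ∀ B' : Orbit M X, ¬ ↑S ⊆ B'.1 → (∀ a, ρ b (xi B' a) = 0) ∨
        ∃ (B'' : Orbit M X) (g : parabolic M (nodesC M B₀)) (m : ℕ), m < S.card ∧ ↑S ⊆ B''.1 ∧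
          ∀ a, ρ b (xi B' a) = (RatFunc.X : K) ^ m • xi B'' (MonoidAlgebra.of K _ g * a) := by
  induction S using Finset.induction_on with
  | empty =>
    refine ⟨1, fun B' _ a => ?_, fun B' h => absurd (by simp) h⟩
    rw [map_one, Module.End.one_apply, Finset.card_empty, pow_zero, one_smul]
  | insert β S hβS ih =>
    rw [Finset.coe_insert, Set.insert_subset_iff] at hS
    obtain ⟨hβ, hS⟩ := hS
    obtain ⟨b, h1, h2⟩ := ih hS
    have oB := (B.isAdmissible hX).1
    have hβp := oB.1 β hβ
    obtain ⟨c, hc⟩ := hb.exists_isRootOperator hX hβp.1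
    have hmem : ∀ (B' : Orbit M X) (v : ι → ℤ), v ∈ B.1 → (InPM B'.1 v ↔ v ∈ B'.1) :=
      fun B' v hv => inPM_iff_of_pos (B'.isAdmissible hX).1.1 (oB.1 v hv)
    have key : ∀ B' : Orbit M X, ↑S ⊆ B'.1 → β ∉ B'.1 → (∀ a, ρ c (xi B' a) = 0) ∨
        ∃ (B'' : Orbit M X) (g : parabolic M (nodesC M B₀)), ↑(insert β S) ⊆ B''.1 ∧
          ∀ a, ρ c (xi B' a) = xi B'' (MonoidAlgebra.of K _ g * a) := fun B' hB' hβ' => by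
      by_cases hp : ∀ γ, InPM B'.1 γ → form M β γ = 0
      · exact .inl fun a => hc.perp B' a hp
      obtain ⟨B'', g, h3, h4, h5⟩ := hc.exists_eq hb.isWeylRep hX hβp.1
        (by rwa [hmem B' β hβ]) hp
      refine .inr ⟨B'', g, ?_, h5⟩
      rw [Finset.coe_insert, Set.insert_subset_iff]
      refine ⟨(hmem B'' β hβ).1 h3, fun γ hγ => (hmem B'' γ (hS hγ)).1 (h4 γ (.inl (hB' hγ)) ?_)⟩
      exact oB.2 hβ (hS hγ) (by rintro rfl; exact hβS hγ)
    refine ⟨c * b, fun B' h a => ?_, fun B' h => ?_⟩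
    · rw [Finset.coe_insert, Set.insert_subset_iff] at h
      rw [map_mul, Module.End.mul_apply, h1 B' h.2, map_smul, hc.mem B' a (.inl h.1), smul_smul,
        Finset.card_insert_of_notMem hβS, pow_succ]
    · simp only [map_mul, Module.End.mul_apply, Finset.card_insert_of_notMem hβS]
      by_cases hS' : ↑S ⊆ B'.1
      · have hβ' : β ∉ B'.1 := fun h' => h (by
          rw [Finset.coe_insert, Set.insert_subset_iff]; exact ⟨h', hS'⟩)
        rcases key B' hS' hβ' with h3 | ⟨B'', g, h3, h4⟩
        · left; intro a
          rw [h1 B' hS', map_smul, h3, smul_zero]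
        · exact .inr ⟨B'', g, S.card, Nat.lt_succ_self _, h3, fun a => by
            rw [h1 B' hS', map_smul, h4]⟩
      · rcases h2 B' hS' with h3 | ⟨B'', g, m, hm, h3, h4⟩
        · left; intro a
          rw [h3, map_zero]
        by_cases hβ'' : β ∈ B''.1
        · refine .inr ⟨B'', g, m + 1, Nat.succ_lt_succ hm, ?_, fun a => ?_⟩
          · rw [Finset.coe_insert, Set.insert_subset_iff]; exact ⟨hβ'', h3⟩
          · rw [h4, map_smul, hc.mem B'' _ (.inl hβ''), smul_smul, pow_succ]
        · rcases key B'' h3 hβ'' with h5 | ⟨B₃, g', h5, h6⟩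
          · left; intro a
            rw [h4, map_smul, h5, smul_zero]
          · exact .inr ⟨B₃, g' * g, m, hm.trans (Nat.lt_succ_self _), h5, fun a => by
              rw [h4, map_smul, h6, map_mul, mul_assoc]⟩

/-- An element of the Brauer algebra that maps `V` to `ξ_B ℚ(δ)[W(C)]`, with a factor of highest
degree on `ξ_B`. -/
theorem IsBrauerRep.exists_projection (hb : IsBrauerRep ρW ρ) (hX : IsAdmissible M X)
    (B : Orbit M X) : ∃ (b : BrauerAlgebra M) (n : ℕ),
      (∀ a, ρ b (xi B a) = (RatFunc.X : K) ^ n • xi B a) ∧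
      ∀ B' : Orbit M X, B' ≠ B → (∀ a, ρ b (xi B' a) = 0) ∨
        ∃ (g : parabolic M (nodesC M B₀)) (m : ℕ), m < n ∧
          ∀ a, ρ b (xi B' a) = (RatFunc.X : K) ^ m • xi B (MonoidAlgebra.of K _ g * a) := by
  have hfin : B.1.Finite :=
    (finite_roots (M := M)).subset fun v hv => ((B.isAdmissible hX).1.1 v hv).1
  obtain ⟨b, h1, h2⟩ := hb.exists_prod hX B hfin.toFinset (by simp)
  rw [Set.Finite.coe_toFinset] at h1 h2
  refine ⟨b, _, h1 B subset_rfl, fun B' hB' => ?_⟩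
  rcases h2 B' fun h => hB' (Orbit.eq_of_subset hX h).symm with h | ⟨B'', g, m, hm, h3, h4⟩
  · exact .inl h
  · obtain rfl := Orbit.eq_of_subset hX h3
    exact .inr ⟨g, m, hm, h4⟩

/-- A generator $r_k$ of $W(C)$ fixes $B_0$, and its label there is $r_k$ itself. -/
theorem IsBrauerRep.rep_parabolic (hb : IsBrauerRep ρW ρ) (hX : IsAdmissible M X)
    (h₀ : IsHighest M X B₀) (g : parabolic M (nodesC M B₀)) (a : GroupAlg M B₀) :
    ρW g.1 (xi ⟨B₀, h₀.1⟩ a) = xi ⟨B₀, h₀.1⟩ (MonoidAlgebra.of K _ g * a) := by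
  obtain ⟨w, hw⟩ := g
  have ht := ((isHighest_iff hX).1 h₀).2
  have aB := InOrbit.isAdmissible hX h₀.1
  simp only
  induction hw using Subgroup.closure_induction generalizing a with
  | mem w hw =>
    obtain ⟨k, hk, rfl⟩ := hw
    have e1 : act M k ⟨B₀, h₀.1⟩ = (⟨B₀, h₀.1⟩ : Orbit M X) :=
      Subtype.ext (reflSet_of_perp aB.1 hk)
    have e2 : h M B₀ B₀ k = ⟨s M k, Subgroup.subset_closure ⟨k, hk, rfl⟩⟩ :=
      Subtype.ext (h_of_hRel ht aB (.top k hk))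
    rw [hb.simple, e1, e2]
  | one =>
    rw [map_one, Module.End.one_apply]
    exact congrArg (xi _) ((one_mul a).symm.trans (congrArg (· * a) (map_one _).symm))
  | mul w w' hw hw' ih ih' =>
    rw [rep_mul_apply, ih', ih, ← mul_assoc, ← map_mul]
    rfl
  | inv w hw ih =>
    have h1 := ih (MonoidAlgebra.of K _ (⟨w, hw⟩ : parabolic M (nodesC M B₀))⁻¹ * a)
    rw [← mul_assoc, ← map_mul, mul_inv_cancel, map_one, one_mul] at h1
    rw [← h1, rep_inv_rep]
    rfl

end Image

end BrauerADE

namespace BrauerADE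

set_option linter.unusedSectionVars false

variable {ι : Type*} [Fintype ι] [DecidableEq ι] {M : SimpleGraph ι}

/-! ### The subspaces `∑ ξ_B U` -/

section Sums

variable [PosDefForm M] {X B₀ : Set (ι → ℤ)} {ρW : W M →* Module.End K (V M X B₀)}
  {ρ : BrauerAlgebra M →+* Module.End K (V M X B₀)}
  {U : Submodule (GroupAlg M B₀) (GroupAlg M B₀)} {N : Submodule K (V M X B₀)}

theorem xiSum_le_iff : xiSum X U ≤ N ↔ ∀ (B : Orbit M X), ∀ a ∈ U, xi B a ∈ N := by
  simp only [xiSum, iSup_le_iff, Submodule.map_le_iff_le_comap]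
  rfl

theorem xi_mem_xiSum (B : Orbit M X) {a : GroupAlg M B₀} (ha : a ∈ U) : xi B a ∈ xiSum X U :=
  xiSum_le_iff.1 le_rfl B a ha

theorem apply_mem_of_mem_xiSum {v : V M X B₀} (hv : v ∈ xiSum X U) (B : Orbit M X) : v B ∈ U := by
  have : xiSum X U ≤ (U.restrictScalars K).comap (Finsupp.lapply B) := by
    refine xiSum_le_iff.2 fun B' a ha => ?_
    change (Finsupp.single B' a : V M X B₀) B ∈ U
    by_cases e : B' = B
    · subst e; rwa [Finsupp.single_eq_same]
    · rw [Finsupp.single_eq_of_ne' e]; exact U.zero_mem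
  exact this hv

theorem mem_of_xi_mem_xiSum {B : Orbit M X} {a : GroupAlg M B₀} (h : xi B a ∈ xiSum X U) :
    a ∈ U := by
  have := apply_mem_of_mem_xiSum h B
  rwa [xi, Finsupp.single_eq_same] at this

theorem isInvariant_of_gen (H : ∀ g, ∀ v ∈ N, ρ (brGen M g) v ∈ N) : IsInvariant ρ N := by
  have key : ∀ (m : BrauerMonoid M), ∀ v ∈ N, ρ (MonoidAlgebra.of ℤ _ m) v ∈ N := fun m => by
    obtain ⟨x, rfl⟩ := PresentedMonoid.surjective_mk m
    induction x using FreeMonoid.inductionOn with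
    | one => intro v hv; rwa [map_one, map_one, map_one, Module.End.one_apply]
    | of g => exact H g
    | mul x y hx hy =>
      intro v hv
      rw [map_mul, map_mul, map_mul, Module.End.mul_apply]
      exact hx _ (hy v hv)
  intro a
  induction a using MonoidAlgebra.induction_on with
  | of m => exact key m
  | add x y hx hy =>
    intro v hv
    rw [map_add, LinearMap.add_apply]
    exact N.add_mem (hx v hv) (hy v hv)
  | smul c x hx =>
    intro v hv
    rw [map_zsmul, LinearMap.smul_apply]
    exact zsmul_mem (hx v hv) c

/-- Only the action of δ is prescribed; that of its inverse is forced by the relation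
$\delta\delta^{-1}=1$. -/
theorem IsBrauerRep.gen_deltaInv (hb : IsBrauerRep ρW ρ) (v : V M X B₀) :
    ρ (brGen M .deltaInv) v = (RatFunc.X : K)⁻¹ • v := by
  have h1 : brGen M .delta * brGen M .deltaInv = 1 := by
    rw [brGen, brGen, ← map_mul, ← map_one (MonoidAlgebra.of ℤ (BrauerMonoid M))]
    exact congrArg _ (PresentedMonoid.mk_eq_mk_of_rel BrauerRel.delta_inv)
  have h2 := hb.gen_delta (ρ (brGen M .deltaInv) v)
  rw [← Module.End.mul_apply, ← map_mul, h1, map_one, Module.End.one_apply] at h2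
  conv_rhs => rw [h2]
  rw [smul_smul, inv_mul_cancel₀ RatFunc.X_ne_zero, one_smul]

theorem IsBrauerRep.isInvariant_xiSum (hb : IsBrauerRep ρW ρ) (hX : IsAdmissible M X) :
    IsInvariant ρ (xiSum X U) := by
  refine isInvariant_of_gen fun g => ?_
  cases g with
  | delta =>
    intro v hv
    rw [hb.gen_delta]
    exact Submodule.smul_mem _ _ hv
  | deltaInv =>
    intro v hv
    rw [hb.gen_deltaInv]
    exact Submodule.smul_mem _ _ hv
  | r i =>
    refine fun v hv => (xiSum_le_iff (N := (xiSum X U).comap (ρ (brGen M (.r i))))).2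
      (fun B a ha => ?_) hv
    rw [Submodule.mem_comap, hb.gen_r, hb.simple]
    exact xi_mem_xiSum _ (U.smul_mem _ ha)
  | e i =>
    refine fun v hv => (xiSum_le_iff (N := (xiSum X U).comap (ρ (brGen M (.e i))))).2
      (fun B a ha => ?_) hv
    have hE := hb.isRootOperator hX i
    rw [Submodule.mem_comap]
    by_cases h1 : InPM B.1 (simpleRoot i)
    · rw [hE.mem B a h1]
      exact Submodule.smul_mem _ _ (xi_mem_xiSum B ha)
    by_cases h2 : ∀ β, InPM B.1 β → form M (simpleRoot i) β = 0
    · rw [hE.perp B a h2]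
      exact Submodule.zero_mem _
    obtain ⟨B', g, -, -, h3⟩ := hE.exists_eq hb.isWeylRep hX (isRoot_simpleRoot i) h1 h2
    rw [h3]
    exact xi_mem_xiSum _ (U.smul_mem _ ha)

theorem IsBrauerRep.rep_mem (hb : IsBrauerRep ρW ρ) (hN : IsInvariant ρ N) (w : W M)
    {v : V M X B₀} (hv : v ∈ N) : ρW w v ∈ N := by
  obtain ⟨b, hb⟩ := hb.exists_rep_eq w
  rw [← hb]
  exact hN b v hv

/-! ### Leading degrees in δ and irreducibility -/

/-- `f` is `0` or of degree less than `D`. -/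
def DegreeLT (D : ℤ) (f : K) : Prop := f ≠ 0 → f.intDegree < D

theorem DegreeLT.add {D : ℤ} {f g : K} (hf : DegreeLT D f) (hg : DegreeLT D g) :
    DegreeLT D (f + g) := fun h => by
  by_cases hg0 : g = 0
  · subst hg0
    rw [add_zero] at h ⊢
    exact hf h
  by_cases hf0 : f = 0
  · subst hf0
    rw [zero_add] at h ⊢
    exact hg h
  · exact (RatFunc.intDegree_add_le hg0 h).trans_lt (max_lt (hf hf0) (hg hg0))

theorem intDegree_X_pow (n : ℕ) : ((RatFunc.X : K) ^ n).intDegree = n := by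
  induction n with
  | zero => simp
  | succ n ih =>
    rw [pow_succ, RatFunc.intDegree_mul (pow_ne_zero _ RatFunc.X_ne_zero) RatFunc.X_ne_zero, ih,
      RatFunc.intDegree_X]
    push_cast
    rfl

theorem exists_max_degree {v : V M X B₀} (hv : v ≠ 0) : ∃ B x, (v B).coeff x ≠ 0 ∧
    ∀ B' x', (v B').coeff x' ≠ 0 → ((v B').coeff x').intDegree ≤ ((v B).coeff x).intDegree := by
  let S := v.support.sigma fun B => (v B).coeff.support
  have hmem : ∀ B x, (⟨B, x⟩ : Σ _ : Orbit M X, parabolic M (nodesC M B₀)) ∈ S ↔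
      (v B).coeff x ≠ 0 := fun B x => by
    simp only [S, Finset.mem_sigma, Finsupp.mem_support_iff, and_iff_right_iff_imp]
    intro h e
    rw [e] at h
    exact h rfl
  have hne : S.Nonempty := by
    obtain ⟨B, hB⟩ := Finsupp.ne_iff.1 hv
    have hc : (v B).coeff ≠ 0 := fun e => hB (MonoidAlgebra.coeff_injective e)
    obtain ⟨x, hx⟩ := Finsupp.ne_iff.1 hc
    exact ⟨⟨B, x⟩, (hmem B x).2 hx⟩
  obtain ⟨⟨B, x⟩, h1, h2⟩ := S.exists_max_image (fun p => ((v p.1).coeff p.2).intDegree) hne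
  exact ⟨B, x, (hmem B x).1 h1, fun B' x' h => h2 ⟨B', x'⟩ ((hmem B' x').2 h)⟩

/-- A nonzero vector has a nonzero projection to some `ξ_B ℚ(δ)[W(C)]`. -/
theorem IsBrauerRep.exists_xi_mem (hb : IsBrauerRep ρW ρ) (hX : IsAdmissible M X)
    (hN : IsInvariant ρ N) (hN0 : N ≠ ⊥) : ∃ (B : Orbit M X) (a : GroupAlg M B₀),
      a ≠ 0 ∧ xi B a ∈ N := by
  obtain ⟨v, hv, hv0⟩ := Submodule.exists_mem_ne_zero_of_ne_bot hN0
  obtain ⟨B, x, h1, h2⟩ := exists_max_degree hv0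
  obtain ⟨b, n, h3, h4⟩ := hb.exists_projection hX B
  have hsum : v = ∑ B' ∈ insert B v.support, xi B' (v B') := by
    rw [← Finsupp.sum_of_support_subset v (Finset.subset_insert B _) (fun B' a => xi B' a)
      fun B' _ => xi_zero B']
    exact (Finsupp.sum_single v).symm
  -- The degree contributed by `B` itself at `x`. Any other set contributes less, since its power of
  -- δ is below `n` and its coefficient has at most the maximal degree.
  set D := (n : ℤ) + ((v B).coeff x).intDegree with hD
  have key : ∀ B', B' ≠ B → ∃ a : GroupAlg M B₀, ρ b (xi B' (v B')) = xi B a ∧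
      DegreeLT D (a.coeff x) := fun B' hB' => by
    rcases h4 B' hB' with h5 | ⟨g, m, hm, h5⟩
    · exact ⟨0, by rw [h5, xi_zero], fun h => absurd rfl h⟩
    · refine ⟨_, by rw [h5, smul_xi], fun h => ?_⟩
      rw [MonoidAlgebra.coeff_smul, Finsupp.smul_apply, MonoidAlgebra.of_apply,
        MonoidAlgebra.coeff_single_mul_apply, one_mul, smul_eq_mul] at h ⊢
      have h6 := right_ne_zero_of_mul h
      rw [RatFunc.intDegree_mul (left_ne_zero_of_mul h) h6, intDegree_X_pow]
      have := h2 B' _ h6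
      omega
  choose! a ha1 ha2 using key
  have hP : ρ b v = xi B ((RatFunc.X : K) ^ n • v B + ∑ B' ∈ v.support.erase B, a B') := by
    conv_lhs => rw [hsum]
    rw [map_sum, ← Finset.insert_erase (Finset.mem_insert_self B v.support),
      Finset.sum_insert (Finset.notMem_erase _ _), Finset.erase_insert_eq_erase, h3, smul_xi,
      Finset.sum_congr rfl fun B' hB' => ha1 B' (Finset.ne_of_mem_erase hB')]
    simp only [xi, Finsupp.single_add, Finsupp.single_finsetSum]
  refine ⟨B, _, fun e => ?_, hP ▸ hN b v hv⟩
  have hlow : DegreeLT D ((∑ B' ∈ v.support.erase B, a B').coeff x) := by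
    refine Finset.sum_induction a (fun c => DegreeLT D (c.coeff x)) (fun c d hc hd => ?_)
      (fun h => absurd rfl h) fun B' hB' => ha2 B' (Finset.ne_of_mem_erase hB')
    rw [MonoidAlgebra.coeff_add, Finsupp.add_apply]
    exact hc.add hd
  have e' := eq_neg_of_add_eq_zero_right e
  rw [e', MonoidAlgebra.coeff_neg, Finsupp.neg_apply, MonoidAlgebra.coeff_smul,
    Finsupp.smul_apply, smul_eq_mul] at hlow
  have hX0 : (RatFunc.X : K) ^ n ≠ 0 := pow_ne_zero _ RatFunc.X_ne_zero
  have := hlow (neg_ne_zero.2 (mul_ne_zero hX0 h1))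
  rw [RatFunc.intDegree_neg, RatFunc.intDegree_mul hX0 h1, intDegree_X_pow] at this
  omega

theorem of_mul_of_inv (g : parabolic M (nodesC M B₀)) (a : GroupAlg M B₀) :
    MonoidAlgebra.of K _ g * (MonoidAlgebra.of K _ g⁻¹ * a) = a := by
  rw [← mul_assoc, ← map_mul, mul_inv_cancel, map_one, one_mul]

/-- The left ideal of all `a` with `ξ_{B₀} a ∈ N`. -/
noncomputable def fiber (hb : IsBrauerRep ρW ρ) (hX : IsAdmissible M X) (h₀ : IsHighest M X B₀)
    (hN : IsInvariant ρ N) : Submodule (GroupAlg M B₀) (GroupAlg M B₀) where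
  carrier := {a | xi (⟨B₀, h₀.1⟩ : Orbit M X) a ∈ N}
  zero_mem' := by rw [Set.mem_ofPred_eq, xi_zero]; exact N.zero_mem
  add_mem' {a b} ha hb := by
    rw [Set.mem_ofPred_eq, xi, Finsupp.single_add]
    exact N.add_mem ha hb
  smul_mem' c a ha := by
    rw [Set.mem_ofPred_eq] at ha ⊢
    induction c using MonoidAlgebra.induction_on with
    | of g =>
      rw [smul_eq_mul, ← hb.rep_parabolic hX h₀]
      exact hb.rep_mem hN _ ha
    | add x y hx hy =>
      rw [add_smul, xi, Finsupp.single_add]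
      exact N.add_mem hx hy
    | smul c x hx =>
      rw [smul_assoc, ← smul_xi]
      exact N.smul_mem c hx

/-- A nonzero invariant `N` contains a nonzero $\xi_Ba$, which $W$ moves to $B_0$. The left ideal
cut out by `N` at $B_0$ is then a nonzero part of the simple `U`, hence all of it, and $W$ spreads
it over the orbit. -/
theorem IsBrauerRep.isIrreducibleModule_xiSum (hb : IsBrauerRep ρW ρ) (hX : IsAdmissible M X)
    (h₀ : IsHighest M X B₀) (hU : IsSimpleModule (GroupAlg M B₀) U) :
    IsIrreducibleModule ρ (xiSum X U) := by
  have hat := isSimpleModule_iff_isAtom.1 hU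
  refine ⟨hb.isInvariant_xiSum hX, fun e => ?_, fun N hNU hN => or_iff_not_imp_left.2 fun hN0 => ?_⟩
  · obtain ⟨a, ha, ha0⟩ := Submodule.exists_mem_ne_zero_of_ne_bot hat.1
    have := xi_mem_xiSum (⟨B₀, h₀.1⟩ : Orbit M X) ha
    rw [e, Submodule.mem_bot, xi, Finsupp.single_eq_zero] at this
    exact ha0 this
  obtain ⟨B, a, ha0, ha⟩ := hb.exists_xi_mem hX hN hN0
  obtain ⟨w, hw⟩ := exists_actW_eq hX B ⟨B₀, h₀.1⟩
  obtain ⟨g, hg⟩ := hb.isWeylRep.exists_eq hX w B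
  have h1 := hb.rep_mem hN w ha
  rw [hg, hw] at h1
  have hfib : fiber hb hX h₀ hN = U := by
    refine (hat.le_iff.1 fun a ha => mem_of_xi_mem_xiSum (hNU ha)).resolve_left fun e => ha0 ?_
    have h2 : MonoidAlgebra.of K _ g * a ∈ fiber hb hX h₀ hN := h1
    rw [e, Submodule.mem_bot] at h2
    have h3 := of_mul_of_inv g⁻¹ a
    rwa [inv_inv, h2, mul_zero, eq_comm] at h3
  refine le_antisymm hNU (xiSum_le_iff.2 fun B' c hc => ?_)
  obtain ⟨w', rfl⟩ := exists_actW_eq hX ⟨B₀, h₀.1⟩ B'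
  obtain ⟨g', hg'⟩ := hb.isWeylRep.exists_eq hX w' ⟨B₀, h₀.1⟩
  have h4 : MonoidAlgebra.of K _ g'⁻¹ * c ∈ fiber hb hX h₀ hN := by
    rw [hfib]
    exact U.smul_mem _ hc
  have h5 := hb.rep_mem hN w' h4
  rwa [hg', of_mul_of_inv] at h5

/-! ### From equivalent modules to isomorphic left ideals -/

theorem IsBrauerRep.exists_projection_range (hb : IsBrauerRep ρW ρ) (hX : IsAdmissible M X)
    (T : Orbit M X) : ∃ (b : BrauerAlgebra M) (c : K), c ≠ 0 ∧
      (∀ a, ρ b (xi T a) = c • xi T a) ∧ ∀ v, ∃ a, ρ b v = xi T a := by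
  obtain ⟨b, n, hb1, hb2⟩ := hb.exists_projection hX T
  refine ⟨b, (RatFunc.X : K) ^ n, pow_ne_zero _ RatFunc.X_ne_zero, hb1, fun v => ?_⟩
  suffices h : (⊤ : Submodule K (V M X B₀)) ≤
      (LinearMap.range (Finsupp.lsingle T : GroupAlg M B₀ →ₗ[K] V M X B₀)).comap (ρ b) by
    obtain ⟨c, hc⟩ := h (Submodule.mem_top (x := v))
    exact ⟨c, hc.symm⟩
  rw [← Finsupp.iSup_lsingle_range, iSup_le_iff]
  rintro B _ ⟨a, rfl⟩
  rw [Submodule.mem_comap]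
  by_cases e : B = T
  · subst e
    exact ⟨(RatFunc.X : K) ^ n • a, by
      rw [map_smul]; exact (hb1 a).symm⟩
  · rcases hb2 B e with h | ⟨g, m, -, h⟩
    · exact ⟨0, by rw [map_zero]; exact (h a).symm⟩
    · exact ⟨(RatFunc.X : K) ^ m • (MonoidAlgebra.of K _ g * a), by
        rw [map_smul]; exact (h a).symm⟩

/-- The element `ξ_B a` of `∑ ξ_B U`. -/
noncomputable def xiSub (B : Orbit M X) : U →ₗ[K] xiSum X U where
  toFun a := ⟨xi B a.1, xi_mem_xiSum B a.2⟩
  map_add' _ _ := Subtype.ext (Finsupp.single_add B _ _)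
  map_smul' c a := Subtype.ext (smul_xi c B a.1).symm

theorem coe_xiSub (B : Orbit M X) (a : U) : (xiSub B a : V M X B₀) = xi B a.1 := rfl

theorem xiSub_injective (B : Orbit M X) : Function.Injective (xiSub (U := U) B) := fun _ _ e =>
  Subtype.ext (Finsupp.single_injective B (congrArg Subtype.val e))

/-- As φ commutes with the projection at `T`, the image of $\xi_Ta$, multiplied by the nonzero
scalar `c`, lies in the range of that projection. -/
theorem IsBrauerRep.exists_map_xiSub (hb : IsBrauerRep ρW ρ) (hX : IsAdmissible M X)
    {U₁ U₂ : Submodule (GroupAlg M B₀) (GroupAlg M B₀)} (φ : xiSum X U₁ ≃ₗ[K] xiSum X U₂)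
    (hφ : ∀ (a : BrauerAlgebra M) (v v' : xiSum X U₁),
      (v' : V M X B₀) = ρ a v → (φ v' : V M X B₀) = ρ a (φ v)) (T : Orbit M X) (a : U₁) :
    ∃ c : U₂, φ (xiSub T a) = xiSub T c := by
  obtain ⟨b, c, hc, hb1, hb2⟩ := hb.exists_projection_range hX T
  have h1 := hφ b (xiSub T a) (c • xiSub T a) (by
    rw [Submodule.coe_smul, coe_xiSub, hb1])
  obtain ⟨d, hd⟩ := hb2 (φ (xiSub T a))
  rw [hd, map_smul, Submodule.coe_smul] at h1
  have h2 : (φ (xiSub T a) : V M X B₀) = xi T (c⁻¹ • d) := by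
    rw [← smul_xi, ← h1, smul_smul, inv_mul_cancel₀ hc, one_smul]
  have h3 : xi T (c⁻¹ • d) ∈ xiSum X U₂ := by
    rw [← h2]
    exact (φ (xiSub T a)).2
  exact ⟨⟨_, mem_of_xi_mem_xiSum h3⟩, Subtype.ext h2⟩

/-- A map that is additive, homogeneous and equivariant is linear over the group algebra. -/
theorem exists_linearMap_of_equivariant {k G P Q : Type*} [CommSemiring k] [Monoid G]
    [AddCommMonoid P] [AddCommMonoid Q] [Module k P] [Module k Q] [Module (MonoidAlgebra k G) P]
    [Module (MonoidAlgebra k G) Q] [IsScalarTower k (MonoidAlgebra k G) P]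
    [IsScalarTower k (MonoidAlgebra k G) Q] (f : P → Q) (hadd : ∀ a a', f (a + a') = f a + f a')
    (hsmul : ∀ (c : k) a, f (c • a) = c • f a)
    (hof : ∀ (g : G) a, f (MonoidAlgebra.of k G g • a) = MonoidAlgebra.of k G g • f a) :
    ∃ F : P →ₗ[MonoidAlgebra k G] Q, ∀ a, F a = f a :=
  ⟨MonoidAlgebra.equivariantOfLinearOfComm
    { toFun := f, map_add' := hadd, map_smul' := hsmul } hof, fun _ => rfl⟩

-- The elements of $W(C)$ act through the Brauer algebra, and at $B_0$ by left multiplication, so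
-- the map induced on coefficients commutes with them.
set_option maxHeartbeats 800000 in
theorem IsBrauerRep.exists_linearMap (hb : IsBrauerRep ρW ρ) (hX : IsAdmissible M X)
    (h₀ : IsHighest M X B₀) {U₁ U₂ : Submodule (GroupAlg M B₀) (GroupAlg M B₀)}
    (φ : xiSum X U₁ ≃ₗ[K] xiSum X U₂)
    (hφ : ∀ (a : BrauerAlgebra M) (v v' : xiSum X U₁),
      (v' : V M X B₀) = ρ a v → (φ v' : V M X B₀) = ρ a (φ v)) :
    ∃ F : U₁ →ₗ[GroupAlg M B₀] U₂, ∀ a,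
      φ (xiSub (⟨B₀, h₀.1⟩ : Orbit M X) a) = xiSub ⟨B₀, h₀.1⟩ (F a) := by
  choose f hf using hb.exists_map_xiSub hX φ hφ ⟨B₀, h₀.1⟩
  have hinj := xiSub_injective (U := U₂) (⟨B₀, h₀.1⟩ : Orbit M X)
  have hadd : ∀ a a', f (a + a') = f a + f a' := fun a a' => hinj (by
    rw [← hf, map_add, map_add, map_add, hf, hf])
  have hsmul : ∀ (c : K) a, f (c • a) = c • f a := fun c a => hinj (by
    rw [← hf, map_smul, map_smul, map_smul, hf])
  have hof : ∀ (g : parabolic M (nodesC M B₀)) a,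
      f (MonoidAlgebra.of K _ g • a) = MonoidAlgebra.of K _ g • f a := fun g a => by
    obtain ⟨d, hd⟩ := hb.exists_rep_eq g.1
    refine hinj (Subtype.ext ?_)
    rw [← hf, hφ d (xiSub _ a) _ ?_, hf, hd, coe_xiSub, coe_xiSub, hb.rep_parabolic hX h₀]
    · rfl
    · rw [hd, coe_xiSub, coe_xiSub, hb.rep_parabolic hX h₀]
      rfl
  obtain ⟨F, hF⟩ := exists_linearMap_of_equivariant (k := K)
    (G := parabolic M (nodesC M B₀)) f hadd hsmul hof
  exact ⟨F, fun a => by rw [hf, hF]⟩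

/-- Schur's lemma: the induced map is nonzero because φ is injective. -/
theorem IsBrauerRep.nonempty_linearEquiv (hb : IsBrauerRep ρW ρ) (hX : IsAdmissible M X)
    (h₀ : IsHighest M X B₀) {U₁ U₂ : Submodule (GroupAlg M B₀) (GroupAlg M B₀)}
    (h₁ : IsSimpleModule (GroupAlg M B₀) U₁) (h₂ : IsSimpleModule (GroupAlg M B₀) U₂)
    (H : AreEquivalent ρ (xiSum X U₁) (xiSum X U₂)) : Nonempty (U₁ ≃ₗ[GroupAlg M B₀] U₂) := by
  obtain ⟨φ, hφ⟩ := H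
  obtain ⟨F, hF⟩ := hb.exists_linearMap hX h₀ φ hφ
  refine ⟨LinearEquiv.ofBijective F (F.bijective_or_eq_zero.resolve_right fun h => ?_)⟩
  obtain ⟨a, ha, ha0⟩ := Submodule.exists_mem_ne_zero_of_ne_bot (isSimpleModule_iff_isAtom.1 h₁).1
  have h4 := hF ⟨a, ha⟩
  rw [h, LinearMap.zero_apply, map_zero, LinearEquiv.map_eq_zero_iff] at h4
  exact ha0 (congrArg Subtype.val (xiSub_injective _ (h4.trans (map_zero _).symm)))

end Sums

end BrauerADE

theorem mainTheorem9 {ι : Type*} [Fintype ι] [DecidableEq ι] (M : SimpleGraph ι)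
    (hM : BrauerADE.IsADE M) (X : Set (ι → ℤ)) (hX : BrauerADE.IsAdmissible M X) :
    -- the orbit of `X` has a unique highest element
    (∃! B₀, BrauerADE.IsHighest M X B₀) ∧
    ∀ B₀, BrauerADE.IsHighest M X B₀ →
      -- the simple reflections `h_{B,i}` are well defined
      (∀ (B : BrauerADE.Orbit M X) (i : ι), BrauerADE.Perp M i B.1 →
        ∃! k, k ∈ BrauerADE.nodesC M B₀ ∧ BrauerADE.HRel M B₀ B.1 i k) ∧
      -- the representation of the Brauer algebra exists
      (∃ (ρW : BrauerADE.W M →* Module.End BrauerADE.K (BrauerADE.V M X B₀))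
        (ρ : BrauerADE.BrauerAlgebra M →+* Module.End BrauerADE.K (BrauerADE.V M X B₀)),
        BrauerADE.IsBrauerRep ρW ρ) ∧
      ∀ (ρW : BrauerADE.W M →* Module.End BrauerADE.K (BrauerADE.V M X B₀))
        (ρ : BrauerADE.BrauerAlgebra M →+* Module.End BrauerADE.K (BrauerADE.V M X B₀)),
        BrauerADE.IsBrauerRep ρW ρ →
        (∀ U₁ : Submodule (BrauerADE.GroupAlg M B₀) (BrauerADE.GroupAlg M B₀),
          IsSimpleModule (BrauerADE.GroupAlg M B₀) U₁ →
          BrauerADE.IsIrreducibleModule ρ (BrauerADE.xiSum X U₁)) ∧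
        (∀ U₁ U₂ : Submodule (BrauerADE.GroupAlg M B₀) (BrauerADE.GroupAlg M B₀),
          IsSimpleModule (BrauerADE.GroupAlg M B₀) U₁ →
          IsSimpleModule (BrauerADE.GroupAlg M B₀) U₂ →
          ¬ Nonempty (U₁ ≃ₗ[BrauerADE.GroupAlg M B₀] U₂) →
          ¬ BrauerADE.AreEquivalent ρ (BrauerADE.xiSum X U₁) (BrauerADE.xiSum X U₂)) := by
  -- Positive definiteness is all that is needed of the type of `M`.
  have := BrauerADE.posDefForm_of_isADE hM
  refine ⟨BrauerADE.existsUnique_isHighest hX, fun B₀ h₀ => ⟨fun B i hi =>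
    BrauerADE.existsUnique_hRel hX h₀ B.2 hi, BrauerADE.exists_isBrauerRep hX h₀,
    fun ρW ρ hb => ⟨fun U₁ h₁ => hb.isIrreducibleModule_xiSum hX h₀ h₁,
      fun U₁ U₂ h₁ h₂ hne heq => hne (hb.nonempty_linearEquiv hX h₀ h₁ h₂ heq)⟩⟩⟩
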